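/- **Theorem 5.2.** Let $n\ge 1$, $I=\{1,\dots,n\}$, let $(a_{i,j})$ be the Cartan matrix of type $A_n$, $N=n(n+1)/2$, and let $\lambda=\sum_i\lambda_i\Lambda_i$ with all $\lambda_i\in\mathbb Z_{\ge0}$ be a dominant integral weight. Let $\mathbf i_0=(1\,2\cdots n)(1\,2\cdots n-1)\cdots(1\,2)\,1$, and write coordinates of an $N$-dimensional space as $(x_{j;i})_{j,i\ge1,\ i+j\le n+1}$, where $(j;i)$ is the position of the letter $i$ in the $j$-th block of $\mathbf i_0$; put $x_{j;i}=0$ for other $(j;i)$. *First crystal.* Work with complex matrices of size $n+1$. Let $T$ be the torus of invertible diagonal matrices, $B^-$ the invertible lower triangular and $U$ the upper unitriangular matrices, $x_i(a)=1+aE_{i,i+1}$, $y_i(a)=1+aE_{i+1,i}$, $\alpha_i^\vee(c)$ the diagonal matrix with entries $c,c^{-1}$ at places $i,i+1$ and $1$ elsewhere, $\overline s_i=x_i(-1)y_i(1)x_i(-1)$, $\overline w_0$ the product of the $\overline s_i$ along $\mathbf i_0$, $B^-_{w_0}=B^-\cap U\overline w_0U$ and $\mathbb B=TB^-_{w_0}$.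 On $\mathbb B$ consider $\gamma_i(g)=g_{i,i}/g_{i+1,i+1}$, $\varepsilon_i(g)=g_{i+1,i+1}/g_{i+1,i}$, $\varphi_i=\varepsilon_i\gamma_i$, the rational $\mathbb C^\times$-actions $e_i^c(g)=x_i((c-1)\varphi_i(g))\,g\,x_i((c^{-1}-1)\varepsilon_i(g))$, and the decoration $$f_B(g)=\chi^{st}(\pi^+(\overline w_0^{-1}g))+\chi^{st}(\pi^+(\overline w_0^{-1}\eta(g))),$$ where $\pi^+:B^-U\to U$, $bu\mapsto u$, $\chi^{st}(u)=\sum_i u_{i,i+1}$, and $\eta$ is the anti-automorphism fixing all $x_i(a)$, $y_i(a)$ and inverting $T$. Let $\theta:T\times(\mathbb C^\times)^N\to\mathbb B$, $\theta(t,c)=t\,\mathbf y_{i_1}(c_1)\cdots\mathbf y_{i_N}(c_N)$, with $\mathbf y_i(c)=y_i(c)\alpha_i^\vee(c^{-1})$ and $(i_1,\dots,i_N)=\mathbf i_0$. For a rational function $h$ on $T\times(\mathbb C^\times)^N$ and a cocharacter $\xi\in X_*(T)\times\mathbb Z^N$ let $\mathcal{UD}(h)(\xi)$ be the order of vanishing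 at $c=0$ of $h(\xi(c))\in\mathbb C(c)$, and similarly, componentwise, for rational maps to a torus. For $\ell\in X_*(T)=\mathbb Z^{n+1}$ the crystal $B_{f_B,\Theta^-_{\mathbf i_0}}(\ell)$ is the set of $(\ell,x)$, $x\in\mathbb Z^N$, with $\mathcal{UD}(f_B\circ\theta)(\ell,x)\ge0$, with $\langle h_i,\mathrm{wt}\rangle=\mathcal{UD}(\gamma_i\circ\theta)$, $\varepsilon_i=\mathcal{UD}(\varepsilon_i\circ\theta)$, $\varphi_i=\varepsilon_i+\langle h_i,\mathrm{wt}\rangle$, $\tilde e_i^{\,m}=\mathcal{UD}((c,p)\mapsto\theta^{-1}e_i^c\theta(p))(m,\cdot)$ for $m\in\mathbb Z$ and $\tilde f_i=\tilde e_i^{\,-1}$; here $\tilde e_i,\tilde f_i$ are set to $0$ when the result leaves the set. Write $B_{f_B,\Theta^-_{\mathbf i_0}}(\lambda)$ for it when $\ell$ is a cocharacter with $\langle\ell,\alpha_i\rangle=\ell_i-\ell_{i+1}=\lambda_i$ for all $i\in I$. *Second crystal.* Let $\iota=(i_k)_{k\ge1}$ be the periodic sequence $1,2,\dots,n,1,2,\dots,n,\dots$.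 On $\mathbb Z^\infty=\{(x_k)_{k\ge1}:x_k=0\text{ for }k\gg0\}$ put $\sigma_k(x)=x_k+\sum_{j>k}a_{i_k,i_j}x_j$, $\sigma^{(i)}_0(x)=-\lambda_i+\sum_{j\ge1}a_{i,i_j}x_j$, $\sigma^{(i)}=\max_{k:i_k=i}\sigma_k$ and $M^{(i)}=\{k:i_k=i,\sigma_k(x)=\sigma^{(i)}(x)\}$. The crystal $\mathbb Z^\infty_\iota[\lambda]$ is $\mathbb Z^\infty$ with $\mathrm{wt}(x)=\lambda-\sum_jx_j\alpha_{i_j}$, $\varepsilon_i=\max(\sigma^{(i)},\sigma^{(i)}_0)$, $\varphi_i=\varepsilon_i+\langle h_i,\mathrm{wt}\rangle$; $\tilde f_i$ adds $1$ at place $\min M^{(i)}$ if $\sigma^{(i)}>\sigma_0^{(i)}$ and is $0$ otherwise; $\tilde e_i$ subtracts $1$ at place $\max M^{(i)}$ if $\sigma^{(i)}>0$ and $\sigma^{(i)}\ge\sigma^{(i)}_0$ and is $0$ otherwise. Let $k^{(+)}$ and $k^{(-)}$ be the next and the previous place with the same index as $k$, $\beta^{(+)}_k=\sigma_k-\sigma_{k^{(+)}}$,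 and $\beta^{(-)}_k=\sigma_{k^{(-)}}-\sigma_k$, or $\beta^{(-)}_k=\sigma_0^{(i_k)}-\sigma_k$ if $k^{(-)}$ does not exist. For an affine linear function $\phi=c+\sum\phi_kx_k$ put $\widehat S_k\phi=\phi-\phi_k\beta_k^{(+)}$ if $\phi_k>0$ and $\widehat S_k\phi=\phi-\phi_k\beta_k^{(-)}$ if $\phi_k\le0$. The polyhedral realization $\Sigma_\iota[\lambda]$ is the set of $x\in\mathbb Z^\infty$ at which all functions obtained by applying products of the operators $\widehat S_k$ to the $x_j$ ($j\ge1$) and to the $-\beta^{(-)}_{k}$ with $k$ the first place of an index $i\in I$ are non-negative. Put $\iota_0=\mathbf i_0^{-1}$ (the opposite word), and let $\Sigma_{\iota_0}[\lambda]$ be the set of $(x_{j;i})\in\mathbb Z^N$ with $$x_{1;i}\ge x_{2;i-1}\ge\cdots\ge x_{i;1}\ge0\quad(1\le i\le n),\qquad \lambda_i\ge x_{j;i-j+1}-x_{j;i-j}\quad(1\le j\le i\le n),$$ with the crystal structure induced from $\mathbb Z^\infty_\iota[\lambda]$ by extending families by zero, $(j;i)$ being put at place $(j-1)n+i$. Then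 $B_{f_B,\Theta^-_{\mathbf i_0}}(\lambda)$ and $\Sigma_{\iota_0}[\lambda]$ are crystals, and there is an isomorphism of crystals $$B_{f_B,\Theta^-_{\mathbf i_0}}(\lambda)\;\cong\;\Sigma_{\iota_0}[\lambda].$$ Here $\Sigma_{\iota_0}[\lambda]$ is the polyhedral realization: extension by zero is a strict embedding of crystals $\Sigma_{\iota_0}[\lambda]\hookrightarrow\mathbb Z^\infty_\iota[\lambda]$ with image $\Sigma_\iota[\lambda]$. -/

import Mathlib

noncomputable section

namespace DecCrystal

/-! ### Abstract crystals -/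

/-- The data `(B, wt, ε_i, φ_i, ẽ_i, f̃_i)` of a crystal with index set `I`.  A weight `μ` is
recorded by its values `⟨h_i, μ⟩` (coordinates with respect to the fundamental weights), and the
extra element `0` of `B ⊔ {0}` is `none`. -/
structure CrystalData (I : Type) where
  carrier : Type
  wt : carrier → I → ℤ
  eps : I → carrier → WithBot ℤ
  phi : I → carrier → WithBot ℤ
  e : I → carrier → Option carrier
  f : I → carrier → Option carrier

/-- Kashiwara's axioms of a crystal for the Cartan matrix `A = (⟨h_i, α_j⟩)`; the simple root `α_j`
is the weight `i ↦ A i j`. -/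
structure CrystalData.IsCrystal {I : Type} (B : CrystalData I) (A : Matrix I I ℤ) : Prop where
  phi_eq : ∀ i b, B.phi i b = B.eps i b + ((B.wt b i : ℤ) : WithBot ℤ)
  wt_e : ∀ i b b', B.e i b = some b' → ∀ j, B.wt b' j = B.wt b j + A j i
  eps_e : ∀ i b b', B.e i b = some b' → B.eps i b = B.eps i b' + 1
  phi_e : ∀ i b b', B.e i b = some b' → B.phi i b' = B.phi i b + 1
  wt_f : ∀ i b b', B.f i b = some b' → ∀ j, B.wt b' j = B.wt b j - A j i
  eps_f : ∀ i b b', B.f i b = some b' → B.eps i b' = B.eps i b + 1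
  phi_f : ∀ i b b', B.f i b = some b' → B.phi i b = B.phi i b' + 1
  f_iff_e : ∀ i b b', B.f i b = some b' ↔ B.e i b' = some b
  bot_zero : ∀ i b, B.phi i b = ⊥ → B.e i b = none ∧ B.f i b = none

/-- A strict morphism of crystals which sends no element to `0`: it preserves `wt`, `ε_i`, `φ_i`
and commutes with all `ẽ_i`, `f̃_i`. -/
structure IsStrictMorphism {I : Type} (B C : CrystalData I) (ψ : B.carrier → C.carrier) :
    Prop where
  wt : ∀ b, C.wt (ψ b) = B.wt b
  eps : ∀ i b, C.eps i (ψ b) = B.eps i b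
  phi : ∀ i b, C.phi i (ψ b) = B.phi i b
  e : ∀ i b, C.e i (ψ b) = (B.e i b).map ψ
  f : ∀ i b, C.f i (ψ b) = (B.f i b).map ψ

/-- `B` and `C` are isomorphic crystals. -/
def Isomorphic {I : Type} (B C : CrystalData I) : Prop :=
  ∃ ψ : B.carrier ≃ C.carrier, IsStrictMorphism B C ψ

open Classical in
/-- The crystal structure induced on `S` by a map `ι : S → C` (used for injective `ι`):
`wt`, `ε_i`, `φ_i` are restricted, and `ẽ_i`, `f̃_i` are restricted, being `0` on an element whenever
the result does not lie in `S`. -/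
def CrystalData.induced {I : Type} (C : CrystalData I) (S : Type) (ι : S → C.carrier) :
    CrystalData I where
  carrier := S
  wt b := C.wt (ι b)
  eps i b := C.eps i (ι b)
  phi i b := C.phi i (ι b)
  e i b := if h : ∃ b', C.e i (ι b) = some (ι b') then some h.choose else none
  f i b := if h : ∃ b', C.f i (ι b) = some (ι b') then some h.choose else none

/-! ### Polyhedral realizations

Sequences `(…, x₂, x₁)` in `ℤ^∞` are finitely supported functions on `ℕ`; position `k ≥ 1` of the
usual indexing is `k - 1` here. `A` is a Cartan matrix, `io = (…, i₂, i₁)` a sequence of indices in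
which every index occurs infinitely often, `lam` a weight. -/

/-- Affine linear functions `c + ∑ φ_k x_k` with integral coefficients on `ℤ^∞`. -/
abbrev AffForm : Type := ℤ × (ℕ → ℤ)

/-- The value of an affine linear function. -/
def AffForm.eval (φ : AffForm) (x : ℕ →₀ ℤ) : ℤ := φ.1 + x.sum fun k a => φ.2 k * a

section Polyhedral

variable {I : Type} (A : Matrix I I ℤ) (io : ℕ → I) (lam : I → ℤ)

/-- `σ_k(x) = x_k + ∑_{j > k} ⟨h_{i_k}, α_{i_j}⟩ x_j`. -/
def sigmaForm (k : ℕ) : AffForm :=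
  (0, fun j => if j = k then 1 else if k < j then A (io k) (io j) else 0)

/-- `σ_0^{(i)}(x) = -⟨h_i, λ⟩ + ∑_j ⟨h_i, α_{i_j}⟩ x_j`. -/
def sigmaZeroForm (i : I) : AffForm := (-lam i, fun j => A i (io j))

/-- `σ^{(i)}(x) = max_{k : i_k = i} σ_k(x)`. -/
def sigmaMax (i : I) (x : ℕ →₀ ℤ) : ℤ :=
  sSup {s | ∃ k, io k = i ∧ (sigmaForm A io k).eval x = s}

/-- `M^{(i)}(x) = {k : i_k = i, σ_k(x) = σ^{(i)}(x)}`. -/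
def sigmaArgmax (i : I) (x : ℕ →₀ ℤ) : Set ℕ :=
  {k | io k = i ∧ (sigmaForm A io k).eval x = sigmaMax A io i x}

/-- `wt(x) = λ - ∑_j x_j α_{i_j}`. -/
def seqWt (x : ℕ →₀ ℤ) (i : I) : ℤ := lam i - x.sum fun j a => a * A i (io j)

/-- `ε_i(x) = max(σ^{(i)}(x), σ_0^{(i)}(x))`. -/
def seqEps (i : I) (x : ℕ →₀ ℤ) : ℤ :=
  max (sigmaMax A io i x) ((sigmaZeroForm A io lam i).eval x)

open Classical in
/-- The crystal `ℤ^∞_ι[λ]`. -/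
def seqCrystal : CrystalData I where
  carrier := ℕ →₀ ℤ
  wt := seqWt A io lam
  eps i x := (seqEps A io lam i x : ℤ)
  phi i x := (seqWt A io lam x i + seqEps A io lam i x : ℤ)
  e i x :=
    if 0 < sigmaMax A io i x ∧ (sigmaZeroForm A io lam i).eval x ≤ sigmaMax A io i x then
      some (x - Finsupp.single (sSup (sigmaArgmax A io i x)) 1)
    else none
  f i x :=
    if (sigmaZeroForm A io lam i).eval x < sigmaMax A io i x then
      some (x + Finsupp.single (sInf (sigmaArgmax A io i x)) 1)
    else none

/-- `k^{(+)}`, the next position carrying the same index as `k`. -/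
def nextPos (k : ℕ) : ℕ := sInf {l | k < l ∧ io l = io k}

/-- `β_k^{(+)} = σ_k - σ_{k^{(+)}}`. -/
def betaPlus (k : ℕ) : AffForm := sigmaForm A io k - sigmaForm A io (nextPos io k)

open Classical in
/-- `β_k^{(-)}`: it is `σ_{k^{(-)}} - σ_k` if there is a previous position `k^{(-)}` carrying the
same index as `k`, and `σ_0^{(i_k)} - σ_k` otherwise. -/
def betaMinus (k : ℕ) : AffForm :=
  if ∃ l, l < k ∧ io l = io k then
    sigmaForm A io (sSup {l | l < k ∧ io l = io k}) - sigmaForm A io k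
  else sigmaZeroForm A io lam (io k) - sigmaForm A io k

/-- The piecewise linear operators `Ŝ_k`. -/
def sHat (k : ℕ) (φ : AffForm) : AffForm :=
  if 0 < φ.2 k then φ - φ.2 k • betaPlus A io k else φ - φ.2 k • betaMinus A io lam k

/-- The set `Ξ_ι[λ]` of affine linear functions generated by the operators `Ŝ_k` from the
coordinate functions `x_j` and the functions `λ^{(i)} = -β^{(-)}_{ι^{(i)}}`, where `ι^{(i)}` is the
first position carrying the index `i`. -/
inductive IsXi : AffForm → Prop
  | coord (j : ℕ) : IsXi (0, Pi.single j 1)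
  | first (i : I) : IsXi (-betaMinus A io lam (sInf {k | io k = i}))
  | step (k : ℕ) (φ : AffForm) : IsXi φ → IsXi (sHat A io lam k φ)

/-- The polyhedral realization `Σ_ι[λ] ⊆ ℤ^∞_ι[λ]`. -/
def polyhedral : Set (ℕ →₀ ℤ) := {x | ∀ φ, IsXi A io lam φ → 0 ≤ φ.eval x}

end Polyhedral

/-! ### Type `A_n`: positions of the longest word -/

/-- Positions `(j; i)` with `j, i ≥ 1` and `i + j ≤ n + 1` of the reduced longest word
`i_0 = (1 2 … n)(1 2 … n-1) … (1 2) 1`: the position `(j; i)` is the letter `i` in the `j`-th block.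
Both entries are shifted by one: `⟨j, i⟩` stands for `(j + 1; i + 1)`. -/
abbrev Pos (n : ℕ) : Type := Σ j : Fin n, Fin (n - (j : ℕ))

/-- The letter of the longest word at a position (shifted by one). -/
def Pos.letter {n : ℕ} (p : Pos n) : Fin n := ⟨p.2, by have := p.2.isLt; omega⟩

/-- The list of all positions, in the order in which the letters occur in `i_0`. -/
def longWord (n : ℕ) : List (Pos n) :=
  (List.finRange n).flatMap fun j : Fin n => (List.finRange (n - (j : ℕ))).map fun i => (Sigma.mk j i : Pos n)

/-- The entry `x_{j;i}`, with `j` and `i` counted from one; it is zero outside the triangle. -/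
def entry {n : ℕ} (x : Pos n → ℤ) (j i : ℕ) : ℤ :=
  if h : 1 ≤ j ∧ 1 ≤ i ∧ i + j ≤ n + 1 then x ⟨⟨j - 1, by omega⟩, ⟨i - 1, by grind⟩⟩ else 0

/-- The periodic sequence `ι = (…, n, …, 2, 1, n, …, 2, 1)`, whose first entries (read from the
right) are `1, 2, …, n, 1, 2, …`. -/
def periodicSeq (n : ℕ) [NeZero n] (k : ℕ) : Fin n := Fin.ofNat n k

/-- Extension by zero of a triangular family to an element of `ℤ^∞`, where `(j; i)` is put at
position `(j - 1) n + i`. -/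
def extendZero {n : ℕ} (x : Pos n → ℤ) : ℕ →₀ ℤ :=
  ∑ p : Pos n, Finsupp.single ((p.1 : ℕ) * n + p.2) (x p)

/-- The triangular families with `x_{1;i} ≥ x_{2;i-1} ≥ ⋯ ≥ x_{i;1} ≥ 0` for `1 ≤ i ≤ n` and
`λ_i ≥ x_{j;i-j+1} - x_{j;i-j}` for `1 ≤ j ≤ i ≤ n`. -/
def triangleSet (n : ℕ) (lam : Fin n → ℤ) : Set (Pos n → ℤ) :=
  {x | (∀ i, 1 ≤ i → i ≤ n →
          (∀ k, 1 ≤ k → k < i → entry x (k + 1) (i - k) ≤ entry x k (i + 1 - k)) ∧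
            0 ≤ entry x i 1) ∧
        ∀ (i : Fin n) (j : ℕ), 1 ≤ j → j ≤ (i : ℕ) + 1 →
          entry x j ((i : ℕ) + 1 - j + 1) - entry x j ((i : ℕ) + 1 - j) ≤ lam i}

/-- The crystal `Σ_{ι_0}[λ]`: the triangular families above, with the crystal structure induced
from `ℤ^∞_ι[λ]` for the periodic sequence `ι`. -/
def sigmaCrystal (n : ℕ) [NeZero n] (lam : Fin n → ℤ) : CrystalData (Fin n) :=
  (seqCrystal (CartanMatrix.A n) (periodicSeq n) lam).induced (triangleSet n lam)
    fun x => extendZero x.1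

/-! ### The decorated geometric crystal `(T B⁻_{w_0}, f_B)` of type `A_n`

All functions below are rational functions defined over `ℂ`; they are given through their values on
points over an arbitrary field `K`. The group is realized by matrices of size `n + 1`, with `T` the
torus of all invertible diagonal matrices. -/

section Geometric

variable {n : ℕ} {K : Type} [Field K]

/-- `x_i(a) = exp(a e_i)`. -/
def xOne (i : Fin n) (a : K) : Matrix (Fin (n + 1)) (Fin (n + 1)) K :=
  1 + Matrix.single i.castSucc i.succ a

/-- `y_i(a) = exp(a f_i)`. -/
def yOne (i : Fin n) (a : K) : Matrix (Fin (n + 1)) (Fin (n + 1)) K :=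
  1 + Matrix.single i.succ i.castSucc a

/-- The coroot `α_i^∨(c)`. -/
def corootMat (i : Fin n) (c : K) : Matrix (Fin (n + 1)) (Fin (n + 1)) K :=
  Matrix.diagonal fun k => if k = i.castSucc then c else if k = i.succ then c⁻¹ else 1

/-- The representative `s̄_i = x_i(-1) y_i(1) x_i(-1)` of the simple reflection `s_i`. -/
def sBar (i : Fin n) : Matrix (Fin (n + 1)) (Fin (n + 1)) K :=
  xOne i (-1) * yOne i 1 * xOne i (-1)

variable (n K) in
/-- The representative `w̄_0` of the longest element of the Weyl group. -/
def wZeroBar : Matrix (Fin (n + 1)) (Fin (n + 1)) K :=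
  ((longWord n).map fun p => sBar p.letter).prod

/-- Membership in `B⁻` (for an invertible matrix): lower triangular. -/
def IsLower (b : Matrix (Fin (n + 1)) (Fin (n + 1)) K) : Prop := ∀ i j, i < j → b i j = 0

/-- Membership in `U`: upper unitriangular. -/
def IsUpperUni (u : Matrix (Fin (n + 1)) (Fin (n + 1)) K) : Prop :=
  (∀ i j, j < i → u i j = 0) ∧ ∀ i, u i i = 1

open Classical in
/-- The projection `π⁺ : B⁻ U → U`, `b u ↦ u` (for invertible matrices; `u` is then unique). -/
def piPlus (g : Matrix (Fin (n + 1)) (Fin (n + 1)) K) : Matrix (Fin (n + 1)) (Fin (n + 1)) K :=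
  if h : ∃ u, IsUpperUni u ∧ ∃ b, IsLower b ∧ g = b * u then h.choose else 1

/-- The standard regular character `χ^st = ∑ χ_i` of `U`, with `χ_i(x_j(c)) = δ_{ij} c`. -/
def chiSt (u : Matrix (Fin (n + 1)) (Fin (n + 1)) K) : K := ∑ i : Fin n, u i.castSucc i.succ

/-- The positive inverse: the anti-automorphism with `x_i(c) ↦ x_i(c)`, `y_i(c) ↦ y_i(c)` and
`t ↦ t⁻¹` for `t ∈ T`. -/
def posInv (g : Matrix (Fin (n + 1)) (Fin (n + 1)) K) : Matrix (Fin (n + 1)) (Fin (n + 1)) K :=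
  Matrix.diagonal (fun k : Fin (n + 1) => (-1 : K) ^ (k : ℕ)) * g⁻¹ *
    Matrix.diagonal (fun k : Fin (n + 1) => (-1 : K) ^ (k : ℕ))

/-- The decoration `f_B(g) = χ^st(π⁺(w̄_0⁻¹ g)) + χ^st(π⁺(w̄_0⁻¹ η(g)))`, `η` the positive
inverse. -/
def decoration (g : Matrix (Fin (n + 1)) (Fin (n + 1)) K) : K :=
  chiSt (piPlus ((wZeroBar n K)⁻¹ * g)) + chiSt (piPlus ((wZeroBar n K)⁻¹ * posInv g))

/-- `γ_i`: the root `α_i` applied to the `T`-component of an element of `B⁻ ≅ T × U⁻`. -/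
def gammaFun (i : Fin n) (g : Matrix (Fin (n + 1)) (Fin (n + 1)) K) : K :=
  g i.castSucc i.castSucc / g i.succ i.succ

/-- `ε_i(g) = b₂₂ / b₂₁`, where `(b₁₁ 0; b₂₁ b₂₂)` is the `i`-th diagonal `2 × 2` block of
`g ∈ B⁻`. -/
def epsFun (i : Fin n) (g : Matrix (Fin (n + 1)) (Fin (n + 1)) K) : K :=
  g i.succ i.succ / g i.succ i.castSucc

/-- `φ_i = ε_i γ_i`. -/
def phiFun (i : Fin n) (g : Matrix (Fin (n + 1)) (Fin (n + 1)) K) : K := epsFun i g * gammaFun i g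

open Classical in
/-- The rational action
`e_i^c(g) = x_i((c - 1) φ_i(g)) g x_i((c⁻¹ - 1) ε_i(g))`, and `e_i^c(g) = g` if `b₂₁ = 0`. -/
def eAct (i : Fin n) (c : K) (g : Matrix (Fin (n + 1)) (Fin (n + 1)) K) :
    Matrix (Fin (n + 1)) (Fin (n + 1)) K :=
  if g i.succ i.castSucc = 0 then g
  else xOne i ((c - 1) * phiFun i g) * g * xOne i ((c⁻¹ - 1) * epsFun i g)

variable (n K) in
/-- The `K`-points of the torus `T' = T × (ℂ^×)^N`. -/
abbrev TorusPt : Type := (Fin (n + 1) → Kˣ) × (Pos n → Kˣ)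

/-- The positive structure `TΘ⁻_{i_0} : T × (ℂ^×)^N → T B⁻_{w_0}`, where
`B⁻_{w_0} = B⁻ ∩ U w̄_0 U`; it is given by `TΘ⁻_{i_0}(t, c) = t 𝐲_{i_1}(c_1) ⋯ 𝐲_{i_N}(c_N)`, where
`𝐲_i(c) = y_i(c) α_i^∨(c⁻¹)`. -/
def chart (p : TorusPt n K) : Matrix (Fin (n + 1)) (Fin (n + 1)) K :=
  Matrix.diagonal (fun k => (p.1 k : K)) *
    ((longWord n).map fun q =>
      yOne q.letter (p.2 q : K) * corootMat q.letter ((p.2 q : K)⁻¹)).prod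

instance : Nonempty (TorusPt n K) := ⟨(fun _ => 1, fun _ => 1)⟩

/-- The inverse of the (injective) positive structure, on its image. -/
def chartInv : Matrix (Fin (n + 1)) (Fin (n + 1)) K → TorusPt n K := Function.invFun chart

/-- The action in the chart, `e_{i,θ}(c, p) = θ⁻¹(e_i^c(θ(p)))`. -/
def eChart (i : Fin n) (c : K) (p : TorusPt n K) : TorusPt n K := chartInv (eAct i c (chart p))

end Geometric

/-! ### Ultra-discretization -/

/-- The valuation `v` on `ℂ(c)^×`: the order of vanishing at `c = 0`, so `v(c) = 1` and
`v(f + g) = min(v(f), v(g))` for positive `f`, `g`. -/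
def ordZero (f : RatFunc ℂ) : ℤ :=
  (f.num.rootMultiplicity 0 : ℤ) - (f.denom.rootMultiplicity 0 : ℤ)

/-- The element `c` of `ℂ(c)^×`. -/
def cUnit : (RatFunc ℂ)ˣ := Units.mk0 RatFunc.X RatFunc.X_ne_zero

/-- The lattice of cocharacters `X_*(T') = X_*(T) × ℤ^N` of `T' = T × (ℂ^×)^N`. -/
abbrev Cochar (n : ℕ) : Type := (Fin (n + 1) → ℤ) × (Pos n → ℤ)

/-- A cocharacter `ξ : ℂ^× → T'`, as the `ℂ(c)`-point `ξ(c)` of `T'`. -/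
def Cochar.toPt {n : ℕ} (ξ : Cochar n) : TorusPt n (RatFunc ℂ) :=
  (fun k => cUnit ^ ξ.1 k, fun p => cUnit ^ ξ.2 p)

section UD

variable {n : ℕ}

/-- `UD(f_B ∘ θ)(ξ) = v(f_B(θ(ξ(c))))`. -/
def udDecoration (ξ : Cochar n) : ℤ := ordZero (decoration (chart ξ.toPt))

/-- `UD(γ_i ∘ θ)`. -/
def udGamma (i : Fin n) (ξ : Cochar n) : ℤ := ordZero (gammaFun i (chart ξ.toPt))

/-- `UD(ε_i ∘ θ)`. -/
def udEps (i : Fin n) (ξ : Cochar n) : ℤ := ordZero (epsFun i (chart ξ.toPt))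

/-- `UD(e_{i,θ}) : ℤ × X_*(T') → X_*(T')`, with `m` the cocharacter `c ↦ c ^ m` of `ℂ^×`. -/
def udE (i : Fin n) (m : ℤ) (ξ : Cochar n) : Cochar n :=
  let p := eChart i ((cUnit ^ m : (RatFunc ℂ)ˣ) : RatFunc ℂ) ξ.toPt
  (fun k => ordZero (p.1 k : RatFunc ℂ), fun q => ordZero (p.2 q : RatFunc ℂ))

end UD

/-- The free crystal `UD(T B⁻_{w_0})` on `X_*(T) × ℤ^N`: `wt_i`, `ε_i` are the
ultra-discretizations of `γ_i`, `ε_i`, and `ẽ_i^m = UD(e_{i,θ})(m, ·)` for `m ∈ ℤ`, `f̃_i = ẽ_i⁻¹`. -/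
def udCrystal (n : ℕ) : CrystalData (Fin n) where
  carrier := Cochar n
  wt ξ i := udGamma i ξ
  eps i ξ := (udEps i ξ : ℤ)
  phi i ξ := (udEps i ξ + udGamma i ξ : ℤ)
  e i ξ := some (udE i 1 ξ)
  f i ξ := some (udE i (-1) ξ)

/-- The set `{(ℓ, x) ∈ X_*(T) × ℤ^N : UD(f_B)(ℓ, x) ≥ 0}` over a fixed cocharacter `ℓ` of `T`. -/
def decoratedSet (n : ℕ) (l : Fin (n + 1) → ℤ) : Set (Cochar n) :=
  {ξ | ξ.1 = l ∧ 0 ≤ udDecoration ξ}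

/-- The crystal `B_{f_B, Θ⁻_{i_0}}(λ^∨)`, for the cocharacter `λ^∨ = l` of `T`: the restriction of
the free crystal to the set above. -/
def decoratedCrystal (n : ℕ) (l : Fin (n + 1) → ℤ) : CrystalData (Fin n) :=
  (udCrystal n).induced (decoratedSet n l) Subtype.val

end DecCrystal

end

/-!
The isomorphism is the identity on coordinates: it sends `(ℓ, x)` to `x`.  Both sides are computed
explicitly, and they agree.

*The polyhedral side.*  Write an element of `ℤ^∞` as an array with rows (blocks) `j` and columns
(letters) `b`.  Starting from the coordinate functions, the operators `Ŝ_k` move single boxes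
`y_{j;b} - y_{j+1;b-1}` along their rows, so they generate only sums of boxes (`IsBoxSum.sHat`).
Starting from the functions `-β^{(-)}` at the first places they generate only the functions
`λ_i - y_{j;i-j+1} + y_{j;i-j}` and `0` (`sHat_capForm`).  All single boxes and all these functions
do occur, so `Σ_ι[λ]` is cut out by them (`mem_polyhedral_iff`); the boxes force an element to
vanish outside the triangle.  On this set `σ_0^{(i)} ≤ σ^{(i)}` and `σ^{(i)}` is attained inside the
triangle, hence `ε_i = σ^{(i)}`.  There `ẽ_i` and `f̃_i` change the entry at the last, respectively
first, position where `σ^{(i)}` is attained, and they are `0` exactly if the result would leave the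
set (`triangle_e_iff`, `triangle_f_iff`).

*The decoration.*  The factors of `θ` that belong to one block multiply to a lower bidiagonal
matrix.  Adding the blocks from the right, one at a time, gives a factorization
`θ(t, c) = t u₁ w̄_0 u₂` with explicit entries of `u₁`, `u₂` next to the diagonal
(`IsGaussPair.succ`).  So `f_B ∘ θ` is a sum of Laurent monomials with coefficients `1`
(`decoration_chart`), and it has non-negative order on `ξ(c)` if and only if all exponents are
non-negative, because a sum of powers of `c` has no cancellation in lowest order
(`ordZero_sum_X_zpow`).  These are the inequalities of the triangle (`zero_le_udDecoration_iff`).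

*The action.*  One moves `x_i(z)` through `θ(t, c)` from left to right.  This changes only the
coordinates with letter `i`, and with `D_k` the sum of the monomials of `1 / ε_i`, those before the
place `k` being multiplied by `a`, the coordinate at place `k` is multiplied by `D_k / D_{k+1}`
(`eAct_chart`).  The monomials of `1 / ε_i` have the exponents `-σ_k`, so `ε_i` becomes the maximum
of the `σ_k`, and for `a = c^{±1}` the quotients `D_k / D_{k+1}` have order `0` except at the last,
respectively first, position where the maximum is attained, where it is `∓1` (`udE_eq`).
-/

namespace DecCrystal

/-! ### Abstract crystals: induced structures and transport along strict morphisms -/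

lemma CrystalData.induced_e_iff {I : Type} {C : CrystalData I} {S : Type} {ι : S → C.carrier}
    (hι : Function.Injective ι) (i : I) (b b' : S) :
    (C.induced S ι).e i b = some b' ↔ C.e i (ι b) = some (ι b') := by
  by_cases h : ∃ b', C.e i (ι b) = some (ι b')
  · obtain ⟨c, hc, hs⟩ : ∃ c : S, (C.induced S ι).e i b = some c ∧ C.e i (ι b) = some (ι c) :=
      ⟨h.choose, dif_pos h, h.choose_spec⟩
    rw [hc, hs, Option.some_inj, hι.eq_iff]
    exact Option.some_inj
  · have he : (C.induced S ι).e i b = none := dif_neg h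
    rw [he]
    refine ⟨fun h' => by simp at h', fun h' => (h ⟨b', h'⟩).elim⟩

lemma CrystalData.induced_f_iff {I : Type} {C : CrystalData I} {S : Type} {ι : S → C.carrier}
    (hι : Function.Injective ι) (i : I) (b b' : S) :
    (C.induced S ι).f i b = some b' ↔ C.f i (ι b) = some (ι b') := by
  by_cases h : ∃ b', C.f i (ι b) = some (ι b')
  · obtain ⟨c, hc, hs⟩ : ∃ c : S, (C.induced S ι).f i b = some c ∧ C.f i (ι b) = some (ι c) :=
      ⟨h.choose, dif_pos h, h.choose_spec⟩
    rw [hc, hs, Option.some_inj, hι.eq_iff]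
    exact Option.some_inj
  · have he : (C.induced S ι).f i b = none := dif_neg h
    rw [he]
    refine ⟨fun h' => by simp at h', fun h' => (h ⟨b', h'⟩).elim⟩

/-- A subset of a crystal which is stable under all `ẽ_i`, `f̃_i` is strictly embedded. -/
lemma CrystalData.induced_isStrictMorphism {I : Type} {C : CrystalData I} {S : Type}
    {ι : S → C.carrier} (hι : Function.Injective ι)
    (he : ∀ i b c, C.e i (ι b) = some c → ∃ b', ι b' = c)
    (hf : ∀ i b c, C.f i (ι b) = some c → ∃ b', ι b' = c) :
    IsStrictMorphism (C.induced S ι) C ι where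
  wt _ := rfl
  eps _ _ := rfl
  phi _ _ := rfl
  e i b := by
    cases h : C.e i (ι b) with
    | none =>
      have : (C.induced S ι).e i b = none := dif_neg (by simp [h])
      rw [this]; rfl
    | some c =>
      obtain ⟨b', rfl⟩ := he i b c h
      rw [(CrystalData.induced_e_iff hι i b b').2 h]; rfl
  f i b := by
    cases h : C.f i (ι b) with
    | none =>
      have : (C.induced S ι).f i b = none := dif_neg (by simp [h])
      rw [this]; rfl
    | some c =>
      obtain ⟨b', rfl⟩ := hf i b c h
      rw [(CrystalData.induced_f_iff hι i b b').2 h]; rfl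

/-- Kashiwara's axioms are inherited along injective strict morphisms. -/
lemma CrystalData.IsCrystal.of_isStrictMorphism {I : Type} {A : Matrix I I ℤ}
    {B C : CrystalData I} {ψ : B.carrier → C.carrier} (hC : C.IsCrystal A)
    (hψ : IsStrictMorphism B C ψ) (hinj : Function.Injective ψ) : B.IsCrystal A := by
  have hme : ∀ i b b', B.e i b = some b' ↔ C.e i (ψ b) = some (ψ b') := by
    intro i b b'
    rw [hψ.e]
    cases h : B.e i b <;> simp [hinj.eq_iff]
  have hmf : ∀ i b b', B.f i b = some b' ↔ C.f i (ψ b) = some (ψ b') := by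
    intro i b b'
    rw [hψ.f]
    cases h : B.f i b <;> simp [hinj.eq_iff]
  have hw := hψ.wt
  have hε := hψ.eps
  have hφ := hψ.phi
  constructor
  · intro i b; rw [← hw, ← hε, ← hφ]; exact hC.phi_eq i _
  · intro i b b' h; rw [← hw, ← hw]; exact hC.wt_e i _ _ ((hme i b b').1 h)
  · intro i b b' h; rw [← hε, ← hε]; exact hC.eps_e i _ _ ((hme i b b').1 h)
  · intro i b b' h; rw [← hφ, ← hφ]; exact hC.phi_e i _ _ ((hme i b b').1 h)
  · intro i b b' h; rw [← hw, ← hw]; exact hC.wt_f i _ _ ((hmf i b b').1 h)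
  · intro i b b' h; rw [← hε, ← hε]; exact hC.eps_f i _ _ ((hmf i b b').1 h)
  · intro i b b' h; rw [← hφ, ← hφ]; exact hC.phi_f i _ _ ((hmf i b b').1 h)
  · intro i b b'; rw [hme, hmf]; exact hC.f_iff_e i _ _
  · intro i b h
    rw [← hφ] at h
    have h' := hC.bot_zero i _ h
    rw [hψ.e, hψ.f] at h'
    simpa using h'

/-! ### Affine linear functions -/

lemma AffForm.eval_add (φ ψ : AffForm) (x : ℕ →₀ ℤ) :
    (φ + ψ).eval x = φ.eval x + ψ.eval x := by
  simp only [AffForm.eval, Finsupp.sum, Prod.fst_add, Prod.snd_add, Pi.add_apply, add_mul,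
    Finset.sum_add_distrib]
  ring

lemma AffForm.eval_sub (φ ψ : AffForm) (x : ℕ →₀ ℤ) :
    (φ - ψ).eval x = φ.eval x - ψ.eval x := by
  simp only [AffForm.eval, Finsupp.sum, Prod.fst_sub, Prod.snd_sub, Pi.sub_apply, sub_mul,
    Finset.sum_sub_distrib]
  ring

lemma AffForm.eval_zero (x : ℕ →₀ ℤ) : (0 : AffForm).eval x = 0 := by
  simp [AffForm.eval, Finsupp.sum]

lemma AffForm.eval_neg (φ : AffForm) (x : ℕ →₀ ℤ) : (-φ).eval x = -φ.eval x := by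
  rw [← zero_sub, AffForm.eval_sub, AffForm.eval_zero, zero_sub]

lemma AffForm.eval_sum {α : Type*} (s : Finset α) (φ : α → AffForm) (x : ℕ →₀ ℤ) :
    (∑ a ∈ s, φ a).eval x = ∑ a ∈ s, (φ a).eval x := by
  classical
  induction s using Finset.induction_on with
  | empty => simp [AffForm.eval_zero]
  | insert a s ha ih => rw [Finset.sum_insert ha, Finset.sum_insert ha, AffForm.eval_add, ih]

lemma AffForm.eval_const (c : ℤ) (x : ℕ →₀ ℤ) : AffForm.eval (c, 0) x = c := by
  simp [AffForm.eval, Finsupp.sum]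

lemma AffForm.eval_single (k : ℕ) (x : ℕ →₀ ℤ) :
    AffForm.eval (0, Pi.single k 1) x = x k := by
  simp only [AffForm.eval, zero_add]
  rw [Finsupp.sum, Finset.sum_eq_single k]
  · simp
  · intro b _ hb; simp [hb]
  · intro h; simp [Finsupp.notMem_support_iff.1 h]

lemma AffForm.eval_add_single (φ : AffForm) (x : ℕ →₀ ℤ) (k : ℕ) (a : ℤ) :
    φ.eval (x + Finsupp.single k a) = φ.eval x + φ.2 k * a := by
  simp only [AffForm.eval]
  rw [Finsupp.sum_add_index' (by simp) (by intros; ring), Finsupp.sum_single_index (by simp)]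
  ring

/-! ### The crystal `ℤ^∞_ι[λ]` -/

section Polyhedral

variable {I : Type} (A : Matrix I I ℤ) (io : ℕ → I) (lam : I → ℤ)

lemma sigmaForm_eval_add_single (x : ℕ →₀ ℤ) (k m : ℕ) (a : ℤ) :
    (sigmaForm A io k).eval (x + Finsupp.single m a) = (sigmaForm A io k).eval x +
      (if m = k then 1 else if k < m then A (io k) (io m) else 0) * a := by
  rw [AffForm.eval_add_single]; rfl

lemma sigmaZeroForm_eval_add_single (i : I) (x : ℕ →₀ ℤ) (m : ℕ) (a : ℤ) :
    (sigmaZeroForm A io lam i).eval (x + Finsupp.single m a) =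
      (sigmaZeroForm A io lam i).eval x + A i (io m) * a := by
  rw [AffForm.eval_add_single]; rfl

lemma seqWt_add_single (x : ℕ →₀ ℤ) (m : ℕ) (a : ℤ) (j : I) :
    seqWt A io lam (x + Finsupp.single m a) j = seqWt A io lam x j - a * A j (io m) := by
  simp only [seqWt]
  rw [Finsupp.sum_add_index' (by simp) (by intros; ring), Finsupp.sum_single_index (by simp)]
  ring

/-- `σ_k(x)` vanishes beyond the support of `x`. -/
lemma exists_sigmaForm_eval_eq_zero (x : ℕ →₀ ℤ) :
    ∃ N, ∀ k, N ≤ k → (sigmaForm A io k).eval x = 0 := by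
  refine ⟨x.support.sup id + 1, fun k hk => ?_⟩
  simp only [AffForm.eval, sigmaForm, zero_add]
  refine Finset.sum_eq_zero fun j hj => ?_
  have : j ≤ x.support.sup id := Finset.le_sup (f := id) hj
  change (if j = k then 1 else if k < j then A (io k) (io j) else 0) * x j = 0
  rw [if_neg (by omega), if_neg (by omega), zero_mul]

variable {A io lam} in
/-- If `σ_k(x)` is the largest of the `σ_l(x)` with `i_l = i`, then it is `σ^{(i)}(x)`. -/
lemma sigmaMax_eq {i : I} {x : ℕ →₀ ℤ} {k : ℕ} (hk : io k = i)
    (h : ∀ l, io l = i → (sigmaForm A io l).eval x ≤ (sigmaForm A io k).eval x) :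
    sigmaMax A io i x = (sigmaForm A io k).eval x := by
  refine (IsGreatest.csSup_eq (a := (sigmaForm A io k).eval x) ⟨⟨k, hk, rfl⟩, ?_⟩)
  rintro _ ⟨l, hl, rfl⟩
  exact h l hl

variable {A io} in
lemma bddAbove_sigma (i : I) (x : ℕ →₀ ℤ) :
    BddAbove {s | ∃ k, io k = i ∧ (sigmaForm A io k).eval x = s} := by
  obtain ⟨N, hN⟩ := exists_sigmaForm_eval_eq_zero A io x
  have hfin : (Set.range fun k : Fin (N + 1) => (sigmaForm A io k).eval x).Finite :=
    Set.finite_range _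
  refine hfin.bddAbove.mono ?_
  rintro _ ⟨k, _, rfl⟩
  by_cases hk : k < N
  · exact ⟨⟨k, by omega⟩, rfl⟩
  · refine ⟨⟨N, by omega⟩, ?_⟩
    simp only [hN N le_rfl, hN k (by omega)]

variable {A io} in
lemma sigmaForm_eval_le_sigmaMax {i : I} (x : ℕ →₀ ℤ) {k : ℕ} (hk : io k = i) :
    (sigmaForm A io k).eval x ≤ sigmaMax A io i x :=
  le_csSup (bddAbove_sigma i x) ⟨k, hk, rfl⟩

variable {A io} in
lemma sigmaMax_nonneg (hio : ∀ i N, ∃ k, N ≤ k ∧ io k = i) (i : I) (x : ℕ →₀ ℤ) :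
    0 ≤ sigmaMax A io i x := by
  obtain ⟨N, hN⟩ := exists_sigmaForm_eval_eq_zero A io x
  obtain ⟨k, hk, hi⟩ := hio i N
  rw [← hN k hk]
  exact sigmaForm_eval_le_sigmaMax x hi

variable {A io} in
lemma sigmaArgmax_nonempty (hio : ∀ i N, ∃ k, N ≤ k ∧ io k = i) (i : I) (x : ℕ →₀ ℤ) :
    (sigmaArgmax A io i x).Nonempty := by
  obtain ⟨k, _, hk⟩ := hio i 0
  have hne : {s | ∃ k, io k = i ∧ (sigmaForm A io k).eval x = s}.Nonempty := ⟨_, k, hk, rfl⟩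
  obtain ⟨l, hl, h⟩ := Int.csSup_mem hne (bddAbove_sigma i x)
  exact ⟨l, hl, h⟩

variable {A io} in
/-- The smallest element of `M^{(i)}(x)`. -/
lemma exists_first_argmax (hio : ∀ i N, ∃ k, N ≤ k ∧ io k = i) (i : I) (x : ℕ →₀ ℤ) :
    ∃ k, io k = i ∧ (∀ l, io l = i → (sigmaForm A io l).eval x ≤ (sigmaForm A io k).eval x) ∧
      ∀ l < k, io l = i → (sigmaForm A io l).eval x < (sigmaForm A io k).eval x := by
  have hm := Nat.sInf_mem (sigmaArgmax_nonempty (A := A) hio i x)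
  refine ⟨_, hm.1, fun l hl => ?_, fun l hlt hl => ?_⟩
  · rw [hm.2]; exact sigmaForm_eval_le_sigmaMax x hl
  · rw [hm.2]
    refine lt_of_le_of_ne (sigmaForm_eval_le_sigmaMax x hl) fun h => ?_
    exact Nat.notMem_of_lt_sInf hlt ⟨hl, h⟩

variable {A io} in
/-- The largest element of `M^{(i)}(x)`; it exists if `σ^{(i)}(x) > 0`. -/
lemma exists_last_argmax (hio : ∀ i N, ∃ k, N ≤ k ∧ io k = i) (i : I) (x : ℕ →₀ ℤ)
    (hpos : 0 < sigmaMax A io i x) :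
    ∃ k, io k = i ∧ (∀ l, io l = i → (sigmaForm A io l).eval x ≤ (sigmaForm A io k).eval x) ∧
      ∀ l, k < l → io l = i → (sigmaForm A io l).eval x < (sigmaForm A io k).eval x := by
  obtain ⟨N, hN⟩ := exists_sigmaForm_eval_eq_zero A io x
  have hb : BddAbove (sigmaArgmax A io i x) := by
    refine ⟨N, fun k hk => ?_⟩
    by_contra h
    have := hk.2
    rw [hN k (by omega)] at this
    omega
  have hm := Nat.sSup_mem (sigmaArgmax_nonempty (A := A) hio i x) hb
  refine ⟨_, hm.1, fun l hl => ?_, fun l hlt hl => ?_⟩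
  · rw [hm.2]; exact sigmaForm_eval_le_sigmaMax x hl
  · rw [hm.2]
    refine lt_of_le_of_ne (sigmaForm_eval_le_sigmaMax x hl) fun h => ?_
    exact absurd (le_csSup hb ⟨hl, h⟩) (by omega)

variable {A io} in
lemma sInf_sigmaArgmax {i : I} {x : ℕ →₀ ℤ} {k : ℕ} (hk : io k = i)
    (h : ∀ l, io l = i → (sigmaForm A io l).eval x ≤ (sigmaForm A io k).eval x)
    (h' : ∀ l < k, io l = i → (sigmaForm A io l).eval x < (sigmaForm A io k).eval x) :
    sInf (sigmaArgmax A io i x) = k := by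
  have hM := sigmaMax_eq hk h
  refine IsLeast.csInf_eq ⟨⟨hk, hM.symm⟩, fun l hl => ?_⟩
  by_contra hlt
  have h1 := h' l (by omega) hl.1
  rw [hl.2, hM] at h1
  exact lt_irrefl _ h1

variable {A io} in
lemma sSup_sigmaArgmax {i : I} {x : ℕ →₀ ℤ} {k : ℕ} (hk : io k = i)
    (h : ∀ l, io l = i → (sigmaForm A io l).eval x ≤ (sigmaForm A io k).eval x)
    (h' : ∀ l, k < l → io l = i → (sigmaForm A io l).eval x < (sigmaForm A io k).eval x) :
    sSup (sigmaArgmax A io i x) = k := by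
  have hM := sigmaMax_eq hk h
  refine IsGreatest.csSup_eq ⟨⟨hk, hM.symm⟩, fun l hl => ?_⟩
  by_contra hlt
  have h1 := h' l (by omega) hl.1
  rw [hl.2, hM] at h1
  exact lt_irrefl _ h1

variable {A io} in
/-- `ẽ_i x = y` in `ℤ^∞_ι[λ]`, in terms of the last place where `σ^{(i)}(x)` is attained. -/
lemma seqCrystal_e_eq_some_iff (hio : ∀ i N, ∃ k, N ≤ k ∧ io k = i) (i : I) (x y : ℕ →₀ ℤ) :
    (seqCrystal A io lam).e i x = some y ↔
      ∃ k, io k = i ∧ (∀ l, io l = i → (sigmaForm A io l).eval x ≤ (sigmaForm A io k).eval x) ∧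
        (∀ l, k < l → io l = i → (sigmaForm A io l).eval x < (sigmaForm A io k).eval x) ∧
        0 < (sigmaForm A io k).eval x ∧
        (sigmaZeroForm A io lam i).eval x ≤ (sigmaForm A io k).eval x ∧
        y = x - Finsupp.single k 1 := by
  simp only [seqCrystal]
  constructor
  · intro h
    split_ifs at h with hc
    obtain ⟨k, hk, h1, h2⟩ := exists_last_argmax hio i x hc.1
    rw [sSup_sigmaArgmax hk h1 h2, Option.some_inj] at h
    rw [sigmaMax_eq hk h1] at hc
    exact ⟨k, hk, h1, h2, hc.1, hc.2, h.symm⟩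
  · rintro ⟨k, hk, h1, h2, h3, h4, rfl⟩
    rw [sigmaMax_eq hk h1, if_pos ⟨h3, h4⟩, sSup_sigmaArgmax hk h1 h2]

variable {A io} in
/-- `f̃_i x = y` in `ℤ^∞_ι[λ]`, in terms of the first place where `σ^{(i)}(x)` is attained. -/
lemma seqCrystal_f_eq_some_iff (hio : ∀ i N, ∃ k, N ≤ k ∧ io k = i) (i : I) (x y : ℕ →₀ ℤ) :
    (seqCrystal A io lam).f i x = some y ↔
      ∃ k, io k = i ∧ (∀ l, io l = i → (sigmaForm A io l).eval x ≤ (sigmaForm A io k).eval x) ∧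
        (∀ l < k, io l = i → (sigmaForm A io l).eval x < (sigmaForm A io k).eval x) ∧
        (sigmaZeroForm A io lam i).eval x < (sigmaForm A io k).eval x ∧
        y = x + Finsupp.single k 1 := by
  simp only [seqCrystal]
  constructor
  · intro h
    split_ifs at h with hc
    obtain ⟨k, hk, h1, h2⟩ := exists_first_argmax (A := A) hio i x
    rw [sInf_sigmaArgmax hk h1 h2, Option.some_inj] at h
    rw [sigmaMax_eq hk h1] at hc
    exact ⟨k, hk, h1, h2, hc, h.symm⟩
  · rintro ⟨k, hk, h1, h2, h3, rfl⟩
    rw [sigmaMax_eq hk h1, if_pos h3, sInf_sigmaArgmax hk h1 h2]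

variable {A io} in
/-- Subtracting `1` at the last place where `σ^{(i)}` is attained makes it the first such place. -/
lemma seqCrystal_f_of_e (hA : ∀ i, A i i = 2) (hio : ∀ i N, ∃ k, N ≤ k ∧ io k = i) (i : I)
    (x y : ℕ →₀ ℤ) (h : (seqCrystal A io lam).e i x = some y) :
    (seqCrystal A io lam).f i y = some x ∧
      (∀ j, seqWt A io lam y j = seqWt A io lam x j + A j i) ∧
      seqEps A io lam i x = seqEps A io lam i y + 1 := by
  rw [seqCrystal_e_eq_some_iff lam hio] at h
  obtain ⟨k, rfl, h1, h2, h3, h4, rfl⟩ := h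
  have hσ : ∀ l, io l = io k → (sigmaForm A io l).eval (x - Finsupp.single k 1) =
      (sigmaForm A io l).eval x - (if k = l then 1 else if l < k then 2 else 0) := by
    intro l hl
    rw [sub_eq_add_neg, ← Finsupp.single_neg, sigmaForm_eval_add_single, hl, hA]
    split_ifs <;> ring
  have hσ0 : (sigmaZeroForm A io lam (io k)).eval (x - Finsupp.single k 1) =
      (sigmaZeroForm A io lam (io k)).eval x - 2 := by
    rw [sub_eq_add_neg, ← Finsupp.single_neg, sigmaZeroForm_eval_add_single, hA]; ring
  have hk' := hσ k rfl
  simp only [if_true] at hk'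
  have hle : ∀ l, io l = io k → (sigmaForm A io l).eval (x - Finsupp.single k 1) ≤
      (sigmaForm A io k).eval (x - Finsupp.single k 1) := by
    intro l hl
    rw [hσ l hl, hk']
    have a1 := h1 l hl
    split_ifs with c1 c2
    · omega
    · omega
    · have := h2 l (by omega) hl
      omega
  refine ⟨?_, ?_, ?_⟩
  · rw [seqCrystal_f_eq_some_iff lam hio]
    refine ⟨k, rfl, hle, fun l hlk hl => ?_, ?_, by simp⟩
    · rw [hσ l hl, hk', if_neg (by omega), if_pos hlk]
      have := h1 l hl
      omega
    · rw [hσ0, hk']; omega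
  · intro j
    rw [sub_eq_add_neg, ← Finsupp.single_neg, seqWt_add_single]; ring
  · simp only [seqEps]
    rw [sigmaMax_eq rfl h1, sigmaMax_eq rfl hle, hk', hσ0]
    omega

variable {A io} in
lemma seqCrystal_e_of_f (hA : ∀ i, A i i = 2) (hio : ∀ i N, ∃ k, N ≤ k ∧ io k = i) (i : I)
    (x y : ℕ →₀ ℤ) (h : (seqCrystal A io lam).f i x = some y) :
    (seqCrystal A io lam).e i y = some x := by
  have hnn := sigmaMax_nonneg (A := A) hio i x
  rw [seqCrystal_f_eq_some_iff lam hio] at h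
  obtain ⟨k, rfl, h1, h2, h3, rfl⟩ := h
  have hσ : ∀ l, io l = io k → (sigmaForm A io l).eval (x + Finsupp.single k 1) =
      (sigmaForm A io l).eval x + (if k = l then 1 else if l < k then 2 else 0) := by
    intro l hl
    rw [sigmaForm_eval_add_single, hl, hA, mul_one]
  have hσ0 : (sigmaZeroForm A io lam (io k)).eval (x + Finsupp.single k 1) =
      (sigmaZeroForm A io lam (io k)).eval x + 2 := by
    rw [sigmaZeroForm_eval_add_single, hA, mul_one]
  rw [sigmaMax_eq rfl h1] at hnn
  have hk' := hσ k rfl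
  simp only [if_true] at hk'
  rw [seqCrystal_e_eq_some_iff lam hio]
  refine ⟨k, rfl, fun l hl => ?_, fun l hlk hl => ?_, by omega, by omega, by simp⟩
  · rw [hσ l hl, hk']
    have a1 := h1 l hl
    split_ifs with c1 c2
    · omega
    · have := h2 l c2 hl
      omega
    · omega
  · rw [hσ l hl, hk', if_neg (by omega), if_neg (by omega)]
    have := h1 l hl
    omega

variable {A io} in
lemma seqCrystal_isCrystal (hA : ∀ i, A i i = 2) (hio : ∀ i N, ∃ k, N ≤ k ∧ io k = i) :
    (seqCrystal A io lam).IsCrystal A := by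
  have key := seqCrystal_f_of_e lam hA hio
  have key' := seqCrystal_e_of_f lam hA hio
  have hc : ∀ a b : ℤ, ((a : ℤ) : WithBot ℤ) = (b : ℤ) + 1 ↔ a = b + 1 := by
    intro a b
    rw [← WithBot.coe_one, ← WithBot.coe_add, WithBot.coe_inj]
  constructor
  · intro i b
    change ((seqWt A io lam b i + seqEps A io lam i b : ℤ) : WithBot ℤ) =
      ((seqEps A io lam i b : ℤ) : WithBot ℤ) + ((seqWt A io lam b i : ℤ) : WithBot ℤ)
    rw [← WithBot.coe_add, add_comm]
  · intro i b b' h j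
    exact (key i b b' h).2.1 j
  · intro i b b' h
    exact (hc _ _).2 (key i b b' h).2.2
  · intro i b b' h
    refine (hc _ _).2 ?_
    have h1 := (key i b b' h).2.2
    have h2 := (key i b b' h).2.1 i
    rw [hA] at h2
    omega
  · intro i b b' h j
    have := (key i b' b (key' i b b' h)).2.1 j
    exact eq_sub_of_add_eq this.symm
  · intro i b b' h
    exact (hc _ _).2 (key i b' b (key' i b b' h)).2.2
  · intro i b b' h
    refine (hc _ _).2 ?_
    have h1 := (key i b' b (key' i b b' h)).2.2
    have h2 := (key i b' b (key' i b b' h)).2.1 i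
    rw [hA] at h2
    omega
  · intro i b b'
    exact ⟨key' i b b', fun h => (key i b' b h).1⟩
  · intro i b h
    exact absurd h (WithBot.coe_ne_bot)

end Polyhedral

/-! ### The periodic sequence in type `A_n`: coordinates and the forms `β_k^{(±)}` -/

/-- The entry of `y ∈ ℤ^∞` in block `j` (counted from zero) at the letter `b` (counted from one) of
the periodic sequence `1, 2, …, n, 1, 2, …, n, …`; it is `0` unless `1 ≤ b ≤ n`. -/
def grid (n : ℕ) (y : ℕ →₀ ℤ) (j b : ℕ) : ℤ :=
  if 1 ≤ b ∧ b ≤ n then y (j * n + (b - 1)) else 0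

/-- The coordinate function `y ↦ grid n y j b` as an affine linear function. -/
def coordForm (n j b : ℕ) : AffForm :=
  if 1 ≤ b ∧ b ≤ n then (0, Pi.single (j * n + (b - 1)) 1) else 0

/-- The difference of the entries `(j; b)` and `(j + 1; b - 1)`. -/
def boxForm (n j b : ℕ) : AffForm := coordForm n j b - coordForm n (j + 1) (b - 1)

/-- The inequalities of the polyhedral realization in terms of `grid`: entries decrease along
antidiagonals (which forces `y` to vanish outside the triangle `j + b ≤ n`), and
`y_{j; i-j+1} - y_{j; i-j} ≤ λ_i`. -/
structure InTriangle (n : ℕ) (lam : Fin n → ℤ) (y : ℕ →₀ ℤ) : Prop where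
  box : ∀ j b, 1 ≤ b → b ≤ n + 1 → grid n y (j + 1) (b - 1) ≤ grid n y j b
  cap : ∀ (i : Fin n) (j : ℕ), j ≤ i → grid n y j (i + 1 - j) - grid n y j (i - j) ≤ lam i

section Grid

variable {n : ℕ}

lemma coordForm_fst (j b : ℕ) : (coordForm n j b).1 = 0 := by
  unfold coordForm; split_ifs <;> rfl

lemma coordForm_snd (j b l : ℕ) :
    (coordForm n j b).2 l = if 1 ≤ b ∧ b ≤ n ∧ l = j * n + (b - 1) then 1 else 0 := by
  unfold coordForm
  split_ifs with h1 h2 h2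
  · simp [h2.2.2]
  · simp only [Pi.single_apply]
    rw [if_neg (by tauto)]
  · tauto
  · rfl

lemma coordForm_eval (j b : ℕ) (y : ℕ →₀ ℤ) : (coordForm n j b).eval y = grid n y j b := by
  unfold coordForm grid
  split_ifs
  · exact AffForm.eval_single _ _
  · exact AffForm.eval_zero _

lemma grid_zero (y : ℕ →₀ ℤ) (j : ℕ) : grid n y j 0 = 0 := by simp [grid]

lemma grid_of_lt (y : ℕ →₀ ℤ) (j b : ℕ) (h : n < b) : grid n y j b = 0 := by
  rw [grid, if_neg (by omega)]

/-- Positions `j n + r` with `r < n` are determined by `j` and `r`. -/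
lemma mul_add_inj {j r j' r' : ℕ} (hr : r < n) (hr' : r' < n) :
    j * n + r = j' * n + r' ↔ j = j' ∧ r = r' := by
  constructor
  · intro h
    have h1 := congrArg (· % n) h
    simp only [Nat.mul_add_mod_self_right, Nat.mod_eq_of_lt hr, Nat.mod_eq_of_lt hr'] at h1
    subst h1
    have h2 : j * n = j' * n := by omega
    exact ⟨Nat.eq_of_mul_eq_mul_right (by omega) h2, rfl⟩
  · rintro ⟨rfl, rfl⟩; rfl

lemma coordForm_snd_pos {j b a c : ℕ} (hc : 1 ≤ c) (hc' : c ≤ n) :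
    (coordForm n j b).2 (a * n + (c - 1)) = if j = a ∧ b = c then 1 else 0 := by
  rw [coordForm_snd]
  by_cases hb : 1 ≤ b ∧ b ≤ n
  · have := mul_add_inj (j := a) (j' := j) (r := c - 1) (r' := b - 1) (n := n)
      (by omega) (by omega)
    refine if_congr ?_ rfl rfl
    rw [this]; omega
  · rw [if_neg (by tauto), if_neg (by omega)]

lemma grid_add_single (y : ℕ →₀ ℤ) {j b a c : ℕ} (hc : 1 ≤ c) (hc' : c ≤ n) (t : ℤ) :
    grid n (y + Finsupp.single (a * n + (c - 1)) t) j b =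
      grid n y j b + if j = a ∧ b = c then t else 0 := by
  rw [← coordForm_eval, AffForm.eval_add_single, coordForm_eval, coordForm_snd_pos hc hc']
  split_ifs <;> simp

lemma add_le_of_mod_eq {k l : ℕ} (h : k < l) (hm : l % n = k % n) : k + n ≤ l := by
  have h1 : n ∣ l - k := (Nat.modEq_iff_dvd' h.le).1 (Eq.symm hm)
  have := Nat.le_of_dvd (by omega) h1
  omega

variable [NeZero n]

lemma periodicSeq_val (k : ℕ) : (periodicSeq n k : ℕ) = k % n := rfl

lemma periodicSeq_mul_add (j : ℕ) {r : ℕ} (hr : r < n) :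
    periodicSeq n (j * n + r) = ⟨r, hr⟩ :=
  Fin.ext (by rw [periodicSeq_val, Nat.mul_add_mod_self_right, Nat.mod_eq_of_lt hr])

lemma periodicSeq_eq_iff (k l : ℕ) : periodicSeq n k = periodicSeq n l ↔ k % n = l % n := by
  rw [Fin.ext_iff]; rfl

lemma periodicSeq_unbounded (i : Fin n) (N : ℕ) : ∃ k, N ≤ k ∧ periodicSeq n k = i := by
  refine ⟨N * n + i, ?_, periodicSeq_mul_add N i.isLt⟩
  have := Nat.le_mul_of_pos_right N (NeZero.pos n)
  omega

lemma nextPos_periodicSeq (k : ℕ) : nextPos (periodicSeq n) k = k + n := by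
  have hn := NeZero.pos n
  refine IsLeast.csInf_eq ⟨⟨by omega, ?_⟩, fun l hl => ?_⟩
  · rw [periodicSeq_eq_iff, Nat.add_mod_right]
  · exact add_le_of_mod_eq hl.1 ((periodicSeq_eq_iff _ _).1 hl.2)

lemma betaMinus_of_lt (lam : Fin n → ℤ) {k : ℕ} (hk : k < n) :
    betaMinus (CartanMatrix.A n) (periodicSeq n) lam k =
      sigmaZeroForm (CartanMatrix.A n) (periodicSeq n) lam (periodicSeq n k) -
        sigmaForm (CartanMatrix.A n) (periodicSeq n) k := by
  rw [betaMinus, if_neg]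
  rintro ⟨l, hl, h⟩
  have := add_le_of_mod_eq hl ((periodicSeq_eq_iff _ _).1 h.symm)
  omega

lemma betaMinus_add (lam : Fin n → ℤ) (k : ℕ) :
    betaMinus (CartanMatrix.A n) (periodicSeq n) lam (k + n) =
      betaPlus (CartanMatrix.A n) (periodicSeq n) k := by
  have hn := NeZero.pos n
  have h1 : k < k + n ∧ periodicSeq n k = periodicSeq n (k + n) :=
    ⟨by omega, by rw [periodicSeq_eq_iff, Nat.add_mod_right]⟩
  have h2 : sSup {l | l < k + n ∧ periodicSeq n l = periodicSeq n (k + n)} = k := by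
    refine IsGreatest.csSup_eq ⟨h1, fun l hl => ?_⟩
    have := add_le_of_mod_eq hl.1 ((periodicSeq_eq_iff _ _).1 hl.2.symm)
    omega
  rw [betaMinus, if_pos ⟨k, h1⟩, h2, betaPlus, nextPos_periodicSeq]

/-- `β^{(+)}` involves only the entry itself and its neighbours in the same and in the next block, since
the contributions of all places after `k^{(+)}` cancel. -/
lemma betaPlus_mul_add (j : ℕ) {b : ℕ} (hb : 1 ≤ b) (hb' : b ≤ n) :
    betaPlus (CartanMatrix.A n) (periodicSeq n) (j * n + (b - 1)) =
      coordForm n j b + coordForm n (j + 1) b - coordForm n (j + 1) (b - 1) -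
        coordForm n j (b + 1) := by
  have hn := NeZero.pos n
  rw [betaPlus, nextPos_periodicSeq]
  refine Prod.ext (by simp [sigmaForm, coordForm_fst]) (funext fun l => ?_)
  have hb1 : b - 1 < n := by omega
  have e1 : (j + 1) * n = j * n + n := by ring
  have hk := periodicSeq_mul_add j hb1
  have hk' : periodicSeq n (j * n + (b - 1) + n) = ⟨b - 1, hb1⟩ := by
    rw [← hk, periodicSeq_eq_iff, Nat.add_mod_right]
  simp only [sigmaForm, Prod.snd_sub, Prod.snd_add, Pi.sub_apply, Pi.add_apply, coordForm_snd,
    hk, hk', e1]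
  rcases lt_or_ge l (j * n) with h | h
  · generalize j * n = m at *
    grind
  rcases lt_or_ge l (j * n + n) with h1 | h1
  · obtain ⟨s, rfl⟩ := Nat.exists_eq_add_of_le h
    have hs : s < n := by omega
    rw [periodicSeq_mul_add j hs]
    generalize j * n = m at *
    simp only [CartanMatrix.A, Matrix.of_apply, Fin.mk.injEq]
    grind
  rcases lt_or_ge l (j * n + n + n) with h2 | h2
  · obtain ⟨s, rfl⟩ := Nat.exists_eq_add_of_le h1
    have hs : s < n := by omega
    have := periodicSeq_mul_add (j + 1) hs
    rw [e1] at this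
    rw [this]
    generalize j * n = m at *
    simp only [CartanMatrix.A, Matrix.of_apply, Fin.mk.injEq]
    grind
  · generalize j * n = m at *
    grind

lemma betaMinus_zero_row (lam : Fin n → ℤ) {b : ℕ} (hb : 1 ≤ b) (hb' : b ≤ n) :
    betaMinus (CartanMatrix.A n) (periodicSeq n) lam (b - 1) =
      (-lam ⟨b - 1, by omega⟩, 0) + coordForm n 0 b - coordForm n 0 (b - 1) := by
  have hb1 : b - 1 < n := by omega
  rw [betaMinus_of_lt lam hb1]
  have hk := periodicSeq_mul_add 0 hb1
  rw [zero_mul, zero_add] at hk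
  rw [hk]
  refine Prod.ext (by simp [sigmaForm, sigmaZeroForm, coordForm_fst]) (funext fun l => ?_)
  simp only [sigmaForm, sigmaZeroForm, Prod.snd_sub, Prod.snd_add, Pi.sub_apply,
    coordForm_snd, hk, zero_mul, zero_add]
  rcases lt_or_ge (b - 1) l with h | h
  · grind
  · have hl : l < n := by omega
    have := periodicSeq_mul_add 0 hl
    rw [zero_mul, zero_add] at this
    rw [this]
    simp only [CartanMatrix.A, Matrix.of_apply, Fin.mk.injEq]
    grind

lemma betaMinus_succ_row (lam : Fin n → ℤ) (j : ℕ) {b : ℕ} (hb : 1 ≤ b) (hb' : b ≤ n) :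
    betaMinus (CartanMatrix.A n) (periodicSeq n) lam ((j + 1) * n + (b - 1)) =
      coordForm n j b + coordForm n (j + 1) b - coordForm n (j + 1) (b - 1) -
        coordForm n j (b + 1) := by
  rw [← betaPlus_mul_add j hb hb', ← betaMinus_add lam]
  congr 1
  ring

end Grid

section Polyhedral

variable {n : ℕ}

/-! ### The polyhedral realization in type `A_n` -/

/-- The affine linear functions generated from the coordinate functions: sums of boxes
`(a; m a)` over a finite set `S` of rows `a`, with `m` strictly decreasing along adjacent rows
of `S`. -/
def IsBoxSum (n : ℕ) (φ : AffForm) : Prop :=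
  ∃ (S : Finset ℕ) (m : ℕ → ℕ), φ = ∑ a ∈ S, boxForm n a (m a) ∧
    (∀ a ∈ S, 1 ≤ m a ∧ m a ≤ n + 1) ∧ ∀ a ∈ S, a + 1 ∈ S → m (a + 1) < m a

/-- The function `λ_i - y_{j; i-j+1} + y_{j; i-j}`. -/
def capForm (lam : Fin n → ℤ) (i : Fin n) (j : ℕ) : AffForm :=
  (lam i, 0) - coordForm n j (i + 1 - j) + coordForm n j (i - j)

lemma boxForm_snd_pos {a m j b : ℕ} (hb : 1 ≤ b) (hb' : b ≤ n) :
    (boxForm n a m).2 (j * n + (b - 1)) =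
      (if a = j ∧ m = b then 1 else 0) - (if a + 1 = j ∧ m = b + 1 then 1 else 0) := by
  simp only [boxForm, Prod.snd_sub, Pi.sub_apply, coordForm_snd_pos hb hb']
  congr 1
  refine if_congr ?_ rfl rfl
  omega

lemma sum_boxForm_snd_pos (S : Finset ℕ) (m : ℕ → ℕ) {j b : ℕ} (hb : 1 ≤ b) (hb' : b ≤ n) :
    (∑ a ∈ S, boxForm n a (m a)).2 (j * n + (b - 1)) =
      (if j ∈ S ∧ m j = b then 1 else 0) -
        (if 1 ≤ j ∧ j - 1 ∈ S ∧ m (j - 1) = b + 1 then 1 else 0) := by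
  have h : (∑ a ∈ S, boxForm n a (m a)).2 (j * n + (b - 1)) =
      ∑ a ∈ S, (boxForm n a (m a)).2 (j * n + (b - 1)) := by
    rw [Prod.snd_sum, Finset.sum_apply]
  rw [h]
  simp only [boxForm_snd_pos hb hb', Finset.sum_sub_distrib]
  congr 1
  · by_cases hj : j ∈ S
    · rw [Finset.sum_eq_single_of_mem j hj]
      · simp [hj]
      · intro a _ ha; simp [ha]
    · rw [Finset.sum_eq_zero]
      · simp [hj]
      · intro a ha
        rw [if_neg]; rintro ⟨rfl, _⟩; exact hj ha
  · by_cases hj : 1 ≤ j ∧ j - 1 ∈ S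
    · rw [Finset.sum_eq_single_of_mem (j - 1) hj.2]
      · have : j - 1 + 1 = j := by omega
        simp [hj, this]
      · intro a _ ha
        rw [if_neg]; omega
    · rw [Finset.sum_eq_zero]
      · rw [if_neg (by tauto)]
      · intro a ha
        rw [if_neg]; rintro ⟨rfl, _⟩; exact hj ⟨by omega, by simpa using ha⟩

lemma sum_boxForm_update (S : Finset ℕ) (m : ℕ → ℕ) {a : ℕ} (ha : a ∈ S) (b : ℕ) :
    ∑ c ∈ S, boxForm n c (Function.update m a b c) =
      ∑ c ∈ S, boxForm n c (m c) - boxForm n a (m a) + boxForm n a b := by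
  rw [← Finset.add_sum_erase S _ ha, ← Finset.add_sum_erase S (fun c => boxForm n c (m c)) ha]
  rw [Function.update_self, Finset.sum_congr rfl (g := fun c => boxForm n c (m c))]
  · abel
  · intro c hc
    rw [Function.update_of_ne (Finset.ne_of_mem_erase hc)]

lemma capForm_snd_pos (lam : Fin n → ℤ) (i : Fin n) (j a : ℕ) {b : ℕ} (hb : 1 ≤ b)
    (hb' : b ≤ n) : (capForm lam i j).2 (a * n + (b - 1)) =
      (if j = a ∧ i - j = b then 1 else 0) - (if j = a ∧ i + 1 - j = b then 1 else 0) := by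
  simp only [capForm, Prod.snd_sub, Prod.snd_add, Pi.sub_apply, Pi.add_apply,
    coordForm_snd_pos hb hb', Pi.zero_apply]
  ring

/-- A coordinate function is the sum of the boxes on the antidiagonal below it. -/
lemma isBoxSum_coordForm (j : ℕ) {b : ℕ} (hb' : b ≤ n) : IsBoxSum n (coordForm n j b) := by
  refine ⟨Finset.Ico j (j + b), fun a => j + b - a, ?_, ?_, ?_⟩
  · have key : ∀ c, c ≤ b → ∑ a ∈ Finset.Ico j (j + c), boxForm n a (j + b - a) =
        coordForm n j b - coordForm n (j + c) (b - c) := by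
      intro c hc
      induction c with
      | zero => simp
      | succ c ih =>
        rw [← add_assoc, Finset.sum_Ico_succ_top (by omega), ih (by omega), boxForm]
        have e1 : j + b - (j + c) = b - c := by omega
        have e2 : b - c - 1 = b - (c + 1) := by omega
        rw [e1, e2]
        abel
    rw [key b le_rfl, Nat.sub_self]
    have : coordForm n (j + b) 0 = 0 := by simp [coordForm]
    rw [this, sub_zero]
  · intro a ha
    have := Finset.mem_Ico.1 ha
    change 1 ≤ j + b - a ∧ j + b - a ≤ n + 1
    omega
  · intro a ha ha'
    have := Finset.mem_Ico.1 ha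
    have := Finset.mem_Ico.1 ha'
    change j + b - (a + 1) < j + b - a
    omega

variable [NeZero n]

/-- A position of `ℤ^∞` as block and letter. -/
lemma exists_block_letter (k : ℕ) : ∃ j b, 1 ≤ b ∧ b ≤ n ∧ k = j * n + (b - 1) := by
  refine ⟨k / n, k % n + 1, by omega, Nat.mod_lt _ (NeZero.pos n), ?_⟩
  rw [Nat.add_sub_cancel, mul_comm]
  exact (Nat.div_add_mod k n).symm

/-- `Ŝ_k` moves a box `(j; b)` to `(j; b + 1)` or back. -/
lemma IsBoxSum.sHat {φ : AffForm} (lam : Fin n → ℤ) (hφ : IsBoxSum n φ) (k : ℕ) :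
    IsBoxSum n (sHat (CartanMatrix.A n) (periodicSeq n) lam k φ) := by
  obtain ⟨S, m, rfl, h1, h2⟩ := hφ
  obtain ⟨j, b, hb, hb', rfl⟩ := exists_block_letter (n := n) k
  have hc := sum_boxForm_snd_pos S m (j := j) hb hb'
  unfold DecCrystal.sHat
  rw [hc]
  by_cases hp : j ∈ S ∧ m j = b <;> by_cases hq : 1 ≤ j ∧ j - 1 ∈ S ∧ m (j - 1) = b + 1
  · rw [if_pos hp, if_pos hq]
    simp only [sub_self, lt_irrefl, if_false, zero_smul, sub_zero]
    exact ⟨S, m, rfl, h1, h2⟩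
  · rw [if_pos hp, if_neg hq, sub_zero, if_pos one_pos, one_smul]
    refine ⟨S, Function.update m j (b + 1), ?_, ?_, ?_⟩
    · rw [sum_boxForm_update S m hp.1, hp.2, betaPlus_mul_add j hb hb']
      simp only [boxForm, Nat.add_sub_cancel]
      abel
    · intro a ha
      have := h1 a ha
      simp only [Function.update_apply]
      split_ifs <;> omega
    · intro a ha ha'
      have h3 := h2 a ha ha'
      simp only [Function.update_apply]
      split_ifs with c1 c2 c2
      · omega
      · have h4 : j - 1 = a := by omega
        rw [h4] at hq
        rw [c1, hp.2] at h3
        have : m a ≠ b + 1 := fun h => hq ⟨by omega, ha, h⟩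
        omega
      · subst c2
        omega
      · exact h3
  · rw [if_neg hp, if_pos hq, zero_sub, if_neg (by norm_num)]
    obtain ⟨a, rfl⟩ : ∃ a, j = a + 1 := ⟨j - 1, by omega⟩
    rw [Nat.add_sub_cancel] at hq
    refine ⟨S, Function.update m a b, ?_, ?_, ?_⟩
    · rw [sum_boxForm_update S m hq.2.1, hq.2.2, betaMinus_succ_row lam a hb hb']
      simp only [boxForm, Nat.add_sub_cancel, neg_smul, one_smul]
      abel
    · intro c hc
      have := h1 c hc
      simp only [Function.update_apply]
      split_ifs <;> omega
    · intro c hc hc'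
      have h3 := h2 c hc hc'
      simp only [Function.update_apply]
      split_ifs with c1 c2 c2
      · omega
      · rw [c1, hq.2.2] at h3; omega
      · subst c2
        have : m (c + 1) ≠ b := fun h => hp ⟨hc', h⟩
        rw [hq.2.2] at h3
        omega
      · exact h3
  · rw [if_neg hp, if_neg hq, sub_zero, if_neg (lt_irrefl _), zero_smul, sub_zero]
    exact ⟨S, m, rfl, h1, h2⟩

/-- `Ŝ_k` moves a function `λ_i - y_{j; i-j+1} + y_{j; i-j}` to an adjacent value of `j`, except
that it sends the one with `j = 0` to `0` at its negative coordinate. -/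
lemma sHat_capForm (lam : Fin n → ℤ) (i : Fin n) {j : ℕ} (hj : j ≤ i) (k : ℕ) :
    sHat (CartanMatrix.A n) (periodicSeq n) lam k (capForm lam i j) = 0 ∨
      ∃ j' : ℕ, j' ≤ i ∧
        sHat (CartanMatrix.A n) (periodicSeq n) lam k (capForm lam i j) = capForm lam i j' := by
  have hi := i.isLt
  obtain ⟨a, b, hb, hb', rfl⟩ := exists_block_letter (n := n) k
  have hc := capForm_snd_pos lam i j a hb hb'
  unfold DecCrystal.sHat
  by_cases hp : j = a ∧ (i : ℕ) - j = b
  · right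
    obtain ⟨rfl, rfl⟩ := hp
    rw [if_pos ⟨rfl, rfl⟩, if_neg (by omega), sub_zero] at hc
    rw [hc, if_pos one_pos, one_smul]
    refine ⟨j + 1, by omega, ?_⟩
    rw [betaPlus_mul_add j hb hb', capForm, capForm]
    have e1 : (i : ℕ) + 1 - (j + 1) = i - j := by omega
    have e2 : (i : ℕ) - (j + 1) = i - j - 1 := by omega
    have e3 : (i : ℕ) + 1 - j = i - j + 1 := by omega
    rw [e1, e2, e3]
    abel
  by_cases hq : j = a ∧ (i : ℕ) + 1 - j = b
  · obtain ⟨rfl, rfl⟩ := hq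
    rw [if_neg (by omega), if_pos ⟨rfl, rfl⟩, zero_sub] at hc
    rw [hc, if_neg (by norm_num), neg_smul, one_smul, sub_neg_eq_add]
    rcases j with _ | j
    · left
      rw [zero_mul, zero_add, betaMinus_zero_row lam hb hb', capForm]
      have : (-lam ⟨(i : ℕ) + 1 - 0 - 1, by omega⟩, 0) = -((lam i, 0) : AffForm) := by
        ext <;> simp
      rw [this]
      simp only [Nat.sub_zero, Nat.add_sub_cancel]
      abel
    · right
      refine ⟨j, by omega, ?_⟩
      rw [betaMinus_succ_row lam j hb hb', capForm, capForm]
      have e1 : (i : ℕ) + 1 - (j + 1) = i - j := by omega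
      have e2 : (i : ℕ) - (j + 1) = i - j - 1 := by omega
      have e3 : (i : ℕ) + 1 - j = i - j + 1 := by omega
      rw [e1, e2, e3]
      abel
  · right
    refine ⟨j, hj, ?_⟩
    rw [if_neg hp, if_neg hq, sub_zero] at hc
    rw [hc, if_neg (lt_irrefl _), zero_smul, sub_zero]

lemma sInf_periodicSeq (i : Fin n) : sInf {k | periodicSeq n k = i} = i := by
  refine IsLeast.csInf_eq ⟨?_, fun l hl => ?_⟩
  · have := periodicSeq_mul_add 0 i.isLt
    rwa [zero_mul, zero_add] at this
  · have : l % n = i := by rw [← periodicSeq_val, hl]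
    rw [← this]
    exact Nat.mod_le _ _

lemma neg_betaMinus_first (lam : Fin n → ℤ) (i : Fin n) :
    -betaMinus (CartanMatrix.A n) (periodicSeq n) lam (sInf {k | periodicSeq n k = i}) =
      capForm lam i 0 := by
  have hi := i.isLt
  have := betaMinus_zero_row lam (b := i + 1) (by omega) (by omega)
  simp only [Nat.add_sub_cancel] at this
  rw [sInf_periodicSeq, this, capForm]
  have e : (-lam ⟨(i : ℕ), i.isLt⟩, 0) = -((lam i, 0) : AffForm) := by ext <;> simp
  rw [e]
  simp only [Nat.sub_zero]
  abel

/-- The functions in `Ξ_ι[λ]`: sums of boxes, the functions `capForm`, and possibly `0`. -/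
lemma isXi_classification (lam : Fin n → ℤ) {φ : AffForm}
    (hφ : IsXi (CartanMatrix.A n) (periodicSeq n) lam φ) :
    IsBoxSum n φ ∨ (∃ (i : Fin n) (j : ℕ), j ≤ i ∧ φ = capForm lam i j) ∨ φ = 0 := by
  induction hφ with
  | coord k =>
    left
    obtain ⟨j, b, hb, hb', rfl⟩ := exists_block_letter (n := n) k
    have := isBoxSum_coordForm j hb'
    rwa [coordForm, if_pos ⟨hb, hb'⟩] at this
  | first i => exact .inr (.inl ⟨i, 0, by omega, neg_betaMinus_first lam i⟩)
  | step k φ _ ih =>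
    rcases ih with h | ⟨i, j, hj, rfl⟩ | rfl
    · exact .inl (h.sHat lam k)
    · rcases sHat_capForm lam i hj k with h | ⟨j', hj', h⟩
      · exact .inr (.inr h)
      · exact .inr (.inl ⟨i, j', hj', h⟩)
    · exact .inr (.inr (by simp [sHat]))

lemma InTriangle.mem_polyhedral {lam : Fin n → ℤ} {y : ℕ →₀ ℤ} (hy : InTriangle n lam y) :
    y ∈ polyhedral (CartanMatrix.A n) (periodicSeq n) lam := by
  intro φ hφ
  rcases isXi_classification lam hφ with ⟨S, m, rfl, h1, -⟩ | ⟨i, j, hj, rfl⟩ | rfl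
  · rw [AffForm.eval_sum]
    refine Finset.sum_nonneg fun a ha => ?_
    rw [boxForm, AffForm.eval_sub, coordForm_eval, coordForm_eval, sub_nonneg]
    exact hy.box a _ (h1 a ha).1 (h1 a ha).2
  · have := hy.cap i j hj
    rw [capForm, AffForm.eval_add, AffForm.eval_sub, coordForm_eval, coordForm_eval,
      AffForm.eval_const]
    omega
  · rw [AffForm.eval_zero]

lemma isXi_boxForm (lam : Fin n → ℤ) (j : ℕ) {b : ℕ} (hb : 1 ≤ b) (hb' : b ≤ n + 1) :
    IsXi (CartanMatrix.A n) (periodicSeq n) lam (boxForm n j b) := by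
  have hn := NeZero.pos n
  induction b, hb using Nat.le_induction with
  | base =>
    have h := IsXi.coord (A := CartanMatrix.A n) (io := periodicSeq n) (lam := lam) (j * n + 0)
    have h0 : coordForm n (j + 1) 0 = 0 := by simp [coordForm]
    rw [boxForm, Nat.sub_self, h0, sub_zero, coordForm, if_pos ⟨le_rfl, hn⟩]
    exact h
  | succ b hb ih =>
    have h := IsXi.step (j * n + (b - 1)) _ (ih (by omega))
    have hc : (boxForm n j b).2 (j * n + (b - 1)) = 1 := by
      rw [boxForm_snd_pos hb (by omega), if_pos ⟨rfl, rfl⟩, if_neg (by omega), sub_zero]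
    rw [sHat, hc, if_pos one_pos, one_smul, betaPlus_mul_add j hb (by omega)] at h
    convert h using 1
    simp only [boxForm, Nat.add_sub_cancel]
    abel

lemma isXi_capForm (lam : Fin n → ℤ) (i : Fin n) (j : ℕ) (hj : j ≤ i) :
    IsXi (CartanMatrix.A n) (periodicSeq n) lam (capForm lam i j) := by
  have hi := i.isLt
  induction j with
  | zero => rw [← neg_betaMinus_first]; exact IsXi.first i
  | succ j ih =>
    have h := IsXi.step (j * n + ((i - j) - 1)) _ (ih (by omega))
    have hc : (capForm lam i j).2 (j * n + ((i - j) - 1)) = 1 := by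
      rw [capForm_snd_pos lam i j j (by omega) (by omega), if_pos ⟨rfl, rfl⟩,
        if_neg (by omega), sub_zero]
    rw [sHat, hc, if_pos one_pos, one_smul,
      betaPlus_mul_add j (by omega) (by omega)] at h
    convert h using 1
    rw [capForm, capForm]
    have e1 : (i : ℕ) + 1 - (j + 1) = i - j := by omega
    have e2 : (i : ℕ) - (j + 1) = i - j - 1 := by omega
    have e3 : (i : ℕ) + 1 - j = i - j + 1 := by omega
    rw [e1, e2, e3]
    abel

/-- The polyhedral realization `Σ_ι[λ]` is given by the triangle inequalities. -/
lemma mem_polyhedral_iff (lam : Fin n → ℤ) (y : ℕ →₀ ℤ) :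
    y ∈ polyhedral (CartanMatrix.A n) (periodicSeq n) lam ↔ InTriangle n lam y := by
  refine ⟨fun h => ⟨fun j b hb hb' => ?_, fun i j hj => ?_⟩, fun h => h.mem_polyhedral⟩
  · have := h _ (isXi_boxForm lam j hb hb')
    rwa [boxForm, AffForm.eval_sub, coordForm_eval, coordForm_eval, sub_nonneg] at this
  · have := h _ (isXi_capForm lam i j hj)
    rw [capForm, AffForm.eval_add, AffForm.eval_sub, coordForm_eval, coordForm_eval,
      AffForm.eval_const] at this
    omega

end Polyhedral

section Triangle

variable {n : ℕ}

/-! ### Extension by zero -/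

/-- The place of `ℤ^∞` (counted from zero) at which the entry at a position is put. -/
def Pos.place (p : Pos n) : ℕ := p.1 * n + p.2

lemma Pos.snd_lt (p : Pos n) : (p.2 : ℕ) < n := by have := p.2.isLt; omega

lemma Pos.fst_add_snd_lt (p : Pos n) : (p.1 : ℕ) + p.2 < n := by have := p.2.isLt; omega

lemma Pos.letter_val (p : Pos n) : (p.letter : ℕ) = p.2 := rfl

lemma Pos.ext_val {p q : Pos n} (h1 : (p.1 : ℕ) = q.1) (h2 : (p.2 : ℕ) = q.2) : p = q := by
  obtain ⟨⟨j, hj⟩, ⟨i, hi⟩⟩ := p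
  obtain ⟨⟨j', hj'⟩, ⟨i', hi'⟩⟩ := q
  simp only at h1 h2
  subst h1
  subst h2
  rfl

lemma Pos.place_injective : Function.Injective (Pos.place : Pos n → ℕ) := by
  intro p q h
  have := (mul_add_inj p.snd_lt q.snd_lt).1 h
  exact Pos.ext_val this.1 this.2

lemma Pos.place_lt_iff_of_letter_eq {p q : Pos n} (h : p.letter = q.letter) :
    p.place < q.place ↔ (p.1 : ℕ) < q.1 := by
  have h' : (p.2 : ℕ) = q.2 := congrArg Fin.val h
  have hn : 0 < n := by have := p.fst_add_snd_lt; omega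
  unfold Pos.place
  rw [h', Nat.add_lt_add_iff_right, Nat.mul_lt_mul_right hn]

/-- The position in block `j` (counted from zero) with letter `b` (counted from one). -/
def Pos.mk' (j b : ℕ) (h : 1 ≤ b ∧ j + b ≤ n) : Pos n := ⟨⟨j, by omega⟩, ⟨b - 1, by grind⟩⟩

lemma Pos.mk'_place (j b : ℕ) (h : 1 ≤ b ∧ j + b ≤ n) :
    (Pos.mk' j b h).place = j * n + (b - 1) := rfl

lemma Pos.mk'_letter (j b : ℕ) (h : 1 ≤ b ∧ j + b ≤ n) :
    ((Pos.mk' j b h).letter : ℕ) = b - 1 := rfl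

lemma extendZero_apply (x : Pos n → ℤ) (k : ℕ) :
    extendZero x k = ∑ p : Pos n, if p.place = k then x p else 0 := by
  rw [extendZero, Finsupp.finsetSum_apply]
  exact Finset.sum_congr rfl fun p _ => Finsupp.single_apply

lemma extendZero_place (x : Pos n → ℤ) (p : Pos n) : extendZero x p.place = x p := by
  rw [extendZero_apply, Finset.sum_eq_single p]
  · simp
  · intro q _ hq
    rw [if_neg fun h => hq (Pos.place_injective h)]
  · simp

lemma extendZero_of_ne (x : Pos n → ℤ) (k : ℕ) (h : ∀ p : Pos n, p.place ≠ k) :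
    extendZero x k = 0 := by
  rw [extendZero_apply]
  exact Finset.sum_eq_zero fun p _ => if_neg (h p)

lemma extendZero_injective : Function.Injective (extendZero : (Pos n → ℤ) → ℕ →₀ ℤ) := by
  intro x x' h
  funext p
  rw [← extendZero_place x p, h, extendZero_place]

lemma extendZero_add_single (x : Pos n → ℤ) (p : Pos n) (a : ℤ) :
    extendZero (x + Pi.single p a) = extendZero x + Finsupp.single p.place a := by
  have h : ∀ y : Pos n → ℤ, extendZero y = ∑ p : Pos n, Finsupp.single p.place (y p) :=
    fun _ => rfl
  simp only [h, Pi.add_apply, Finsupp.single_add, Finset.sum_add_distrib]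
  congr 1
  rw [Finset.sum_eq_single p]
  · simp
  · intro q _ hq
    simp [hq]
  · simp

lemma grid_extendZero (x : Pos n → ℤ) (j b : ℕ) :
    grid n (extendZero x) j b = if h : 1 ≤ b ∧ j + b ≤ n then x (Pos.mk' j b h) else 0 := by
  unfold grid
  split_ifs with h1 h2 h2
  · exact extendZero_place x (Pos.mk' j b h2)
  · refine extendZero_of_ne _ _ fun p hp => ?_
    have := (mul_add_inj p.snd_lt (by omega)).1 hp
    have := p.fst_add_snd_lt
    omega
  · omega
  · rfl

lemma entry_succ (x : Pos n → ℤ) (j b : ℕ) : entry x (j + 1) b = grid n (extendZero x) j b := by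
  rw [grid_extendZero, entry]
  refine dite_congr ?_ (fun h => rfl) (fun _ => rfl)
  rw [eq_iff_iff]
  omega

/-! ### The triangle inequalities and the functions `σ_k` -/

lemma InTriangle.grid_nonneg {lam : Fin n → ℤ} {y : ℕ →₀ ℤ} (hy : InTriangle n lam y)
    (j b : ℕ) : 0 ≤ grid n y j b := by
  induction b generalizing j with
  | zero => rw [grid_zero]
  | succ b ih =>
    by_cases hb : b ≤ n
    · exact (ih (j + 1)).trans (hy.box j (b + 1) (by omega) (by omega))
    · rw [grid_of_lt _ _ _ (by omega)]

lemma InTriangle.grid_eq_zero {lam : Fin n → ℤ} {y : ℕ →₀ ℤ} (hy : InTriangle n lam y)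
    (j b : ℕ) (h : n < j + b) : grid n y j b = 0 := by
  induction j generalizing b with
  | zero => exact grid_of_lt _ _ _ (by omega)
  | succ j ih =>
    by_cases hb : b ≤ n
    · have h1 := hy.box j (b + 1) (by omega) (by omega)
      rw [ih (b + 1) (by omega), Nat.add_sub_cancel] at h1
      exact le_antisymm h1 (hy.grid_nonneg _ _)
    · exact grid_of_lt _ _ _ (by omega)

lemma InTriangle.exists_extendZero {lam : Fin n → ℤ} {y : ℕ →₀ ℤ} (hy : InTriangle n lam y)
    [NeZero n] : ∃ x : Pos n → ℤ, extendZero x = y := by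
  refine ⟨fun p => y p.place, Finsupp.ext fun k => ?_⟩
  by_cases h : ∃ p : Pos n, p.place = k
  · obtain ⟨p, rfl⟩ := h
    exact extendZero_place _ p
  · push Not at h
    rw [extendZero_of_ne _ k h]
    obtain ⟨j, b, hb, hb', rfl⟩ := exists_block_letter (n := n) k
    have hjb : n < j + b := by
      by_contra hc
      exact h (Pos.mk' j b ⟨hb, by omega⟩) rfl
    have := hy.grid_eq_zero j b hjb
    rw [grid, if_pos ⟨hb, hb'⟩] at this
    exact this.symm

lemma mem_triangleSet_iff (lam : Fin n → ℤ) (x : Pos n → ℤ) :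
    x ∈ triangleSet n lam ↔
      (∀ j b, 1 ≤ b → j + b ≤ n →
        grid n (extendZero x) (j + 1) (b - 1) ≤ grid n (extendZero x) j b) ∧
      ∀ (i : Fin n) (j : ℕ), j ≤ i →
        grid n (extendZero x) j (i - j + 1) - grid n (extendZero x) j (i - j) ≤ lam i := by
  simp only [triangleSet, Set.mem_ofPred_eq]
  refine and_congr ⟨fun h j b hb hjb => ?_, fun h i hi hi' => ⟨fun k hk hki => ?_, ?_⟩⟩
    ⟨fun h i j hj => ?_, fun h i j hj hj' => ?_⟩
  · by_cases hb1 : b = 1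
    · subst hb1
      rw [Nat.sub_self, grid_zero, ← entry_succ]
      exact (h (j + 1) (by omega) (by omega)).2
    · have := (h (j + b) (by omega) (by omega)).1 (j + 1) (by omega) (by omega)
      rw [entry_succ, entry_succ] at this
      convert this using 2 <;> omega
  · have := h (k - 1) (i + 1 - k) (by omega) (by omega)
    rw [← entry_succ, ← entry_succ] at this
    convert this using 2 <;> omega
  · have := h (i - 1) 1 le_rfl (by omega)
    rw [Nat.sub_self, grid_zero, ← entry_succ] at this
    convert this using 2
    omega
  · have := h i (j + 1) (by omega) (by omega)
    rw [entry_succ, entry_succ] at this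
    convert this using 3 <;> omega
  · have := h i (j - 1) (by omega)
    rw [← entry_succ, ← entry_succ] at this
    convert this using 3 <;> omega

lemma mem_triangleSet_iff_inTriangle (lam : Fin n → ℤ) (x : Pos n → ℤ) :
    x ∈ triangleSet n lam ↔ InTriangle n lam (extendZero x) := by
  rw [mem_triangleSet_iff]
  constructor
  · rintro ⟨h1, h2⟩
    refine ⟨fun j b hb hb' => ?_, fun i j hj => ?_⟩
    · by_cases hjb : j + b ≤ n
      · exact h1 j b hb hjb
      · rw [grid_extendZero, dif_neg (by omega), grid_extendZero, dif_neg (by omega)]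
    · have := h2 i j hj
      rwa [show (i : ℕ) + 1 - j = i - j + 1 by omega]
  · rintro ⟨h1, h2⟩
    refine ⟨fun j b hb hb' => h1 j b hb (by omega), fun i j hj => ?_⟩
    have := h2 i j hj
    rwa [show (i : ℕ) + 1 - j = i - j + 1 by omega] at this

lemma image_extendZero_triangleSet [NeZero n] (lam : Fin n → ℤ) :
    extendZero '' triangleSet n lam =
      polyhedral (CartanMatrix.A n) (periodicSeq n) lam := by
  ext y
  rw [mem_polyhedral_iff]
  constructor
  · rintro ⟨x, hx, rfl⟩
    exact (mem_triangleSet_iff_inTriangle lam x).1 hx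
  · intro hy
    obtain ⟨x, rfl⟩ := hy.exists_extendZero
    exact ⟨x, (mem_triangleSet_iff_inTriangle lam x).2 hy, rfl⟩

section Sigma

variable [NeZero n]

variable (n) in
/-- The value `σ_k(y)` for the periodic sequence in type `A_n`. -/
def sigmaVal (y : ℕ →₀ ℤ) (k : ℕ) : ℤ :=
  (sigmaForm (CartanMatrix.A n) (periodicSeq n) k).eval y

lemma sigmaVal_sub (y : ℕ →₀ ℤ) (j : ℕ) {b : ℕ} (hb : 1 ≤ b) (hb' : b ≤ n) :
    sigmaVal n y (j * n + (b - 1)) - sigmaVal n y ((j + 1) * n + (b - 1)) =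
      grid n y j b + grid n y (j + 1) b - grid n y (j + 1) (b - 1) - grid n y j (b + 1) := by
  have h := congrArg (AffForm.eval · y) (betaPlus_mul_add j hb hb')
  simp only [betaPlus, nextPos_periodicSeq, AffForm.eval_sub, AffForm.eval_add,
    coordForm_eval] at h
  have e : (j + 1) * n + (b - 1) = j * n + (b - 1) + n := by ring
  rw [sigmaVal, sigmaVal, e]
  exact h

lemma sigmaZero_sub (lam : Fin n → ℤ) (y : ℕ →₀ ℤ) (i : Fin n) :
    (sigmaZeroForm (CartanMatrix.A n) (periodicSeq n) lam i).eval y - sigmaVal n y i =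
      -lam i + grid n y 0 (i + 1) - grid n y 0 i := by
  have h := congrArg (AffForm.eval · y) (neg_betaMinus_first lam i)
  rw [sInf_periodicSeq, betaMinus_of_lt lam i.isLt] at h
  have hi : periodicSeq n (i : ℕ) = i := by
    have := periodicSeq_mul_add 0 i.isLt
    rwa [zero_mul, zero_add] at this
  simp only [hi, AffForm.eval_neg, AffForm.eval_sub, AffForm.eval_add, capForm,
    coordForm_eval, AffForm.eval_const, Nat.sub_zero] at h
  rw [sigmaVal]
  linarith

/-- `σ_k` vanishes at the places outside the triangle. -/
lemma InTriangle.sigmaVal_eq_zero {lam : Fin n → ℤ} {y : ℕ →₀ ℤ} (hy : InTriangle n lam y)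
    {j b : ℕ} (hb : 1 ≤ b) (hb' : b ≤ n) (hjb : n < j + b) :
    sigmaVal n y (j * n + (b - 1)) = 0 := by
  obtain ⟨N, hN⟩ := exists_sigmaForm_eval_eq_zero (CartanMatrix.A n) (periodicSeq n) y
  have h : ∀ m, sigmaVal n y (j * n + (b - 1)) = sigmaVal n y ((j + m) * n + (b - 1)) := by
    intro m
    induction m with
    | zero => rfl
    | succ m ih =>
      have := sigmaVal_sub y (j + m) hb hb'
      rw [hy.grid_eq_zero _ _ (by omega), hy.grid_eq_zero _ _ (by omega),
        hy.grid_eq_zero _ _ (by omega), hy.grid_eq_zero _ _ (by omega)] at this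
      rw [ih, ← add_assoc]
      omega
  rw [h N]
  refine hN _ ?_
  have := Nat.le_mul_of_pos_right (j + N) (NeZero.pos n)
  omega

/-- `σ_k` at the last position of the triangle with a given letter. -/
lemma InTriangle.sigmaVal_last {lam : Fin n → ℤ} {y : ℕ →₀ ℤ} (hy : InTriangle n lam y)
    {b : ℕ} (hb : 1 ≤ b) (hb' : b ≤ n) :
    sigmaVal n y ((n - b) * n + (b - 1)) =
      grid n y (n - b) b - grid n y (n - b + 1) (b - 1) := by
  have := sigmaVal_sub y (n - b) hb hb'
  rw [hy.sigmaVal_eq_zero (j := n - b + 1) hb hb' (by omega),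
    hy.grid_eq_zero (n - b + 1) b (by omega),
    hy.grid_eq_zero (n - b) (b + 1) (by omega)] at this
  omega

/-- An entry can be lowered if `σ` is strictly smaller at the next place with the same letter: by
`sigmaVal_sub` this makes the inequalities which bound the entry from below strict. -/
lemma InTriangle.sub_single {lam : Fin n → ℤ} {y : ℕ →₀ ℤ} (hy : InTriangle n lam y)
    {j b : ℕ} (hb : 1 ≤ b) (hb' : b ≤ n) (hjb : j + b ≤ n)
    (h : sigmaVal n y ((j + 1) * n + (b - 1)) < sigmaVal n y (j * n + (b - 1))) :
    InTriangle n lam (y - Finsupp.single (j * n + (b - 1)) 1) := by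
  have hs := sigmaVal_sub y j hb hb'
  rw [sub_eq_add_neg, ← Finsupp.single_neg]
  refine ⟨fun a c hc hc' => ?_, fun i a ha => ?_⟩
  · rw [grid_add_single y hb hb', grid_add_single y hb hb']
    have h1 := hy.box a c hc hc'
    have h2 := hy.box j (b + 1) (by omega) (by omega)
    rw [Nat.add_sub_cancel] at h2
    split_ifs with c1 c2 c2
    · omega
    · omega
    · obtain ⟨rfl, rfl⟩ := c2
      omega
    · omega
  · rw [grid_add_single y hb hb', grid_add_single y hb hb']
    have h1 := hy.cap i a ha
    split_ifs with c1 c2 c2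
    · omega
    · omega
    · obtain ⟨rfl, rfl⟩ := c2
      have h2 := hy.cap i (a + 1) (by omega)
      rw [show (i : ℕ) + 1 - (a + 1) = i - a by omega,
        show (i : ℕ) - (a + 1) = i - a - 1 by omega] at h2
      rw [show (i : ℕ) + 1 - a = i - a + 1 by omega] at h1 ⊢
      omega
    · omega

/-- An entry can be raised if `σ` is strictly smaller at the previous place with the same letter
(`σ_0^{(i)}` taking its role in the first block). -/
lemma InTriangle.add_single {lam : Fin n → ℤ} {y : ℕ →₀ ℤ} (hy : InTriangle n lam y)
    {j b : ℕ} (hb : 1 ≤ b) (hb' : b ≤ n)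
    (h : ∀ a, a + 1 = j → sigmaVal n y (a * n + (b - 1)) < sigmaVal n y (j * n + (b - 1)))
    (h0 : j = 0 → (sigmaZeroForm (CartanMatrix.A n) (periodicSeq n) lam
      ⟨b - 1, by omega⟩).eval y < sigmaVal n y (j * n + (b - 1))) :
    InTriangle n lam (y + Finsupp.single (j * n + (b - 1)) 1) := by
  refine ⟨fun a c hc hc' => ?_, fun i a ha => ?_⟩
  · rw [grid_add_single y hb hb', grid_add_single y hb hb']
    have h1 := hy.box a c hc hc'
    split_ifs with c1 c2 c2
    · omega
    · obtain ⟨rfl, rfl⟩ := c1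
      have h2 := h a rfl
      have hs := sigmaVal_sub y a hb hb'
      have h3 := hy.box a (c - 1) (by omega) (by omega)
      rw [show c - 1 + 1 = c by omega] at hs
      omega
    · omega
    · omega
  · rw [grid_add_single y hb hb', grid_add_single y hb hb']
    have h1 := hy.cap i a ha
    split_ifs with c1 c2 c2
    · omega
    · obtain ⟨rfl, rfl⟩ := c1
      rcases a with _ | a
      · have h2 := h0 rfl
        have h3 := sigmaZero_sub lam y i
        have e : (⟨(i : ℕ) + 1 - 0 - 1, by omega⟩ : Fin n) = i := Fin.ext (by simp)
        rw [e] at h2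
        simp only [Nat.sub_zero, Nat.add_sub_cancel, zero_mul, zero_add] at h2 h3 ⊢
        omega
      · have h2 := h a rfl
        have hs := sigmaVal_sub y a hb hb'
        have h3 := hy.cap i a (by omega)
        rw [show (i : ℕ) + 1 - (a + 1) = i - a by omega,
          show (i : ℕ) - (a + 1) = i - a - 1 by omega] at *
        rw [show (i : ℕ) + 1 - a = i - a + 1 by omega] at h3
        omega
    · omega
    · omega

end Sigma

end Triangle

section Triangle

variable {n : ℕ}

/-! ### The crystal `Σ_{ι_0}[λ]` -/

lemma Pos.place_eq (p : Pos n) : p.place = (p.1 : ℕ) * n + ((p.2 : ℕ) + 1 - 1) := rfl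

variable [NeZero n]

omit [NeZero n] in
lemma cartanMatrix_A_diag (i : Fin n) : CartanMatrix.A n i i = 2 := by simp [CartanMatrix.A]

lemma periodicSeq_place (p : Pos n) : periodicSeq n p.place = p.letter :=
  periodicSeq_mul_add _ p.snd_lt

/-- A place with letter `i` comes from a position of the triangle, or lies in one of the blocks
that contain no such position. -/
lemma exists_place_or_outside {i : Fin n} {k : ℕ} (hk : periodicSeq n k = i) :
    (∃ p : Pos n, p.letter = i ∧ p.place = k) ∨
      ∃ j, n < j + (i + 1) ∧ k = j * n + ((i : ℕ) + 1 - 1) := by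
  obtain ⟨j, b, hb, hb', rfl⟩ := exists_block_letter (n := n) k
  rw [periodicSeq_mul_add j (by omega)] at hk
  have hi : (i : ℕ) = b - 1 := by rw [← hk]
  by_cases hjb : j + b ≤ n
  · exact .inl ⟨Pos.mk' j b ⟨hb, hjb⟩, Fin.ext (by rw [Pos.mk'_letter, hi]), rfl⟩
  · exact .inr ⟨j, by omega, by rw [hi, Nat.sub_add_cancel hb]⟩

/-- The last position of the triangle with letter `i`. -/
def lastPos (i : Fin n) : Pos n := Pos.mk' (n - (i + 1)) (i + 1) ⟨by omega, by omega⟩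

omit [NeZero n] in
lemma lastPos_letter (i : Fin n) : (lastPos i).letter = i := Fin.ext rfl

omit [NeZero n] in
lemma lastPos_fst (i : Fin n) : ((lastPos i).1 : ℕ) = n - (i + 1) := rfl

lemma InTriangle.sigmaVal_lastPos {lam : Fin n → ℤ} {y : ℕ →₀ ℤ} (hy : InTriangle n lam y)
    (i : Fin n) : sigmaVal n y (lastPos i).place =
      grid n y (n - (i + 1)) (i + 1) - grid n y (n - (i + 1) + 1) (i + 1 - 1) :=
  hy.sigmaVal_last (b := i + 1) (by omega) (by omega)

lemma InTriangle.sigmaVal_lastPos_nonneg {lam : Fin n → ℤ} {y : ℕ →₀ ℤ}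
    (hy : InTriangle n lam y) (i : Fin n) : 0 ≤ sigmaVal n y (lastPos i).place := by
  rw [hy.sigmaVal_lastPos, sub_nonneg]
  exact hy.box _ _ (by omega) (by omega)

omit [NeZero n] in
lemma place_le_lastPos (p : Pos n) : (p.1 : ℕ) ≤ (lastPos p.letter).1 := by
  have := p.fst_add_snd_lt
  rw [lastPos_fst, Pos.letter_val]
  omega

/-- Every place with letter `i` outside the triangle comes after the last position. -/
lemma place_lastPos_lt {i : Fin n} {j : ℕ} (hj : n < j + (i + 1)) :
    (lastPos i).place < j * n + ((i : ℕ) + 1 - 1) := by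
  have h : (n - (i + 1)) * n < j * n := Nat.mul_lt_mul_of_pos_right (by omega) (NeZero.pos n)
  change (n - (i + 1)) * n + ((i : ℕ) + 1 - 1) < _
  omega

/-- `p` is the last position with letter `i` at which `s` takes its maximum over these. -/
structure IsLastArgmax (s : Pos n → ℤ) (i : Fin n) (p : Pos n) : Prop where
  letter : p.letter = i
  le : ∀ q : Pos n, q.letter = i → s q ≤ s p
  lt : ∀ q : Pos n, q.letter = i → p.place < q.place → s q < s p

/-- `p` is the first position with letter `i` at which `s` takes its maximum over these. -/
structure IsFirstArgmax (s : Pos n → ℤ) (i : Fin n) (p : Pos n) : Prop where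
  letter : p.letter = i
  le : ∀ q : Pos n, q.letter = i → s q ≤ s p
  lt : ∀ q : Pos n, q.letter = i → q.place < p.place → s q < s p

omit [NeZero n] in
lemma IsLastArgmax.unique {s : Pos n → ℤ} {i : Fin n} {p q : Pos n}
    (hp : IsLastArgmax s i p) (hq : IsLastArgmax s i q) : p = q := by
  rcases lt_trichotomy p.place q.place with h | h | h
  · exact absurd (hp.lt q hq.letter h) (not_lt.2 (hq.le p hp.letter))
  · exact Pos.place_injective h
  · exact absurd (hq.lt p hp.letter h) (not_lt.2 (hp.le q hq.letter))

omit [NeZero n] in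
lemma IsFirstArgmax.unique {s : Pos n → ℤ} {i : Fin n} {p q : Pos n}
    (hp : IsFirstArgmax s i p) (hq : IsFirstArgmax s i q) : p = q := by
  rcases lt_trichotomy p.place q.place with h | h | h
  · exact absurd (hq.lt p hp.letter h) (not_lt.2 (hp.le q hq.letter))
  · exact Pos.place_injective h
  · exact absurd (hp.lt q hq.letter h) (not_lt.2 (hq.le p hp.letter))

variable {lam : Fin n → ℤ} {y : ℕ →₀ ℤ} {i : Fin n} {p : Pos n}

/-- On the triangle, `σ^{(i)}` is attained at a position of the triangle. -/
lemma InTriangle.sigmaVal_le (hy : InTriangle n lam y)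
    (hp : ∀ q : Pos n, q.letter = i → sigmaVal n y q.place ≤ sigmaVal n y p.place)
    (l : ℕ) (hl : periodicSeq n l = i) : sigmaVal n y l ≤ sigmaVal n y p.place := by
  rcases exists_place_or_outside hl with ⟨q, hq, rfl⟩ | ⟨j, hj, rfl⟩
  · exact hp q hq
  · rw [hy.sigmaVal_eq_zero (by omega) (by omega) hj]
    exact (hy.sigmaVal_lastPos_nonneg i).trans (hp _ (lastPos_letter i))

lemma InTriangle.sigmaZero_le (hy : InTriangle n lam y)
    (hp : ∀ q : Pos n, q.letter = i → sigmaVal n y q.place ≤ sigmaVal n y p.place) :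
    (sigmaZeroForm (CartanMatrix.A n) (periodicSeq n) lam i).eval y ≤ sigmaVal n y p.place := by
  have h1 := sigmaZero_sub lam y i
  have h2 := hy.cap i 0 (by omega)
  have hi : periodicSeq n (i : ℕ) = i := by
    have := periodicSeq_mul_add 0 i.isLt
    rwa [zero_mul, zero_add] at this
  have h3 := hy.sigmaVal_le hp i hi
  simp only [Nat.sub_zero] at h2
  omega

/-- On the triangle, `ε_i = σ^{(i)}`. -/
lemma InTriangle.seqEps_eq (hy : InTriangle n lam y) (hpi : p.letter = i)
    (hp : ∀ q : Pos n, q.letter = i → sigmaVal n y q.place ≤ sigmaVal n y p.place) :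
    seqEps (CartanMatrix.A n) (periodicSeq n) lam i y = sigmaVal n y p.place := by
  rw [seqEps, sigmaMax_eq (k := p.place) ((periodicSeq_place p).trans hpi) (hy.sigmaVal_le hp)]
  exact max_eq_left (hy.sigmaZero_le hp)

lemma InTriangle.e_cases (hy : InTriangle n lam y) {z : ℕ →₀ ℤ}
    (h : (seqCrystal (CartanMatrix.A n) (periodicSeq n) lam).e i y = some z) :
    ∃ p : Pos n, IsLastArgmax (fun q => sigmaVal n y q.place) i p ∧
      z = y - Finsupp.single p.place 1 ∧ InTriangle n lam z := by
  rw [seqCrystal_e_eq_some_iff lam periodicSeq_unbounded] at h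
  obtain ⟨k, hk, h1, h2, h3, -, rfl⟩ := h
  rcases exists_place_or_outside hk with ⟨p, hp, rfl⟩ | ⟨j, hj, rfl⟩
  · refine ⟨p, ⟨hp, fun q hq => h1 _ ((periodicSeq_place q).trans hq), fun q hq hlt =>
      h2 _ hlt ((periodicSeq_place q).trans hq)⟩, rfl, ?_⟩
    have hpl := p.fst_add_snd_lt
    refine hy.sub_single (j := p.1) (b := p.2 + 1) (by omega) (by omega) (by omega) ?_
    have e : ((p.1 : ℕ) + 1) * n + ((p.2 : ℕ) + 1 - 1) = p.place + n := by
      rw [p.place_eq]; ring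
    rw [e, ← p.place_eq]
    refine h2 _ ?_ ?_
    · have := NeZero.pos n; omega
    · rw [← hp, ← periodicSeq_place p, periodicSeq_eq_iff, Nat.add_mod_right]
  · have := hy.sigmaVal_eq_zero (by omega) (by omega) hj
    rw [sigmaVal] at this
    omega

lemma InTriangle.f_cases (hy : InTriangle n lam y) {z : ℕ →₀ ℤ}
    (h : (seqCrystal (CartanMatrix.A n) (periodicSeq n) lam).f i y = some z) :
    ∃ p : Pos n, IsFirstArgmax (fun q => sigmaVal n y q.place) i p ∧
      z = y + Finsupp.single p.place 1 ∧ InTriangle n lam z := by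
  rw [seqCrystal_f_eq_some_iff lam periodicSeq_unbounded] at h
  obtain ⟨k, hk, h1, h2, h3, rfl⟩ := h
  rcases exists_place_or_outside hk with ⟨p, hp, rfl⟩ | ⟨j, hj, rfl⟩
  · refine ⟨p, ⟨hp, fun q hq => h1 _ ((periodicSeq_place q).trans hq), fun q hq hlt =>
      h2 _ hlt ((periodicSeq_place q).trans hq)⟩, rfl, ?_⟩
    have hpl := p.fst_add_snd_lt
    refine hy.add_single (j := p.1) (b := p.2 + 1) (by omega) (by omega) ?_ ?_
    · intro a ha
      have e : p.place = a * n + ((p.2 : ℕ) + 1 - 1) + n := by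
        have : ((p.1 : ℕ)) * n = (a + 1) * n := by rw [ha]
        rw [p.place_eq, this]; ring
      rw [← p.place_eq]
      refine h2 _ ?_ ?_
      · have := NeZero.pos n; omega
      · rw [← hp, ← periodicSeq_place p, periodicSeq_eq_iff, e, Nat.add_mod_right]
    · intro _
      have e : (⟨(p.2 : ℕ) + 1 - 1, by omega⟩ : Fin n) = i := by rw [← hp]; rfl
      rw [e]
      exact h3
  · have h4 := hy.sigmaVal_eq_zero (by omega) (by omega) hj
    have h5 := hy.sigmaVal_lastPos_nonneg i
    have h6 := h2 _ (place_lastPos_lt hj) ((periodicSeq_place _).trans (lastPos_letter i))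
    rw [sigmaVal] at h4 h5
    omega

/-- If lowering the last maximal entry stays in the triangle, then it is `ẽ_i`. -/
lemma InTriangle.e_eq_some (hy : InTriangle n lam y)
    (hp : IsLastArgmax (fun q => sigmaVal n y q.place) i p)
    (hz : InTriangle n lam (y - Finsupp.single p.place 1)) :
    (seqCrystal (CartanMatrix.A n) (periodicSeq n) lam).e i y =
      some (y - Finsupp.single p.place 1) := by
  have hlast := hp.le _ (lastPos_letter i)
  have hnn := hy.sigmaVal_lastPos_nonneg i
  have hpos : 0 < sigmaVal n y p.place := by
    by_contra hc
    -- then `p` is the last position, where `σ` is the difference of a box that cannot be lowered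
    have hpe : p = lastPos i := by
      refine Pos.place_injective ?_
      have h1 := hp.lt _ (lastPos_letter i)
      have h2 := place_le_lastPos p
      rw [hp.letter] at h2
      have h3 := Pos.place_lt_iff_of_letter_eq (p := p) (q := lastPos i)
        (hp.letter.trans (lastPos_letter i).symm)
      by_contra hne
      rcases h2.lt_or_eq with h4 | h4
      · have := h1 (h3.2 h4)
        omega
      · refine hne (congrArg Pos.place (Pos.ext_val h4 ?_))
        exact congrArg Fin.val (hp.letter.trans (lastPos_letter i).symm)
    rw [hpe] at hc hz
    have h1 := hy.sigmaVal_lastPos i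
    have h2 := hz.box (n - (i + 1)) (i + 1) (by omega) (by omega)
    have e : (lastPos i).place = (n - (i + 1)) * n + ((i : ℕ) + 1 - 1) := rfl
    rw [sub_eq_add_neg, ← Finsupp.single_neg, e,
      grid_add_single y (by omega) (by omega), grid_add_single y (by omega) (by omega),
      if_neg (by omega), if_pos ⟨rfl, rfl⟩] at h2
    omega
  refine (seqCrystal_e_eq_some_iff lam periodicSeq_unbounded i y _).2
    ⟨p.place, (periodicSeq_place p).trans hp.letter, hy.sigmaVal_le hp.le,
      fun l hlt hl => ?_, hpos, hy.sigmaZero_le hp.le, rfl⟩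
  rcases exists_place_or_outside hl with ⟨q, hq, rfl⟩ | ⟨j, hj, rfl⟩
  · exact hp.lt q hq hlt
  · have := hy.sigmaVal_eq_zero (by omega) (by omega) hj
    rw [sigmaVal] at this
    rw [this]
    exact hpos

/-- If raising the first maximal entry stays in the triangle, then it is `f̃_i`. -/
lemma InTriangle.f_eq_some (hy : InTriangle n lam y)
    (hp : IsFirstArgmax (fun q => sigmaVal n y q.place) i p)
    (hz : InTriangle n lam (y + Finsupp.single p.place 1)) :
    (seqCrystal (CartanMatrix.A n) (periodicSeq n) lam).f i y =
      some (y + Finsupp.single p.place 1) := by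
  have hi := i.isLt
  have h0 := hy.sigmaZero_le hp.le
  refine (seqCrystal_f_eq_some_iff lam periodicSeq_unbounded i y _).2
    ⟨p.place, (periodicSeq_place p).trans hp.letter, hy.sigmaVal_le hp.le,
      fun l hlt hl => ?_, ?_, rfl⟩
  · rcases exists_place_or_outside hl with ⟨q, hq, rfl⟩ | ⟨j, hj, rfl⟩
    · exact hp.lt q hq hlt
    · exfalso
      have h1 := place_lastPos_lt hj
      have h2 := place_le_lastPos p
      rw [hp.letter] at h2
      have h3 := Pos.place_lt_iff_of_letter_eq (p := lastPos i) (q := p)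
        ((lastPos_letter i).trans hp.letter.symm)
      omega
  · refine lt_of_le_of_ne h0 fun heq => ?_
    -- then `p` is the first position, where the capping inequality is an equality
    have hfirst : (Pos.mk' 0 (i + 1) ⟨by omega, by omega⟩ : Pos n).letter = i := Fin.ext rfl
    have hpl : (Pos.mk' 0 (i + 1) ⟨by omega, by omega⟩ : Pos n).place = i := by
      rw [Pos.mk'_place]; omega
    have h1 := sigmaZero_sub lam y i
    have h2 := hy.cap i 0 (by omega)
    have h3 := hp.le _ hfirst
    have h4 := hp.lt _ hfirst
    have h5 := Pos.place_lt_iff_of_letter_eq (q := p) (hfirst.trans hp.letter.symm)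
    simp only [hpl, Nat.sub_zero] at h2 h3 h4 h5
    have heq' : (sigmaZeroForm (CartanMatrix.A n) (periodicSeq n) lam i).eval y =
      sigmaVal n y p.place := heq
    have hp1 : (p.1 : ℕ) = 0 := by
      by_contra hne
      have := h4 (h5.2 (Nat.pos_of_ne_zero hne))
      omega
    have hp2 : (p.2 : ℕ) = i := congrArg Fin.val hp.letter
    have h6 := hz.cap i 0 (by omega)
    have hpe : p.place = 0 * n + ((i : ℕ) + 1 - 1) := by
      have h7 : (p.1 : ℕ) * n = 0 * n := by rw [hp1]
      rw [p.place_eq, h7, hp2]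
    rw [hpe, grid_add_single y (by omega) (by omega),
      grid_add_single y (by omega) (by omega)] at h6
    simp only [Nat.sub_zero, true_and, if_true] at h6
    rw [if_neg (by omega)] at h6
    omega

variable (lam) in
lemma triangle_e_iff {x x' : Pos n → ℤ} (hx : x ∈ triangleSet n lam)
    (hx' : x' ∈ triangleSet n lam)
    (hp : IsLastArgmax (fun q => sigmaVal n (extendZero x) q.place) i p) :
    (seqCrystal (CartanMatrix.A n) (periodicSeq n) lam).e i (extendZero x) =
      some (extendZero x') ↔ x' = x - Pi.single p 1 := by
  have e : extendZero (x - Pi.single p 1) = extendZero x - Finsupp.single p.place 1 := by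
    rw [sub_eq_add_neg, ← Pi.single_neg, extendZero_add_single, Finsupp.single_neg,
      ← sub_eq_add_neg]
  rw [mem_triangleSet_iff_inTriangle] at hx hx'
  constructor
  · intro h
    obtain ⟨q, hq, hz, -⟩ := hx.e_cases h
    obtain rfl := hq.unique hp
    exact extendZero_injective (hz.trans e.symm)
  · rintro rfl
    rw [e] at hx' ⊢
    exact hx.e_eq_some hp hx'

variable (lam) in
lemma triangle_f_iff {x x' : Pos n → ℤ} (hx : x ∈ triangleSet n lam)
    (hx' : x' ∈ triangleSet n lam)
    (hp : IsFirstArgmax (fun q => sigmaVal n (extendZero x) q.place) i p) :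
    (seqCrystal (CartanMatrix.A n) (periodicSeq n) lam).f i (extendZero x) =
      some (extendZero x') ↔ x' = x + Pi.single p 1 := by
  have e := extendZero_add_single x p 1
  rw [mem_triangleSet_iff_inTriangle] at hx hx'
  constructor
  · intro h
    obtain ⟨q, hq, hz, -⟩ := hx.f_cases h
    obtain rfl := hq.unique hp
    exact extendZero_injective (hz.trans e.symm)
  · rintro rfl
    rw [e] at hx' ⊢
    exact hx.f_eq_some hp hx'

omit [NeZero n] in
lemma extendZero_subtype_injective (lam : Fin n → ℤ) :
    Function.Injective fun x : triangleSet n lam => extendZero x.1 :=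
  extendZero_injective.comp Subtype.val_injective

variable (lam) in
lemma sigmaCrystal_isStrictMorphism :
    IsStrictMorphism (sigmaCrystal n lam) (seqCrystal (CartanMatrix.A n) (periodicSeq n) lam)
      (fun x => extendZero x.1) := by
  have key : ∀ z, InTriangle n lam z → ∃ b' : triangleSet n lam, extendZero b'.1 = z := by
    intro z hz
    obtain ⟨x, rfl⟩ := hz.exists_extendZero
    exact ⟨⟨x, (mem_triangleSet_iff_inTriangle lam x).2 hz⟩, rfl⟩
  refine CrystalData.induced_isStrictMorphism (extendZero_subtype_injective lam) ?_ ?_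
  · intro i b c h
    obtain ⟨p, -, -, hc⟩ := ((mem_triangleSet_iff_inTriangle lam b.1).1 b.2).e_cases h
    exact key c hc
  · intro i b c h
    obtain ⟨p, -, -, hc⟩ := ((mem_triangleSet_iff_inTriangle lam b.1).1 b.2).f_cases h
    exact key c hc

variable (lam) in
lemma sigmaCrystal_isCrystal : (sigmaCrystal n lam).IsCrystal (CartanMatrix.A n) :=
  (seqCrystal_isCrystal lam cartanMatrix_A_diag periodicSeq_unbounded).of_isStrictMorphism
    (sigmaCrystal_isStrictMorphism lam) (extendZero_subtype_injective lam)

omit [NeZero n] in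
lemma sum_extendZero (x : Pos n → ℤ) (g : ℕ → ℤ) :
    ((extendZero x).sum fun k a => g k * a) = ∑ q : Pos n, g q.place * x q := by
  have h : ∀ y : Pos n → ℤ, extendZero y = ∑ p : Pos n, Finsupp.single p.place (y p) :=
    fun _ => rfl
  rw [h, ← Finsupp.sum_finsetSum_index (by simp) (by intros; ring)]
  exact Finset.sum_congr rfl fun q _ => Finsupp.sum_single_index (by simp)

lemma sigmaVal_extendZero (x : Pos n → ℤ) (p : Pos n) :
    sigmaVal n (extendZero x) p.place = x p +
      ∑ q : Pos n with p.place < q.place, CartanMatrix.A n p.letter q.letter * x q := by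
  rw [sigmaVal, AffForm.eval, sum_extendZero]
  simp only [sigmaForm, zero_add, periodicSeq_place]
  rw [Finset.sum_filter, ← Finset.add_sum_erase _ _ (Finset.mem_univ p),
    ← Finset.add_sum_erase (a := p) Finset.univ
      (fun q : Pos n => if p.place < q.place then
        CartanMatrix.A n p.letter q.letter * x q else 0) (Finset.mem_univ p)]
  rw [if_pos rfl, if_neg (lt_irrefl _), one_mul, zero_add]
  congr 1
  refine Finset.sum_congr rfl fun q hq => ?_
  rw [if_neg fun h => (Finset.ne_of_mem_erase hq) (Pos.place_injective h)]
  split_ifs <;> simp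

lemma seqWt_extendZero (x : Pos n → ℤ) (i : Fin n) :
    seqWt (CartanMatrix.A n) (periodicSeq n) lam (extendZero x) i =
      lam i - ∑ q : Pos n, CartanMatrix.A n i q.letter * x q := by
  rw [seqWt]
  congr 1
  simp only [mul_comm _ (CartanMatrix.A n i _)]
  rw [sum_extendZero]
  simp only [periodicSeq_place]

end Triangle

section Geometric

variable {n : ℕ} {K : Type} [Field K]

/-! ### Products along the longest word -/

lemma longWord_map_prod {M : Type*} [Monoid M] (F : Pos n → M) (f : ℕ → ℕ → M)
    (h : ∀ q, F q = f q.1 q.2) :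
    ((longWord n).map F).prod =
      ((List.range' 0 n).map fun j => ((List.range (n - j)).map (f j)).prod).prod := by
  rw [longWord, List.map_flatMap, List.flatMap_def, List.prod_flatten, List.map_map]
  congr 1
  rw [← List.range_eq_range', ← List.map_coe_finRange_eq_range, List.map_map]
  refine List.map_congr_left fun j _ => ?_
  simp only [Function.comp_apply]
  rw [← List.map_coe_finRange_eq_range, List.map_map, List.map_map]
  congr 1
  exact List.map_congr_left fun i _ => h _

/-! ### Lower bidiagonal matrices -/

/-- The lower bidiagonal matrix with diagonal `d` whose subdiagonal entry in column `b` is `1` if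
`P b` holds, and `0` otherwise. -/
def lowBi (n : ℕ) (d : ℕ → K) (P : ℕ → Prop) [DecidablePred P] :
    Matrix (Fin (n + 1)) (Fin (n + 1)) K :=
  fun a b => if a = b then d a else if (a : ℕ) = b + 1 ∧ P b then 1 else 0

variable (d : ℕ → K) (P : ℕ → Prop) [DecidablePred P]

lemma vecMul_lowBi (r : Fin (n + 1) → K) (b : Fin (n + 1)) :
    Matrix.vecMul r (lowBi n d P) b =
      r b * d b + if h : (b : ℕ) < n ∧ P b then r ⟨b + 1, by omega⟩ else 0 := by
  simp only [Matrix.vecMul, dotProduct, lowBi]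
  rw [← Finset.add_sum_erase _ _ (Finset.mem_univ b), if_pos rfl]
  congr 1
  split_ifs with h
  · rw [Finset.sum_eq_single_of_mem (⟨b + 1, by omega⟩ : Fin (n + 1))
      (by simp [Fin.ext_iff])]
    · simp [Fin.ext_iff, h.2]
    · intro a ha hne
      rw [if_neg (Finset.ne_of_mem_erase ha), if_neg, mul_zero]
      rintro ⟨h1, -⟩
      exact hne (Fin.ext h1)
  · refine Finset.sum_eq_zero fun a ha => ?_
    rw [if_neg (Finset.ne_of_mem_erase ha), if_neg, mul_zero]
    rintro ⟨h1, h2⟩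
    exact h ⟨by omega, h2⟩

lemma mul_lowBi (A : Matrix (Fin (n + 1)) (Fin (n + 1)) K) (a b : Fin (n + 1)) :
    (A * lowBi n d P) a b =
      A a b * d b + if h : (b : ℕ) < n ∧ P b then A a ⟨b + 1, by omega⟩ else 0 :=
  vecMul_lowBi d P (A a) b

lemma lowBi_mulVec (w : Fin (n + 1) → K) (a : Fin (n + 1)) :
    Matrix.mulVec (lowBi n d P) w a =
      d a * w a + if h : 1 ≤ (a : ℕ) ∧ P (a - 1) then w ⟨a - 1, by omega⟩ else 0 := by
  simp only [Matrix.mulVec, dotProduct, lowBi]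
  rw [← Finset.add_sum_erase _ _ (Finset.mem_univ a), if_pos rfl]
  congr 1
  split_ifs with h
  · have h1 : (a : ℕ) - 1 + 1 = a := by omega
    rw [Finset.sum_eq_single_of_mem (⟨a - 1, by omega⟩ : Fin (n + 1))
      (by simp [Fin.ext_iff]; omega)]
    · simp only [Fin.ext_iff, h1, h.2, and_self, if_true]
      rw [if_neg (by omega), one_mul]
    · intro b hb hne
      rw [if_neg (Ne.symm (Finset.ne_of_mem_erase hb)), if_neg, zero_mul]
      rintro ⟨h2, -⟩
      exact hne (Fin.ext (by simp only; omega))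
  · refine Finset.sum_eq_zero fun b hb => ?_
    rw [if_neg (Ne.symm (Finset.ne_of_mem_erase hb)), if_neg, zero_mul]
    rintro ⟨h1, h2⟩
    refine h ⟨by omega, ?_⟩
    rwa [show (a : ℕ) - 1 = b by omega]

lemma lowBi_mul (A : Matrix (Fin (n + 1)) (Fin (n + 1)) K) (a b : Fin (n + 1)) :
    (lowBi n d P * A) a b =
      d a * A a b + if h : 1 ≤ (a : ℕ) ∧ P (a - 1) then A ⟨a - 1, by omega⟩ b else 0 :=
  lowBi_mulVec d P (fun k => A k b) a

lemma det_lowBi_ne_zero (hd : ∀ k, d k ≠ 0) : (lowBi n d P).det ≠ 0 := by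
  rw [Matrix.det_of_isLowerTriangular]
  · refine Finset.prod_ne_zero_iff.2 fun a _ => ?_
    simp [lowBi, hd]
  · intro a b hab
    have hab' : a < b := hab
    simp only [lowBi]
    rw [if_neg hab'.ne, if_neg (by omega)]

/-- `𝐲_i(c) = y_i(c) α_i^∨(c⁻¹)` is lower bidiagonal. -/
lemma yOne_mul_corootMat (i : Fin n) {c : K} (hc : c ≠ 0) :
    yOne i c * corootMat i c⁻¹ =
      lowBi n (fun k => if k = i then c⁻¹ else if k = i + 1 then c else 1) (fun k => k = i) := by
  ext a b
  rw [corootMat, Matrix.mul_diagonal, yOne, Matrix.add_apply, Matrix.one_apply,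
    Matrix.single_apply, lowBi]
  simp only [Fin.ext_iff, Fin.val_castSucc, Fin.val_succ, inv_inv]
  grind

/-- The product of the `𝐲_i(e_{i+1})` over `i < m` is lower bidiagonal. -/
lemma prod_lowBi (e : ℕ → K) (he : ∀ k, e k ≠ 0) (he0 : e 0 = 1) (m : ℕ) (hm : m ≤ n) :
    ((List.range m).map fun i => lowBi n
      (fun k => if k = i then (e (i + 1))⁻¹ else if k = i + 1 then e (i + 1) else 1)
      (fun k => k = i)).prod =
      lowBi n (fun k => (if k ≤ m then e k else 1) / (if k + 1 ≤ m then e (k + 1) else 1))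
        (fun k => k < m) := by
  induction m with
  | zero =>
    ext a b
    simp only [List.range_zero, List.map_nil, List.prod_nil, Matrix.one_apply, lowBi]
    by_cases h : (a : ℕ) = 0 <;> grind
  | succ m ih =>
    rw [List.range_succ, List.map_append, List.prod_append, ih (by omega)]
    simp only [List.map_cons, List.map_nil, List.prod_cons, List.prod_nil, mul_one]
    ext a b
    rw [mul_lowBi]
    have h1 := he (m + 1)
    simp only [lowBi, Fin.ext_iff]
    rcases lt_trichotomy (b : ℕ) m with h | h | h
    · grind
    · grind
    · grind

/-- The coordinate of `c` in block `j` (counted from zero) at the letter `b` (counted from one);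
it is `1` outside the triangle. -/
def cEntry (c : Pos n → Kˣ) (j b : ℕ) : K :=
  if h : 1 ≤ b ∧ j + b ≤ n then (c (Pos.mk' j b h) : K) else 1

lemma cEntry_ne_zero (c : Pos n → Kˣ) (j b : ℕ) : cEntry c j b ≠ 0 := by
  unfold cEntry; split_ifs
  · exact Units.ne_zero _
  · exact one_ne_zero

lemma cEntry_zero (c : Pos n → Kˣ) (j : ℕ) : cEntry c j 0 = 1 := by simp [cEntry]

lemma cEntry_of_lt (c : Pos n → Kˣ) {j b : ℕ} (h : n < j + b) : cEntry c j b = 1 := by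
  rw [cEntry, dif_neg (by omega)]

lemma cEntry_pos (c : Pos n → Kˣ) (q : Pos n) : cEntry c q.1 (q.2 + 1) = c q := by
  have := q.fst_add_snd_lt
  rw [cEntry, dif_pos ⟨by omega, by omega⟩]
  rfl

/-- The factor of the chart that belongs to the `j`-th block of the longest word. -/
def blockMat (c : Pos n → Kˣ) (j : ℕ) : Matrix (Fin (n + 1)) (Fin (n + 1)) K :=
  lowBi n (fun k => cEntry c j k / cEntry c j (k + 1)) (fun k => k < n - j)

/-- The product of the factors of the `s` blocks from the `j`-th one on. -/
def blockProd (c : Pos n → Kˣ) (j s : ℕ) : Matrix (Fin (n + 1)) (Fin (n + 1)) K :=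
  ((List.range' j s).map (blockMat c)).prod

lemma blockProd_succ (c : Pos n → Kˣ) (j s : ℕ) :
    blockProd c j (s + 1) = blockMat c j * blockProd c (j + 1) s := by
  simp [blockProd, List.range'_succ]

lemma chart_eq (p : TorusPt n K) :
    chart p = Matrix.diagonal (fun k => (p.1 k : K)) * blockProd p.2 0 n := by
  rw [chart, blockProd]
  congr 1
  rw [longWord_map_prod _ (fun j i => lowBi n (fun k => if k = i then (cEntry p.2 j (i + 1))⁻¹
    else if k = i + 1 then cEntry p.2 j (i + 1) else 1) (fun k => k = i))]
  · congr 1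
    refine List.map_congr_left fun j hj => ?_
    rw [prod_lowBi (cEntry p.2 j) (cEntry_ne_zero p.2 j) (cEntry_zero p.2 j) (n - j) (by omega),
      blockMat]
    congr 1
    funext k
    have h1 : ∀ k, n - j < k → cEntry p.2 j k = 1 := fun k hk => cEntry_of_lt _ (by omega)
    split_ifs with h2 h3 h3
    · rfl
    · rw [h1 (k + 1) (by omega)]
    · omega
    · rw [h1 k (by omega), h1 (k + 1) (by omega)]
  · intro q
    rw [cEntry_pos, yOne_mul_corootMat _ (Units.ne_zero _)]
    rfl

lemma det_blockMat_ne_zero (c : Pos n → Kˣ) (j : ℕ) : (blockMat c j).det ≠ 0 :=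
  det_lowBi_ne_zero _ _ fun _ => div_ne_zero (cEntry_ne_zero c _ _) (cEntry_ne_zero c _ _)

lemma det_blockProd_ne_zero (c : Pos n → Kˣ) (j s : ℕ) : (blockProd c j s).det ≠ 0 := by
  induction s generalizing j with
  | zero => simp [blockProd]
  | succ s ih =>
    rw [blockProd_succ, Matrix.det_mul]
    exact mul_ne_zero (det_blockMat_ne_zero c j) (ih _)

/-! ### The representative of the longest element -/

lemma mul_xOne_apply (i : Fin n) (z : K) (M : Matrix (Fin (n + 1)) (Fin (n + 1)) K)
    (a b : Fin (n + 1)) :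
    (M * xOne i z) a b = M a b + if b = i.succ then M a i.castSucc * z else 0 := by
  rw [xOne, mul_add, mul_one, Matrix.add_apply]
  congr 1
  split_ifs with h
  · subst h; simp
  · rw [Matrix.mul_single_apply_of_ne _ _ _ _ _ h]

lemma sBar_apply (i : Fin n) (a b : Fin (n + 1)) :
    (sBar i : Matrix (Fin (n + 1)) (Fin (n + 1)) K) a b =
      if (b : ℕ) = i then (if (a : ℕ) = i + 1 then 1 else 0)
      else if (b : ℕ) = i + 1 then (if (a : ℕ) = i then -1 else 0)
      else if a = b then 1 else 0 := by
  have hmul : ∀ (M : Matrix (Fin (n + 1)) (Fin (n + 1)) K) (z : K) (a b : Fin (n + 1)),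
      (M * yOne i z) a b = M a b + if b = i.castSucc then M a i.succ * z else 0 := by
    intro M z a b
    rw [yOne, mul_add, mul_one, Matrix.add_apply]
    congr 1
    split_ifs with h
    · subst h; simp
    · rw [Matrix.mul_single_apply_of_ne _ _ _ _ _ h]
  rw [sBar, mul_xOne_apply, hmul, hmul]
  simp only [xOne, Matrix.add_apply, Matrix.one_apply, Matrix.single_apply, Fin.ext_iff,
    Fin.val_castSucc, Fin.val_succ]
  grind

/-- The product of the `s̄_i` over `i < m`. -/
lemma prod_sBar (m : ℕ) (hm : m ≤ n) (f : ℕ → Matrix (Fin (n + 1)) (Fin (n + 1)) K)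
    (hf : ∀ i : Fin n, f i = sBar i) (a b : Fin (n + 1)) :
    ((List.range m).map f).prod a b =
      if (b : ℕ) < m then (if (a : ℕ) = b + 1 then 1 else 0)
      else if (b : ℕ) = m then (if (a : ℕ) = 0 then (-1) ^ m else 0)
      else if a = b then 1 else 0 := by
  induction m generalizing a b with
  | zero =>
    simp only [List.range_zero, List.map_nil, List.prod_nil, Matrix.one_apply, Fin.ext_iff]
    grind
  | succ m ih =>
    have ih' := ih (by omega)
    rw [List.range_succ, List.map_append, List.prod_append]
    simp only [List.map_cons, List.map_nil, List.prod_cons, List.prod_nil, mul_one]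
    have hs : f m = sBar ⟨m, by omega⟩ := hf ⟨m, by omega⟩
    rw [hs, Matrix.mul_apply]
    simp only [sBar_apply]
    rcases eq_or_ne (b : ℕ) m with h | h
    · simp only [h, if_true]
      rw [Finset.sum_eq_single (⟨m + 1, by omega⟩ : Fin (n + 1))]
      · rw [ih']
        have h1 : ¬ m + 1 < m := by omega
        simp [Fin.ext_iff, h1]
      · intro c _ hc
        rw [if_neg fun h' => hc (Fin.ext h'), mul_zero]
      · simp
    rcases eq_or_ne (b : ℕ) (m + 1) with h1 | h1
    · simp only [h1, if_true]
      rw [Finset.sum_eq_single (⟨m, by omega⟩ : Fin (n + 1))]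
      · rw [ih']
        by_cases ha : (a : ℕ) = 0 <;> simp [pow_succ, ha]
      · intro c _ hc
        rw [if_neg (by omega), if_neg fun h' => hc (Fin.ext h'), mul_zero]
      · simp
    · simp only [h, h1, if_false]
      rw [Finset.sum_eq_single b]
      · rw [ih', if_pos rfl, mul_one]
        grind
      · intro c _ hc
        rw [if_neg hc, mul_zero]
      · simp

/-- `w̄_0` is the antidiagonal matrix with alternating signs. -/
lemma wZeroBar_apply (a b : Fin (n + 1)) :
    wZeroBar n K a b = if (a : ℕ) + b = n then (-1) ^ (b : ℕ) else 0 := by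
  set f : ℕ → Matrix (Fin (n + 1)) (Fin (n + 1)) K :=
    fun i => if h : i < n then sBar ⟨i, h⟩ else 1 with hf
  have hf' : ∀ i : Fin n, f i = sBar i := fun i => by simp [hf]
  rw [wZeroBar, longWord_map_prod _ (fun _ i => f i) (fun q => (hf' q.letter).symm)]
  have key : ∀ s j, j + s = n → ∀ a b : Fin (n + 1),
      ((List.range' j s).map fun j => ((List.range (n - j)).map f).prod).prod a b =
        if (a : ℕ) ≤ s then (if (a : ℕ) + b = s then (-1) ^ (b : ℕ) else 0)
        else if a = b then 1 else 0 := by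
    intro s
    induction s with
    | zero =>
      intro j _ a b
      simp only [List.range'_zero, List.map_nil, List.prod_nil, Matrix.one_apply, Fin.ext_iff]
      by_cases h : (a : ℕ) = 0
      · by_cases h' : (b : ℕ) = 0
        · simp [h, h']
        · simp [h, h', Ne.symm h']
      · simp [h]
    | succ s ih =>
      intro j hj a b
      have ih' := ih (j + 1) (by omega)
      have hZ := prod_sBar (n - j) (by omega) f hf'
      rw [show n - j = s + 1 by omega] at hZ
      rw [List.range'_succ, List.map_cons, List.prod_cons, Matrix.mul_apply]
      simp only [show n - j = s + 1 by omega, hZ]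
      rcases Nat.eq_zero_or_pos (a : ℕ) with h | h
      · rw [Finset.sum_eq_single (⟨s + 1, by omega⟩ : Fin (n + 1))]
        · rw [ih']
          have h1 : ¬ s + 1 ≤ s := by omega
          by_cases hb : (b : ℕ) = s + 1
          · simp [h, h1, hb, Fin.ext_iff]
          · simp [h, hb, Ne.symm hb, Fin.ext_iff]
        · intro c _ hc
          have h1 : (c : ℕ) ≠ s + 1 := fun h' => hc (Fin.ext h')
          by_cases h2 : (c : ℕ) < s + 1
          · simp [h, h2]
          · have h3 : (c : ℕ) ≠ 0 := by omega
            simp [h, h1, h2, Fin.ext_iff, h3.symm]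
        · simp
      rcases le_or_gt (a : ℕ) (s + 1) with h1 | h1
      · rw [Finset.sum_eq_single (⟨a - 1, by omega⟩ : Fin (n + 1))]
        · rw [ih']
          simp only [Fin.ext_iff]
          rw [if_pos (by omega), if_pos (by omega), if_pos (by omega), if_pos h1, one_mul]
          refine if_congr ?_ rfl rfl
          omega
        · intro c _ hc
          have h2 : (c : ℕ) ≠ a - 1 := fun h' => hc (Fin.ext h')
          by_cases h3 : (c : ℕ) < s + 1
          · have h4 : (a : ℕ) ≠ c + 1 := by omega
            simp [h3, h4]
          · have h4 : (a : ℕ) ≠ 0 := by omega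
            by_cases h5 : (c : ℕ) = s + 1
            · simp [h5, h4]
            · have h6 : (a : ℕ) ≠ c := by omega
              simp [h3, h5, h6, Fin.ext_iff]
        · simp
      · rw [Finset.sum_eq_single a]
        · have h2 : ¬ (a : ℕ) < s + 1 := by omega
          have h3 : (a : ℕ) ≠ s + 1 := by omega
          have h4 : ¬ (a : ℕ) ≤ s := by omega
          have h5 : ¬ (a : ℕ) ≤ s + 1 := by omega
          rw [ih']
          simp [h2, h3, h4, h5]
        · intro c _ hc
          have h2 : (a : ℕ) ≠ 0 := by omega
          by_cases h3 : (c : ℕ) < s + 1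
          · have h4 : (a : ℕ) ≠ c + 1 := by omega
            simp [h3, h4]
          · by_cases h5 : (c : ℕ) = s + 1
            · simp [h5, h2]
            · simp [h3, h5, Ne.symm hc]
        · simp
  rw [key n 0 (by omega), if_pos (by omega)]

end Geometric

section Geometric

variable {n : ℕ} {K : Type} [Field K]

/-! ### Gauss decomposition of the chart -/

/-- The row vector `(1, -1/c_{j;1}, 1/c_{j;2}, …)`, supported on the first `s + 1` places. -/
def alternatingRow (c : Pos n → Kˣ) (j s : ℕ) : Fin (n + 1) → K :=
  fun a => if (a : ℕ) ≤ s then (-1) ^ (a : ℕ) / cEntry c j a else 0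

lemma alternatingRow_vecMul_blockMat (c : Pos n → Kˣ) {j s : ℕ} (hjs : j + s = n)
    (S : Fin (n + 1)) (hS : (S : ℕ) = s) :
    Matrix.vecMul (alternatingRow c j s) (blockMat c j) = Pi.single S ((-1) ^ s) := by
  funext b
  rw [blockMat, vecMul_lowBi]
  have h0 := cEntry_ne_zero c j
  have hlast : cEntry c j (s + 1) = 1 := cEntry_of_lt _ (by omega)
  simp only [alternatingRow]
  rcases lt_trichotomy (b : ℕ) s with h | h | h
  · rw [dif_pos ⟨by omega, by omega⟩, if_pos h.le, if_pos (by omega),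
      Pi.single_eq_of_ne (by intro hb; rw [hb] at h; omega)]
    have h1 := h0 b
    have h2 := h0 (b + 1)
    field_simp
    ring
  · have hb : b = S := Fin.ext (h.trans hS.symm)
    subst hb
    rw [dif_neg (by omega), if_pos h.le, Pi.single_eq_same, h, hlast]
    have h1 := h0 s
    field_simp
    simp
  · rw [dif_neg (by omega), if_neg (by omega),
      Pi.single_eq_of_ne (by intro hb; rw [hb] at h; omega)]
    ring

/-- A factorization `A V` of the product of the last `s` blocks, with `V` upper unitriangular and
`A` vanishing below the antidiagonal of the upper left block of size `s + 1` (both matrices are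
the identity outside this block). It records the entries of `A` on the antidiagonal and next to
it, and those of `V` next to the diagonal. -/
structure IsGaussPair (c : Pos n → Kˣ) (j s : ℕ) (A V : Matrix (Fin (n + 1)) (Fin (n + 1)) K) :
    Prop where
  fact : blockProd c j s = A * V
  upper : IsUpperUni V
  upper_outside : ∀ a b : Fin (n + 1), s < (b : ℕ) → V a b = if a = b then 1 else 0
  anti_zero : ∀ a b : Fin (n + 1), (a : ℕ) ≤ s → (b : ℕ) ≤ s → s < (a : ℕ) + b → A a b = 0
  anti_outside : ∀ a b : Fin (n + 1), s < (a : ℕ) ∨ s < (b : ℕ) → A a b = if a = b then 1 else 0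
  anti_diag : ∀ a b : Fin (n + 1), (a : ℕ) + b = s → A a b = (-1) ^ (b : ℕ)
  anti_near : ∀ a b : Fin (n + 1), (a : ℕ) + 1 + b = s → A a b = (-1) ^ (b : ℕ) *
    ∑ m ∈ Finset.range (a + 1), cEntry c (j + m) (a - m) / cEntry c (j + m) (a - m + 1)
  upper_near : ∀ a b : Fin (n + 1), (b : ℕ) = a + 1 → (b : ℕ) ≤ s → V a b =
    ∑ k ∈ Finset.range (a + 1), cEntry c (n - 1 - a) (k + 1) / cEntry c (n - a) k
  row : ∀ S : Fin (n + 1), (S : ℕ) = s →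
    Matrix.vecMul (alternatingRow c j s) A = Pi.single S ((-1) ^ s)

lemma isGaussPair_zero (c : Pos n → Kˣ) : IsGaussPair c n 0 1 1 where
  fact := by simp [blockProd]
  upper := ⟨fun i j h => Matrix.one_apply_ne h.ne', fun i => Matrix.one_apply_eq i⟩
  upper_outside a b _ := Matrix.one_apply
  anti_zero a b h1 h2 h3 := by omega
  anti_outside a b _ := Matrix.one_apply
  anti_diag a b h := by
    have h1 : (a : ℕ) = 0 := by omega
    have h2 : (b : ℕ) = 0 := by omega
    have h3 : a = b := Fin.ext (h1.trans h2.symm)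
    rw [h3, Matrix.one_apply_eq, h2, pow_zero]
  anti_near a b h := by omega
  upper_near _ b h h' := by omega
  row S hS := by
    rw [Matrix.vecMul_one]
    funext a
    simp only [alternatingRow, Pi.single_apply, Fin.ext_iff, hS]
    by_cases h : (a : ℕ) = 0
    · simp [h, cEntry_zero]
    · simp [h]

lemma sum_ite_le_eq_sum_range (s : ℕ) (hs : s ≤ n) (f : ℕ → K) :
    ∑ a : Fin (n + 1), (if (a : ℕ) ≤ s then f a else 0) = ∑ k ∈ Finset.range (s + 1), f k := by
  rw [Fin.sum_univ_eq_sum_range (fun a => if a ≤ s then f a else 0) (n + 1), ← Finset.sum_filter]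
  refine Finset.sum_congr ?_ fun _ _ => rfl
  ext k
  simp only [Finset.mem_filter, Finset.mem_range]
  omega

/-- One block is put in front by a single column operation: with `w` the alternating column of the
new coordinates and `A v = w`, the last column is corrected by `v`. -/
lemma IsGaussPair.succ {c : Pos n → Kˣ} {j s : ℕ} (hjs : j + (s + 1) = n)
    {A V : Matrix (Fin (n + 1)) (Fin (n + 1)) K} (h : IsGaussPair c (j + 1) s A V) :
    ∃ A' V', IsGaussPair c j (s + 1) A' V' := by
  have hne := cEntry_ne_zero c
  set S : Fin (n + 1) := ⟨s + 1, by omega⟩ with hS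
  set S₀ : Fin (n + 1) := ⟨s, by omega⟩ with hS₀
  set L := blockMat c j with hL
  set w : Fin (n + 1) → K :=
    fun a => if (a : ℕ) ≤ s then (-1) ^ (s - a) * cEntry c j (a + 1) else 0 with hw
  have hdet : IsUnit A.det := by
    have := det_blockProd_ne_zero c (j + 1) s
    rw [h.fact, Matrix.det_mul] at this
    exact (left_ne_zero_of_mul this).isUnit
  set v : Fin (n + 1) → K := Matrix.mulVec A⁻¹ w with hv
  have hAv : Matrix.mulVec A v = w := by
    rw [hv, Matrix.mulVec_mulVec, Matrix.mul_nonsing_inv A hdet, Matrix.one_mulVec]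
  have hv_out : ∀ k : Fin (n + 1), s < k → v k = 0 := by
    intro k hk
    have h1 := congrFun hAv k
    simp only [Matrix.mulVec, dotProduct, hw] at h1
    rw [if_neg (by omega), Finset.sum_eq_single k] at h1
    · rwa [h.anti_outside k k (.inl hk), if_pos rfl, one_mul] at h1
    · intro b _ hb
      rw [h.anti_outside k b (.inl hk), if_neg (Ne.symm hb), zero_mul]
    · simp
  have hv_last : v S₀ = ∑ k ∈ Finset.range (s + 1), cEntry c j (k + 1) / cEntry c (j + 1) k := by
    have h1 := congrArg (fun u => alternatingRow c (j + 1) s ⬝ᵥ u) hAv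
    simp only [Matrix.dotProduct_mulVec, h.row S₀ rfl, single_dotProduct] at h1
    have h2 : alternatingRow c (j + 1) s ⬝ᵥ w =
        (-1) ^ s * ∑ k ∈ Finset.range (s + 1), cEntry c j (k + 1) / cEntry c (j + 1) k := by
      rw [← sum_ite_le_eq_sum_range (n := n) s (by omega), Finset.mul_sum, dotProduct]
      refine Finset.sum_congr rfl fun a _ => ?_
      simp only [alternatingRow, hw]
      split_ifs with ha
      · have e : ((-1 : K)) ^ s = (-1) ^ (a : ℕ) * (-1) ^ (s - (a : ℕ)) := by
          rw [← pow_add, Nat.add_sub_cancel' ha]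
        rw [e]; ring
      · simp
    rw [h2] at h1
    exact mul_left_cancel₀ (pow_ne_zero _ (by norm_num)) h1
  have hLw : ∀ a : Fin (n + 1), Matrix.mulVec L w a =
      if a = S then cEntry c j (s + 1)
      else if (a : ℕ) = 0 then (-1) ^ s else 0 := by
    intro a
    rw [hL, blockMat, lowBi_mulVec]
    have h1 := hne j
    simp only [hw]
    have hlast : cEntry c j (s + 1 + 1) = 1 := cEntry_of_lt _ (by omega)
    rcases lt_trichotomy (a : ℕ) (s + 1) with ha | ha | ha
    · rw [if_neg (c := a = S) (by intro h'; rw [h'] at ha; simp [hS] at ha), if_pos (by omega)]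
      by_cases ha0 : (a : ℕ) = 0
      · rw [dif_neg (by omega), if_pos ha0, ha0, cEntry_zero, Nat.sub_zero]
        have := h1 (0 + 1)
        field_simp
        simp
      · rw [dif_pos ⟨by omega, by omega⟩, if_neg ha0, if_pos (by omega)]
        have e1 : (a : ℕ) - 1 + 1 = a := by omega
        have e2 : s - ((a : ℕ) - 1) = s - a + 1 := by omega
        have := h1 (a + 1)
        simp only [e1, e2]
        field_simp
        ring
    · have haS : a = S := Fin.ext ha
      rw [if_pos haS, if_neg (by omega), mul_zero, zero_add, dif_pos ⟨by omega, by omega⟩,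
        if_pos (by omega)]
      have e1 : (a : ℕ) - 1 + 1 = s + 1 := by omega
      have e2 : s - ((a : ℕ) - 1) = 0 := by omega
      simp only [e1, e2, pow_zero, one_mul]
    · rw [if_neg (c := a = S) (by intro h'; rw [h'] at ha; simp [hS] at ha),
        if_neg (c := (a : ℕ) = 0) (by omega), if_neg (c := (a : ℕ) ≤ s) (by omega), mul_zero,
        zero_add]
      split_ifs
      · omega
      · rfl
      · rfl
  have hVrow : ∀ b, V S b = if S = b then 1 else 0 := by
    intro b
    by_cases hb : s < (b : ℕ)
    · exact h.upper_outside S b hb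
    · have hlt : b < S := by rw [Fin.lt_def]; simp only [hS]; omega
      rw [h.upper.1 S b hlt, if_neg hlt.ne']
  set N : Matrix (Fin (n + 1)) (Fin (n + 1)) K := Matrix.vecMulVec v (Pi.single S 1) with hN
  have hNN : N * N = 0 := by
    rw [hN, Matrix.vecMulVec_mul_vecMulVec, single_dotProduct, hv_out S (Nat.lt_succ_self s)]
    simp
  have hLAS : ∀ a, (L * A) a S = if a = S then cEntry c j (s + 1) else 0 := by
    intro a
    rw [hL, blockMat, lowBi_mul]
    have hlast : cEntry c j (s + 1 + 1) = 1 := cEntry_of_lt _ (by omega)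
    simp only [h.anti_outside _ S (.inr (Nat.lt_succ_self s))]
    by_cases haS : a = S
    · subst haS
      simp only [if_true]
      rw [hlast, div_one, mul_one, dif_pos ⟨by simp [hS], by simp only [hS]; omega⟩, if_neg, add_zero]
      intro h'
      have := congrArg Fin.val h'
      simp only [hS] at this
      omega
    · rw [if_neg haS, if_neg haS, mul_zero, zero_add]
      split_ifs with h1 h2
      · have := congrArg Fin.val h2
        simp only [hS] at this
        omega
      · rfl
      · rfl
  have hAN : L * A * N = Matrix.vecMulVec (Matrix.mulVec L w) (Pi.single S 1) := by
    rw [hN, Matrix.mul_vecMulVec, ← Matrix.mulVec_mulVec, hAv]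
  have hNV : N * V = N := by
    rw [hN, Matrix.vecMulVec_mul]
    congr 1
    funext b
    rw [Matrix.single_one_vecMul]
    rw [Matrix.row_apply, hVrow, Pi.single_apply]
    simp only [eq_comm]
  have hA' : ∀ a b, (L * A * (1 - N)) a b =
      (L * A) a b - if b = S then Matrix.mulVec L w a else 0 := by
    intro a b
    rw [mul_sub, mul_one, hAN, Matrix.sub_apply, Matrix.vecMulVec_apply, Pi.single_apply]
    simp
  have hV' : ∀ a b, ((1 + N) * V) a b = V a b + if b = S then v a else 0 := by
    intro a b
    rw [add_mul, one_mul, hNV, Matrix.add_apply, hN, Matrix.vecMulVec_apply, Pi.single_apply]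
    simp
  have hLA : ∀ a b : Fin (n + 1), (L * A) a b = cEntry c j a / cEntry c j (a + 1) * A a b +
      if h : 1 ≤ (a : ℕ) ∧ (a : ℕ) - 1 < n - j then A ⟨a - 1, by omega⟩ b else 0 := by
    intro a b
    rw [hL, blockMat, lowBi_mul]
  -- since `N² = 0`, the two corrections cancel in the product
  refine ⟨L * A * (1 - N), (1 + N) * V, ?_⟩
  constructor
  · rw [blockProd_succ, h.fact, ← mul_assoc, ← mul_assoc (L * A * (1 - N)), mul_assoc (L * A)]
    have : (1 - N) * (1 + N) = 1 := by
      rw [mul_add, sub_mul, sub_mul, hNN, mul_one, one_mul]; simp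
    rw [this, mul_one, ← hL]
  · constructor
    · intro a b hab
      rw [hV', h.upper.1 a b hab, zero_add]
      split_ifs with hb
      · exact hv_out a (by rw [hb, Fin.lt_def] at hab; simp only [hS] at hab; omega)
      · rfl
    · intro a
      rw [hV', h.upper.2 a]
      split_ifs with ha
      · rw [ha, hv_out S (by simp [hS]), add_zero]
      · rw [add_zero]
  · intro a b hb
    rw [hV', if_neg (by intro h'; rw [h'] at hb; simp [hS] at hb), add_zero,
      h.upper_outside a b (by omega)]
  · intro a b ha hb hab
    rw [hA']
    by_cases hbS : b = S
    · rw [if_pos hbS, hbS, hLAS, hLw]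
      have ha0 : (a : ℕ) ≠ 0 := by
        intro h'
        rw [h', hbS] at hab
        simp [hS] at hab
      rw [if_neg ha0, sub_self]
    · have hbS' : (b : ℕ) ≠ s + 1 := fun h' => hbS (Fin.ext h')
      rw [if_neg hbS, sub_zero, hLA, dif_pos ⟨by omega, by omega⟩,
        h.anti_zero ⟨a - 1, by omega⟩ b (by simp only; omega) (by omega) (by simp only; omega)]
      by_cases ha' : (a : ℕ) ≤ s
      · rw [h.anti_zero a b ha' (by omega) (by omega)]; simp
      · rw [h.anti_outside a b (.inl (by omega)), if_neg (by intro h'; rw [h'] at ha'; omega)]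
        simp
  · intro a b hab
    rw [hA']
    rcases lt_or_ge (s + 1) (b : ℕ) with hb | hb
    · rw [if_neg (c := b = S) (by intro h'; rw [h'] at hb; simp [hS] at hb), sub_zero, hLA,
        h.anti_outside a b (.inr (by omega))]
      have hz : ∀ h' : 1 ≤ (a : ℕ) ∧ (a : ℕ) - 1 < n - j,
          A ⟨a - 1, by omega⟩ b = 0 := by
        intro h'
        rw [h.anti_outside _ b (.inr (by omega)), if_neg]
        intro h''
        have := congrArg Fin.val h''
        simp only at this
        omega
      have hz' : (if h' : 1 ≤ (a : ℕ) ∧ (a : ℕ) - 1 < n - j then A ⟨a - 1, by omega⟩ b else 0) =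
          0 := by
        split_ifs with h'
        · exact hz h'
        · rfl
      rw [hz', add_zero]
      split_ifs with hab'
      · subst hab'
        rw [cEntry_of_lt c (by omega), cEntry_of_lt c (by omega)]
        simp
      · rw [mul_zero]
    · have ha : s + 1 < (a : ℕ) := by omega
      have haS : a ≠ S := by intro h'; rw [h'] at ha; simp [hS] at ha
      rw [hLA, dif_neg (by omega), h.anti_outside a b (.inl (by omega)), add_zero, hLw,
        if_neg haS, if_neg (c := a = b) (by intro h'; rw [h'] at ha; omega),
        if_neg (c := (a : ℕ) = 0) (by omega)]
      simp
  · intro a b hab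
    rw [hA']
    by_cases hbS : b = S
    · have ha : (a : ℕ) = 0 := by rw [hbS] at hab; simp only [hS] at hab; omega
      have haS : a ≠ S := by intro h'; rw [h'] at ha; simp [hS] at ha
      rw [if_pos hbS, hbS, hLAS, hLw, if_neg haS, if_neg haS, if_pos ha, zero_sub]
      simp only [hS]
      ring
    · have hbS' : (b : ℕ) ≠ s + 1 := fun h' => hbS (Fin.ext h')
      rw [if_neg hbS, sub_zero, hLA, dif_pos ⟨by omega, by omega⟩,
        h.anti_diag ⟨a - 1, by omega⟩ b (by simp only; omega)]
      by_cases ha' : (a : ℕ) ≤ s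
      · rw [h.anti_zero a b ha' (by omega) (by omega)]; simp
      · rw [h.anti_outside a b (.inl (by omega)), if_neg (by intro h'; rw [h'] at hab; omega)]
        simp
  · intro a b hab
    have hbS : b ≠ S := by intro h'; rw [h'] at hab; simp only [hS] at hab; omega
    rw [hA', if_neg hbS, sub_zero, hLA, h.anti_diag a b (by omega), Finset.sum_range_succ']
    simp only [Nat.sub_zero, Nat.add_zero, mul_add]
    rw [add_comm]
    congr 1
    · by_cases ha : (a : ℕ) = 0
      · rw [dif_neg (by omega), ha]
        simp
      · rw [dif_pos ⟨by omega, by omega⟩,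
          h.anti_near ⟨a - 1, by omega⟩ b (by simp only; omega)]
        congr 1
        simp only [show (a : ℕ) - 1 + 1 = a by omega]
        refine Finset.sum_congr rfl fun m hm => ?_
        have e1 : (a : ℕ) - 1 - m = a - (m + 1) := by omega
        have e2 : j + 1 + m = j + (m + 1) := by omega
        rw [e1, e2]
    · ring
  · intro a b hab hb
    rw [hV']
    by_cases hbS : b = S
    · have ha : a = S₀ := by
        apply Fin.ext
        rw [hbS] at hab
        simp only [hS, hS₀] at hab ⊢
        omega
      have hjn : n - 1 - s = j := by omega
      have hjn' : n - s = j + 1 := by omega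
      rw [if_pos hbS, hbS, ha, h.upper_outside S₀ S (by simp [hS]),
        if_neg (by intro h'; have := congrArg Fin.val h'; simp [hS, hS₀] at this), zero_add,
        hv_last]
      simp only [hS₀, hjn, hjn']
    · have hbS' : (b : ℕ) ≠ s + 1 := fun h' => hbS (Fin.ext h')
      rw [if_neg hbS, add_zero, h.upper_near a b hab (by omega)]
  · intro S' hS'
    have hSS : S' = S := Fin.ext hS'
    rw [hSS, ← Matrix.vecMul_vecMul, ← Matrix.vecMul_vecMul, hL,
      alternatingRow_vecMul_blockMat c hjs S rfl]
    have h1 : Matrix.vecMul (Pi.single S ((-1) ^ (s + 1))) A = Pi.single S ((-1) ^ (s + 1)) := by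
      funext b
      rw [Matrix.single_vecMul, Pi.smul_apply, Matrix.row_apply,
        h.anti_outside S b (.inl (by simp [hS])), Pi.single_apply]
      simp [eq_comm]
    rw [h1, Matrix.vecMul_sub, Matrix.vecMul_one, hN, Matrix.vecMul_vecMulVec, single_dotProduct,
      hv_out S (by simp [hS])]
    simp

lemma exists_isGaussPair (c : Pos n → Kˣ) {j s : ℕ} (hjs : j + s = n) :
    ∃ A V, IsGaussPair c j s A V := by
  induction s generalizing j with
  | zero =>
    obtain rfl : j = n := by omega
    exact ⟨1, 1, isGaussPair_zero c⟩
  | succ s ih =>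
    obtain ⟨A, V, h⟩ := ih (j := j + 1) (by omega)
    exact h.succ hjs

end Geometric

section Geometric

variable {n : ℕ} {K : Type} [Field K]

/-! ### Triangular matrices and the projection `π⁺` -/

lemma IsUpperUni.det {u : Matrix (Fin (n + 1)) (Fin (n + 1)) K} (hu : IsUpperUni u) :
    u.det = 1 := by
  rw [Matrix.det_of_isUpperTriangular (fun i j h => hu.1 i j h)]
  exact Finset.prod_eq_one fun i _ => hu.2 i

/-- The product of upper triangular matrices next to the diagonal. -/
lemma mul_apply_succ_of_upper {X Y : Matrix (Fin (n + 1)) (Fin (n + 1)) K}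
    (hX : ∀ i j, j < i → X i j = 0) (hY : ∀ i j, j < i → Y i j = 0) (i : Fin n) :
    (X * Y) i.castSucc i.succ =
      X i.castSucc i.castSucc * Y i.castSucc i.succ + X i.castSucc i.succ * Y i.succ i.succ := by
  rw [Matrix.mul_apply, Finset.sum_eq_add i.castSucc i.succ (Fin.castSucc_lt_succ).ne]
  · intro k _ hk
    rcases lt_or_ge k i.castSucc with h | h
    · rw [hX _ _ h, zero_mul]
    · have h1 := hk.1
      have h2 := hk.2
      rw [hY _ _ (by
        rw [ne_eq, Fin.ext_iff, Fin.val_castSucc] at h1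
        rw [ne_eq, Fin.ext_iff, Fin.val_succ] at h2
        rw [Fin.le_def, Fin.val_castSucc] at h
        rw [Fin.lt_def, Fin.val_succ]
        omega), mul_zero]
  · simp
  · simp

lemma mul_apply_self_of_upper {X Y : Matrix (Fin (n + 1)) (Fin (n + 1)) K}
    (hX : ∀ i j, j < i → X i j = 0) (hY : ∀ i j, j < i → Y i j = 0) (i : Fin (n + 1)) :
    (X * Y) i i = X i i * Y i i := by
  rw [Matrix.mul_apply, Finset.sum_eq_single i]
  · intro k _ hk
    rcases lt_or_gt_of_ne hk with h | h
    · rw [hX _ _ h, zero_mul]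
    · rw [hY _ _ h, mul_zero]
  · simp

lemma IsUpperUni.mul {u v : Matrix (Fin (n + 1)) (Fin (n + 1)) K} (hu : IsUpperUni u)
    (hv : IsUpperUni v) : IsUpperUni (u * v) := by
  refine ⟨fun i j h => ?_, fun i => ?_⟩
  · exact Matrix.BlockTriangular.mul (b := id) (fun i j h => hu.1 i j h)
      (fun i j h => hv.1 i j h) h
  · rw [mul_apply_self_of_upper hu.1 hv.1, hu.2, hv.2, mul_one]

lemma IsUpperUni.inv {u : Matrix (Fin (n + 1)) (Fin (n + 1)) K} (hu : IsUpperUni u) :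
    IsUpperUni u⁻¹ := by
  have hunit : IsUnit u.det := by rw [hu.det]; exact isUnit_one
  have := Matrix.invertibleOfIsUnitDet u hunit
  have h1 : ∀ i j, j < i → u⁻¹ i j = 0 := fun i j h =>
    Matrix.blockTriangular_inv_of_blockTriangular (b := id) (fun i j h => hu.1 i j h) h
  refine ⟨h1, fun i => ?_⟩
  have h2 := mul_apply_self_of_upper hu.1 h1 i
  rw [Matrix.mul_nonsing_inv _ hunit, Matrix.one_apply_eq, hu.2, one_mul] at h2
  exact h2.symm

lemma IsUpperUni.inv_apply_succ {u : Matrix (Fin (n + 1)) (Fin (n + 1)) K} (hu : IsUpperUni u)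
    (i : Fin n) : u⁻¹ i.castSucc i.succ = -u i.castSucc i.succ := by
  have hunit : IsUnit u.det := by rw [hu.det]; exact isUnit_one
  have h := mul_apply_succ_of_upper hu.1 hu.inv.1 i
  rw [Matrix.mul_nonsing_inv _ hunit, Matrix.one_apply_ne (Fin.castSucc_lt_succ).ne, hu.2,
    hu.inv.2, one_mul, mul_one] at h
  linear_combination -h

/-- Uniqueness of the decomposition in `B⁻ U`. -/
lemma isUpperUni_unique {b b' u u' : Matrix (Fin (n + 1)) (Fin (n + 1)) K}
    (h : b * u = b' * u') (hdet : b.det ≠ 0) (hb : IsLower b) (hb' : IsLower b')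
    (hu : IsUpperUni u) (hu' : IsUpperUni u') : u = u' := by
  have hbu : IsUnit b.det := hdet.isUnit
  have hu'u : IsUnit u'.det := by rw [hu'.det]; exact isUnit_one
  have := Matrix.invertibleOfIsUnitDet b hbu
  have hbi : Matrix.BlockTriangular b⁻¹ OrderDual.toDual :=
    Matrix.blockTriangular_inv_of_blockTriangular fun i j h => hb i j h
  have hq : u * u'⁻¹ = b⁻¹ * b' := by
    have h1 : b⁻¹ * (b * u) * u'⁻¹ = b⁻¹ * (b' * u') * u'⁻¹ := by rw [h]
    rw [← mul_assoc, Matrix.nonsing_inv_mul _ hbu, one_mul, mul_assoc, mul_assoc,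
      Matrix.mul_nonsing_inv _ hu'u, mul_one] at h1
    exact h1
  have hup := hu.mul hu'.inv
  have hlow : IsLower (u * u'⁻¹) := by
    rw [hq]
    intro i j hij
    exact Matrix.BlockTriangular.mul hbi (fun i j h => hb' i j h) hij
  have hone : u * u'⁻¹ = 1 := by
    ext i j
    rcases lt_trichotomy i j with hij | hij | hij
    · rw [hlow i j hij, Matrix.one_apply_ne hij.ne]
    · rw [hij, hup.2, Matrix.one_apply_eq]
    · rw [hup.1 i j hij, Matrix.one_apply_ne hij.ne']
  calc u = u * u'⁻¹ * u' := by rw [mul_assoc, Matrix.nonsing_inv_mul _ hu'u, mul_one]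
    _ = u' := by rw [hone, one_mul]

lemma piPlus_eq {g b u : Matrix (Fin (n + 1)) (Fin (n + 1)) K} (h : g = b * u)
    (hdet : g.det ≠ 0) (hb : IsLower b) (hu : IsUpperUni u) : piPlus g = u := by
  have hex : ∃ u, IsUpperUni u ∧ ∃ b, IsLower b ∧ g = b * u := ⟨u, hu, b, hb, h⟩
  rw [piPlus, dif_pos hex]
  obtain ⟨hu', b', hb', h'⟩ := hex.choose_spec
  refine isUpperUni_unique (h'.symm.trans h) ?_ hb' hb hu' hu
  rw [h', Matrix.det_mul] at hdet
  exact left_ne_zero_of_mul hdet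

/-! ### The decoration in the chart -/

lemma transpose_wZeroBar_mul (M : Matrix (Fin (n + 1)) (Fin (n + 1)) K) (a b : Fin (n + 1)) :
    ((wZeroBar n K).transpose * M) a b = (-1) ^ (a : ℕ) * M a.rev b := by
  rw [Matrix.mul_apply, Finset.sum_eq_single a.rev]
  · rw [Matrix.transpose_apply, wZeroBar_apply, if_pos (by rw [Fin.val_rev]; omega)]
  · intro k _ hk
    rw [Matrix.transpose_apply, wZeroBar_apply, if_neg, zero_mul]
    intro h
    exact hk (Fin.ext (by rw [Fin.val_rev]; omega))
  · simp

lemma mul_transpose_wZeroBar (M : Matrix (Fin (n + 1)) (Fin (n + 1)) K) (a b : Fin (n + 1)) :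
    (M * (wZeroBar n K).transpose) a b = M a b.rev * (-1) ^ (b.rev : ℕ) := by
  rw [Matrix.mul_apply, Finset.sum_eq_single b.rev]
  · rw [Matrix.transpose_apply, wZeroBar_apply, if_pos (by rw [Fin.val_rev]; omega)]
  · intro k _ hk
    rw [Matrix.transpose_apply, wZeroBar_apply, if_neg, mul_zero]
    intro h
    exact hk (Fin.ext (by rw [Fin.val_rev]; omega))
  · simp

lemma neg_one_pow_mul_self (k : ℕ) : (-1 : K) ^ k * (-1) ^ k = 1 := by
  rw [← mul_pow]; simp

variable (n K) in
lemma wZeroBar_mul_transpose : wZeroBar n K * (wZeroBar n K).transpose = 1 := by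
  ext a b
  rw [mul_transpose_wZeroBar, wZeroBar_apply, Matrix.one_apply]
  by_cases h : a = b
  · rw [if_pos (by rw [h, Fin.val_rev]; omega), if_pos h, neg_one_pow_mul_self]
  · rw [if_neg, if_neg h, zero_mul]
    intro h'
    rw [Fin.val_rev] at h'
    exact h (Fin.ext (by omega))

variable (n K) in
lemma wZeroBar_inv : (wZeroBar n K)⁻¹ = (wZeroBar n K).transpose :=
  Matrix.inv_eq_right_inv (wZeroBar_mul_transpose n K)

variable (n K) in
lemma det_wZeroBar_inv_ne_zero : ((wZeroBar n K)⁻¹).det ≠ 0 := by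
  intro h
  have := congrArg Matrix.det (wZeroBar_mul_transpose n K)
  rw [← wZeroBar_inv, Matrix.det_mul, h] at this
  simp at this

section Decoration

variable {c : Pos n → Kˣ} {A V : Matrix (Fin (n + 1)) (Fin (n + 1)) K} (t : Fin (n + 1) → Kˣ)

lemma IsGaussPair.isLower (h : IsGaussPair c 0 n A V) :
    IsLower ((wZeroBar n K)⁻¹ * (Matrix.diagonal (fun k => (t k : K)) * A)) := by
  intro a b hab
  rw [wZeroBar_inv, transpose_wZeroBar_mul, Matrix.diagonal_mul,
    h.anti_zero _ _ (by omega) (by omega) (by rw [Fin.val_rev]; omega)]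
  simp

lemma det_diagonal_units_ne_zero : (Matrix.diagonal (fun k => (t k : K))).det ≠ 0 := by
  rw [Matrix.det_diagonal]
  exact Finset.prod_ne_zero_iff.2 fun k _ => Units.ne_zero _

lemma det_chart_ne_zero (p : TorusPt n K) : (chart p).det ≠ 0 := by
  rw [chart_eq, Matrix.det_mul]
  exact mul_ne_zero (det_diagonal_units_ne_zero _) (det_blockProd_ne_zero _ _ _)

lemma IsGaussPair.piPlus_eq (h : IsGaussPair c 0 n A V) :
    piPlus ((wZeroBar n K)⁻¹ * chart (t, c)) = V := by
  refine DecCrystal.piPlus_eq ?_ ?_ (h.isLower t) h.upper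
  · rw [chart_eq, h.fact]; simp only [mul_assoc]
  · rw [Matrix.det_mul]
    exact mul_ne_zero (det_wZeroBar_inv_ne_zero n K) (det_chart_ne_zero _)

/-- The factor `u₁` of `chart = t u₁ w̄_0 V` is upper unitriangular. -/
lemma IsGaussPair.left_isUpperUni (h : IsGaussPair c 0 n A V) :
    IsUpperUni (A * (wZeroBar n K)⁻¹) := by
  rw [wZeroBar_inv]
  refine ⟨fun a b hab => ?_, fun a => ?_⟩
  · rw [mul_transpose_wZeroBar, h.anti_zero _ _ (by omega) (by omega)
      (by rw [Fin.val_rev]; omega), zero_mul]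
  · rw [mul_transpose_wZeroBar, h.anti_diag _ _ (by rw [Fin.val_rev]; omega),
      neg_one_pow_mul_self]

lemma IsGaussPair.left_apply_succ (h : IsGaussPair c 0 n A V) (i : Fin n) :
    (A * (wZeroBar n K)⁻¹) i.castSucc i.succ =
      ∑ m ∈ Finset.range (i + 1), cEntry c m (i - m) / cEntry c m (i - m + 1) := by
  rw [wZeroBar_inv, mul_transpose_wZeroBar, h.anti_near _ _
    (by rw [Fin.val_rev, Fin.val_castSucc, Fin.val_succ]; omega), mul_comm, ← mul_assoc,
    neg_one_pow_mul_self, one_mul]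
  simp only [zero_add, Fin.val_castSucc]

/-- With `chart = t u₁ w̄_0 V`, the positive inverse turns `t u₁ t⁻¹` into the right factor. -/
lemma IsGaussPair.piPlus_posInv_eq (h : IsGaussPair c 0 n A V) (i : Fin n) :
    piPlus ((wZeroBar n K)⁻¹ * posInv (chart (t, c))) i.castSucc i.succ =
      (t i.castSucc : K) / t i.succ * (A * (wZeroBar n K)⁻¹) i.castSucc i.succ := by
  set W := wZeroBar n K with hW
  set U := A * W⁻¹ with hU
  set D : Matrix (Fin (n + 1)) (Fin (n + 1)) K :=
    Matrix.diagonal (fun k : Fin (n + 1) => (-1 : K) ^ (k : ℕ)) with hD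
  set T : Matrix (Fin (n + 1)) (Fin (n + 1)) K := Matrix.diagonal (fun k => (t k : K)) with hT
  set T' : Matrix (Fin (n + 1)) (Fin (n + 1)) K :=
    Matrix.diagonal (fun k => (t k : K)⁻¹) with hT'
  have hDD : D * D = 1 := by
    rw [hD, Matrix.diagonal_mul_diagonal, ← Matrix.diagonal_one]
    congr 1
    funext k
    exact neg_one_pow_mul_self _
  have hTT : T' * T = 1 := by
    rw [hT, hT', Matrix.diagonal_mul_diagonal, ← Matrix.diagonal_one]
    congr 1
    funext k
    exact inv_mul_cancel₀ (Units.ne_zero _)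
  have hTi : T⁻¹ = T' := Matrix.inv_eq_left_inv hTT
  have hUu : IsUpperUni U := h.left_isUpperUni
  have hWdet : IsUnit W.det := by
    have := det_wZeroBar_inv_ne_zero n K
    exact Matrix.isUnit_nonsing_inv_det_iff.1 this.isUnit
  have hAU : A = U * W := by rw [hU, mul_assoc, Matrix.nonsing_inv_mul _ hWdet, mul_one]
  have hg : chart (t, c) = T * (U * W * V) := by rw [chart_eq, h.fact, ← hAU]
  have hgi : (chart (t, c))⁻¹ = V⁻¹ * W⁻¹ * U⁻¹ * T' := by
    rw [hg, Matrix.mul_inv_rev, Matrix.mul_inv_rev, Matrix.mul_inv_rev, hTi]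
    simp only [mul_assoc]
  have hpi : posInv (chart (t, c)) = D * (V⁻¹ * W⁻¹ * U⁻¹ * T') * D := by
    rw [← hgi]; rfl
  have hu : ∀ a b, (D * (T * U⁻¹ * T') * D) a b =
      (-1) ^ (a : ℕ) * ((t a : K) * U⁻¹ a b * (t b : K)⁻¹) * (-1) ^ (b : ℕ) := by
    intro a b
    rw [hD, hT, hT', Matrix.mul_diagonal, Matrix.diagonal_mul, Matrix.mul_diagonal,
      Matrix.diagonal_mul]
  have hup : IsUpperUni (D * (T * U⁻¹ * T') * D) := by
    refine ⟨fun a b hab => ?_, fun a => ?_⟩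
    · rw [hu, hUu.inv.1 a b hab]; simp
    · rw [hu, hUu.inv.2 a, mul_one, mul_inv_cancel₀ (Units.ne_zero _), mul_one,
        neg_one_pow_mul_self]
  have hlow : IsLower (W⁻¹ * (D * V⁻¹) * W⁻¹ * T' * D) := by
    intro a b hab
    rw [hD, Matrix.mul_diagonal, hT', Matrix.mul_diagonal, hW, wZeroBar_inv,
      mul_transpose_wZeroBar, transpose_wZeroBar_mul, Matrix.diagonal_mul,
      h.upper.inv.1 _ _ (Fin.rev_lt_rev.2 hab)]
    simp
  have hfac : W⁻¹ * posInv (chart (t, c)) =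
      (W⁻¹ * (D * V⁻¹) * W⁻¹ * T' * D) * (D * (T * U⁻¹ * T') * D) := by
    rw [hpi]
    calc W⁻¹ * (D * (V⁻¹ * W⁻¹ * U⁻¹ * T') * D)
        = W⁻¹ * (D * V⁻¹) * W⁻¹ * 1 * U⁻¹ * T' * D := by simp only [mul_assoc, mul_one]
      _ = W⁻¹ * (D * V⁻¹) * W⁻¹ * (T' * (D * D) * T) * U⁻¹ * T' * D := by
        rw [hDD, mul_one T', hTT]
      _ = _ := by simp only [mul_assoc]
  have hdet : (W⁻¹ * posInv (chart (t, c))).det ≠ 0 := by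
    have hDdet : D.det ≠ 0 := by
      intro h0
      have := congrArg Matrix.det hDD
      rw [Matrix.det_mul, h0] at this
      simp at this
    have hcdet : ((chart (t, c))⁻¹).det ≠ 0 :=
      (Matrix.isUnit_nonsing_inv_det _ (det_chart_ne_zero (t, c)).isUnit).ne_zero
    rw [Matrix.det_mul, posInv, Matrix.det_mul, Matrix.det_mul]
    exact mul_ne_zero (det_wZeroBar_inv_ne_zero n K)
      (mul_ne_zero (mul_ne_zero hDdet hcdet) hDdet)
  rw [DecCrystal.piPlus_eq hfac hdet hlow hup, hu, hUu.inv_apply_succ, Fin.val_castSucc,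
    Fin.val_succ, pow_succ]
  have hsq := neg_one_pow_mul_self (K := K) i
  linear_combination ((t i.castSucc : K) * U i.castSucc i.succ * (t i.succ : K)⁻¹) * hsq

end Decoration

/-- The decoration in the chart is the sum of the `c_{j;b} / c_{j+1;b-1}` over all positions and of
the `α_i(t) c_{m;i-m} / c_{m;i-m+1}`, blocks being counted from zero and `c` being `1` outside the
triangle. -/
lemma decoration_chart (t : Fin (n + 1) → Kˣ) (c : Pos n → Kˣ) :
    decoration (chart (t, c)) =
      (∑ i : Fin n, ∑ k ∈ Finset.range (i + 1),
        cEntry c (n - 1 - i) (k + 1) / cEntry c (n - i) k) +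
      ∑ i : Fin n, ∑ m ∈ Finset.range (i + 1), (t i.castSucc : K) / t i.succ *
        (cEntry c m (i - m) / cEntry c m (i - m + 1)) := by
  obtain ⟨A, V, h⟩ := exists_isGaussPair c (zero_add n)
  rw [decoration, h.piPlus_eq]
  simp only [chiSt, h.piPlus_posInv_eq, h.left_apply_succ, Finset.mul_sum]
  congr 1
  refine Finset.sum_congr rfl fun i _ => ?_
  rw [h.upper_near _ _ (by rw [Fin.val_succ, Fin.val_castSucc]) (by omega), Fin.val_castSucc]

/-! ### Injectivity of the chart -/

lemma alternatingRow_vecMul_blockProd (c : Pos n → Kˣ) {j s : ℕ} (hjs : j + s = n)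
    (S : Fin (n + 1)) (hS : (S : ℕ) = s) :
    Matrix.vecMul (alternatingRow c j s) (blockProd c j s) = Pi.single S ((-1) ^ s) := by
  obtain ⟨A, V, h⟩ := exists_isGaussPair c hjs
  rw [h.fact, ← Matrix.vecMul_vecMul, h.row S hS]
  funext b
  rw [Matrix.single_vecMul, Pi.smul_apply, Matrix.row_apply, Pi.single_apply]
  rcases lt_trichotomy b S with hb | hb | hb
  · rw [h.upper.1 S b hb, if_neg hb.ne]; simp
  · rw [hb, h.upper.2, if_pos rfl]; simp
  · rw [h.upper_outside S b (by rw [← hS]; exact hb), if_neg hb.ne, if_neg hb.ne']; simp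

/-- The alternating row of the first block is recovered from the product as a preimage of a fixed
vector; it determines the first block, which can then be cancelled. -/
lemma blockProd_injective {c c' : Pos n → Kˣ} {j s : ℕ} (hjs : j + s = n)
    (h : blockProd c j s = blockProd c' j s) (q : Pos n) (hq : j ≤ q.1) : c q = c' q := by
  induction s generalizing j with
  | zero =>
    have := q.fst_add_snd_lt
    omega
  | succ s ih =>
    have hrow : alternatingRow c j (s + 1) = alternatingRow c' j (s + 1) := by
      have h1 := alternatingRow_vecMul_blockProd c hjs ⟨s + 1, by omega⟩ rfl
      have h2 := alternatingRow_vecMul_blockProd c' hjs ⟨s + 1, by omega⟩ rfl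
      rw [h, ← h2] at h1
      have hu : IsUnit (blockProd c' j (s + 1)) :=
        (Matrix.isUnit_iff_isUnit_det _).2 (det_blockProd_ne_zero c' j (s + 1)).isUnit
      exact Matrix.vecMul_injective_of_isUnit hu h1
    have hentry : ∀ b, cEntry c j b = cEntry c' j b := by
      intro b
      by_cases hb : b ≤ s + 1
      · have h1 := congrFun hrow ⟨b, by omega⟩
        simp only [alternatingRow] at h1
        rw [if_pos hb, if_pos hb] at h1
        have h2 : ((-1 : K)) ^ b ≠ 0 := pow_ne_zero _ (by norm_num)
        exact inv_injective (mul_left_cancel₀ h2 (by simpa only [div_eq_mul_inv] using h1))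
      · rw [cEntry_of_lt c (by omega), cEntry_of_lt c' (by omega)]
    by_cases hqj : (q.1 : ℕ) = j
    · apply Units.ext
      rw [← cEntry_pos c, ← cEntry_pos c']
      simp only [hqj, hentry]
    · refine ih (j := j + 1) (by omega) ?_ (by omega)
      have hblock : blockMat c j = blockMat c' j := by
        unfold blockMat
        simp only [hentry]
      rw [blockProd_succ, blockProd_succ, hblock] at h
      have hu : IsUnit (blockMat c' j) :=
        (Matrix.isUnit_iff_isUnit_det _).2 (det_blockMat_ne_zero c' j).isUnit
      exact hu.mul_left_cancel h

lemma chart_injective : Function.Injective (chart : TorusPt n K → _) := by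
  rintro ⟨t, c⟩ ⟨t', c'⟩ h
  obtain ⟨A, V, hG⟩ := exists_isGaussPair c (zero_add n)
  obtain ⟨A', V', hG'⟩ := exists_isGaussPair c' (zero_add n)
  have hV : V = V' := by rw [← hG.piPlus_eq t, ← hG'.piPlus_eq t', h]
  have hVu : IsUnit V' := by
    rw [Matrix.isUnit_iff_isUnit_det, hG'.upper.det]; exact isUnit_one
  have h' := h
  rw [chart_eq, chart_eq, hG.fact, hG'.fact, hV, ← mul_assoc, ← mul_assoc] at h'
  have hA := hVu.mul_right_cancel h'
  have ht : t = t' := by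
    funext k
    have h1 := congrFun (congrFun hA k) k.rev
    rw [Matrix.diagonal_mul, Matrix.diagonal_mul, hG.anti_diag _ _ (by rw [Fin.val_rev]; omega),
      hG'.anti_diag _ _ (by rw [Fin.val_rev]; omega)] at h1
    exact Units.ext (mul_right_cancel₀ (pow_ne_zero _ (by norm_num)) h1)
  subst ht
  rw [chart_eq, chart_eq] at h
  have hu : IsUnit (Matrix.diagonal (fun k => (t k : K))) :=
    (Matrix.isUnit_iff_isUnit_det _).2 (det_diagonal_units_ne_zero t).isUnit
  have hP := hu.mul_left_cancel h
  exact Prod.ext rfl (funext fun q => blockProd_injective (zero_add n) hP q (by omega))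

lemma chartInv_chart (p : TorusPt n K) : chartInv (chart p) = p :=
  Function.leftInverse_invFun chart_injective p

end Geometric

section Geometric

variable {n : ℕ} {K : Type} [Field K]

/-! ### The order of the positions in the longest word -/

lemma mem_longWord (q : Pos n) : q ∈ longWord n := by
  obtain ⟨j, i⟩ := q
  simp [longWord]

lemma longWord_pairwise : (longWord n).Pairwise fun p q => p.place < q.place := by
  rw [longWord, List.pairwise_flatMap]
  refine ⟨fun j _ => ?_, ?_⟩
  · rw [List.pairwise_map]
    refine (List.pairwise_lt_finRange _).imp fun {a b} hab => ?_
    exact Nat.add_lt_add_left hab _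
  · refine (List.pairwise_lt_finRange _).imp fun {j j'} hjj p hp q hq => ?_
    simp only [List.mem_map, List.mem_finRange, true_and] at hp hq
    obtain ⟨a, rfl⟩ := hp
    obtain ⟨b, rfl⟩ := hq
    have h1 : ((j : ℕ) + 1) * n ≤ j' * n := Nat.mul_le_mul_right n hjj
    have h2 := a.isLt
    rw [add_mul, one_mul] at h1
    change (j : ℕ) * n + a < j' * n + b
    omega

/-- Membership in a final segment of the longest word. -/
lemma mem_suffix_iff {pre l : List (Pos n)} {q : Pos n} (h : longWord n = pre ++ q :: l)
    (r : Pos n) : r ∈ l ↔ q.place < r.place := by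
  have hs := longWord_pairwise (n := n)
  have hr := mem_longWord r
  rw [h] at hs hr
  rw [List.pairwise_append, List.pairwise_cons] at hs
  obtain ⟨-, ⟨h1, -⟩, h2⟩ := hs
  refine ⟨h1 r, fun hlt => ?_⟩
  rcases List.mem_append.1 hr with hr | hr
  · have := h2 r hr q (by simp)
    omega
  · rcases List.mem_cons.1 hr with rfl | hr
    · omega
    · exact hr

lemma nodup_suffix {pre l : List (Pos n)} (h : longWord n = pre ++ l) : l.Nodup := by
  have hs : (longWord n).Nodup :=
    longWord_pairwise.imp fun hlt heq => by rw [heq] at hlt; exact lt_irrefl _ hlt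
  rw [h] at hs
  exact (List.nodup_append.1 hs).2.1

/-! ### Moving `x_i(z)` through the chart -/

lemma xOne_mul_apply (i : Fin n) (z : K) (M : Matrix (Fin (n + 1)) (Fin (n + 1)) K)
    (a b : Fin (n + 1)) :
    (xOne i z * M) a b = M a b + if a = i.castSucc then z * M i.succ b else 0 := by
  rw [xOne, add_mul, one_mul, Matrix.add_apply]
  congr 1
  split_ifs with h
  · subst h; simp
  · rw [Matrix.single_mul_apply_of_ne _ _ _ _ _ h]

lemma xOne_mul_xOne (i : Fin n) (z z' : K) : xOne i z * xOne i z' = xOne i (z + z') := by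
  ext a b
  rw [mul_xOne_apply]
  simp only [xOne, Matrix.add_apply, Matrix.one_apply, Matrix.single_apply, Fin.ext_iff,
    Fin.val_castSucc, Fin.val_succ]
  grind

lemma xOne_zero (i : Fin n) : xOne i (0 : K) = 1 := by simp [xOne]

lemma xOne_mul_diagonal (i : Fin n) (z : K) (t : Fin (n + 1) → Kˣ) :
    xOne i z * Matrix.diagonal (fun k => (t k : K)) =
      Matrix.diagonal (fun k => (t k : K)) * xOne i ((t i.succ : K) / t i.castSucc * z) := by
  have h := Units.ne_zero (t i.castSucc)
  ext a b
  rw [xOne_mul_apply, mul_xOne_apply]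
  simp only [Matrix.diagonal_apply]
  by_cases ha : a = i.castSucc
  · subst ha
    by_cases hb : b = i.succ
    · subst hb; simp; field_simp
    · rw [if_neg (c := i.succ = b) (Ne.symm hb), if_neg hb]; simp
  · rw [if_neg (c := a = i.castSucc) ha, if_neg (c := a = i.castSucc) ha]; simp

/-- The factor `𝐲_j(c) = y_j(c) α_j^∨(c⁻¹)` of the chart. -/
def yBold (j : Fin n) (c : K) : Matrix (Fin (n + 1)) (Fin (n + 1)) K :=
  yOne j c * corootMat j c⁻¹

lemma yBold_apply (j : Fin n) {c : K} (hc : c ≠ 0) (a b : Fin (n + 1)) :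
    yBold j c a b = if (a : ℕ) = b then
        (if (a : ℕ) = j then c⁻¹ else if (a : ℕ) = j + 1 then c else 1)
      else if (a : ℕ) = j + 1 ∧ (b : ℕ) = j then 1 else 0 := by
  rw [yBold, yOne_mul_corootMat j hc, lowBi]
  simp only [Fin.ext_iff]
  grind

lemma cartanMatrix_A_apply (i j : Fin n) : CartanMatrix.A n i j =
    if (i : ℕ) = j then 2 else if (i : ℕ) + 1 = j ∨ (j : ℕ) + 1 = i then -1 else 0 := by
  simp [CartanMatrix.A, Fin.ext_iff]

lemma xOne_mul_yBold_of_ne {i j : Fin n} (hij : i ≠ j) (z : K) {c : K} (hc : c ≠ 0) :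
    xOne i z * yBold j c = yBold j c * xOne i (c ^ CartanMatrix.A n i j * z) := by
  have hij' : (i : ℕ) ≠ j := fun h => hij (Fin.ext h)
  ext a b
  rw [xOne_mul_apply, mul_xOne_apply, cartanMatrix_A_apply, if_neg hij']
  simp only [yBold_apply j hc, Fin.ext_iff, Fin.val_castSucc, Fin.val_succ]
  by_cases h : (i : ℕ) + 1 = j ∨ (j : ℕ) + 1 = i
  · rw [if_pos h, zpow_neg_one]
    grind
  · rw [if_neg h, zpow_zero, one_mul]
    grind

lemma xOne_mul_yBold_self (i : Fin n) {z c : K} (hc : c ≠ 0) (hz : 1 + z * c ≠ 0) :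
    xOne i z * yBold i c =
      yBold i (c / (1 + z * c)) * xOne i (z * c ^ 2 / (1 + z * c)) := by
  have hc' : c / (1 + z * c) ≠ 0 := div_ne_zero hc hz
  ext a b
  rw [xOne_mul_apply, mul_xOne_apply]
  simp only [yBold_apply i hc, yBold_apply i hc', Fin.ext_iff, Fin.val_castSucc, Fin.val_succ]
  grind

variable (i : Fin n) (c : Pos n → K)

/-- The product of the factors of the chart along a list of positions. -/
def yProd (l : List (Pos n)) : Matrix (Fin (n + 1)) (Fin (n + 1)) K :=
  (l.map fun q => yBold q.letter (c q)).prod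

/-- The value `∏ c_q^{-⟨h_i, α_{i_q}⟩}` of `α_i` on the torus part of `yProd c l`. -/
def rootProd (l : List (Pos n)) : K :=
  (l.map fun q => c q ^ (-CartanMatrix.A n i q.letter)).prod

/-- The contribution `c_q⁻¹ ∏_{r > q} c_r^{-⟨h_i, α_{i_r}⟩}` of a position `q` with letter `i` to
`1 / ε_i`. -/
def epsTerm (q : Pos n) : K :=
  (c q)⁻¹ * ∏ r : Pos n with q.place < r.place, c r ^ (-CartanMatrix.A n i r.letter)

/-- The sum of the terms of `1 / ε_i`, those at places before `k` being multiplied by `a`. -/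
def epsSum (a : K) (k : ℕ) : K :=
  ∑ q : Pos n with q.letter = i, (if q.place < k then a else 1) * epsTerm i c q

open Classical in
/-- The coordinates of `e_i^a` applied to the chart. -/
def actCoord (a : K) (q : Pos n) : K :=
  if q.letter = i then c q * epsSum i c a q.place / epsSum i c a (q.place + 1) else c q

variable {i c}

lemma epsTerm_eq {pre l : List (Pos n)} {q : Pos n} (h : longWord n = pre ++ q :: l) :
    epsTerm i c q = (c q)⁻¹ * rootProd i c l := by
  classical
  have hn : l.Nodup := (List.nodup_cons.1 (nodup_suffix h)).2
  rw [epsTerm, rootProd, ← List.prod_toFinset _ hn]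
  congr 1
  refine Finset.prod_congr ?_ fun _ _ => rfl
  ext r
  simp [mem_suffix_iff h r]

lemma epsSum_succ_of_eq {q : Pos n} (hq : q.letter = i) (a : K) :
    epsSum i c a (q.place + 1) = epsSum i c a q.place + (a - 1) * epsTerm i c q := by
  classical
  have hmem : q ∈ Finset.univ.filter fun q : Pos n => q.letter = i := by simp [hq]
  rw [epsSum, epsSum, ← Finset.add_sum_erase _ _ hmem, ← Finset.add_sum_erase _ _ hmem,
    if_pos (Nat.lt_succ_self _), if_neg (lt_irrefl _)]
  rw [Finset.sum_congr rfl (g := fun r => (if r.place < q.place then a else 1) * epsTerm i c r)]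
  · ring
  · intro r hr
    have hne : r.place ≠ q.place :=
      fun h => Finset.ne_of_mem_erase hr (Pos.place_injective h)
    congr 1
    refine if_congr ?_ rfl rfl
    omega

lemma epsSum_succ_of_ne {q : Pos n} (hq : q.letter ≠ i) (a : K) :
    epsSum i c a (q.place + 1) = epsSum i c a q.place := by
  refine Finset.sum_congr rfl fun r hr => ?_
  have hr' : r.letter = i := by simpa using hr
  have hne : r.place ≠ q.place := fun h => by
    rw [Pos.place_injective h] at hr'
    exact hq hr'
  congr 1
  refine if_congr ?_ rfl rfl
  omega

/-- Two thresholds with no position between them give the same sum. -/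
lemma epsSum_congr {k k' : ℕ} (h : ∀ r : Pos n, r.place < k ↔ r.place < k') (a : K) :
    epsSum i c a k = epsSum i c a k' :=
  Finset.sum_congr rfl fun r _ => by simp only [h r]

/-- Moving `x_i` through the part `l` of the longest word that starts at the place `k` replaces the
coordinates by `actCoord`. The parameter of `x_i` before this part is `(a - 1) α_i(t_l) / D_k`, with
`t_l` the torus part of `yProd c l` and `D_k` the sum `epsSum`. -/
lemma xOne_mul_yProd (hc : ∀ q, c q ≠ 0) {a : K} (hD : ∀ k, epsSum i c a k ≠ 0) {N : ℕ}
    (hN : ∀ q : Pos n, q.place < N) (l : List (Pos n)) :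
    ∀ (pre : List (Pos n)) (k : ℕ), longWord n = pre ++ l → (∀ q, q ∈ l ↔ k ≤ q.place) →
      xOne i ((a - 1) * rootProd i c l / epsSum i c a k) * yProd c l =
        yProd (actCoord i c a) l * xOne i ((a - 1) / epsSum i c a N) := by
  induction l with
  | nil =>
    intro pre k _ hk
    have e : epsSum i c a k = epsSum i c a N := by
      refine epsSum_congr (fun r => ?_) a
      have := (hk r).not.1 (by simp)
      have := hN r
      omega
    simp [yProd, rootProd, e]
  | cons q l ih =>
    intro pre k hl hk
    have e : epsSum i c a k = epsSum i c a q.place := by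
      refine epsSum_congr (fun r => ?_) a
      have h1 := mem_suffix_iff hl r
      have h2 := hk r
      rw [List.mem_cons, h1] at h2
      constructor
      · intro h3
        by_contra h4
        have h5 := h2.not.2 (by omega)
        push Not at h5
        exact h5.1 (Pos.place_injective (by omega))
      · intro h3
        by_contra h4
        rcases h2.2 (by omega) with h5 | h5
        · rw [h5] at h3; omega
        · omega
    have ih' := ih (pre ++ [q]) (q.place + 1) (by simp [hl])
      (fun r => by rw [mem_suffix_iff hl r]; rfl)
    have hcons : ∀ f : Pos n → K, yProd f (q :: l) = yBold q.letter (f q) * yProd f l :=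
      fun f => by simp [yProd]
    have hroot : rootProd i c (q :: l) =
        c q ^ (-CartanMatrix.A n i q.letter) * rootProd i c l := by simp [rootProd]
    have hcq := hc q
    have hDq := hD q.place
    rw [hcons, hcons, mul_assoc, ← ih', ← mul_assoc, ← mul_assoc, e, hroot]
    congr 1
    by_cases hq : q.letter = i
    · have hDs := hD (q.place + 1)
      have hstep := epsSum_succ_of_eq (c := c) hq a
      rw [epsTerm_eq hl] at hstep
      rw [hq, show CartanMatrix.A n i i = 2 by simp [CartanMatrix.A], actCoord, if_pos hq]
      have hz : 1 + (a - 1) * (c q ^ (-2 : ℤ) * rootProd i c l) / epsSum i c a q.place * c q =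
          epsSum i c a (q.place + 1) / epsSum i c a q.place := by
        rw [hstep, zpow_neg, zpow_ofNat]
        field_simp
      rw [xOne_mul_yBold_self i hcq (by rw [hz]; exact div_ne_zero hDs hDq), hz]
      congr 2
      · field_simp
      · rw [zpow_neg, zpow_ofNat]
        field_simp
    · rw [xOne_mul_yBold_of_ne (Ne.symm hq) _ hcq, epsSum_succ_of_ne hq, actCoord, if_neg hq]
      congr 2
      rw [zpow_neg]
      have := zpow_ne_zero (CartanMatrix.A n i q.letter) hcq
      field_simp

/-! ### The functions `γ_i` and `ε_i` in the chart -/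

lemma yBold_lower (j : Fin n) {z : K} (hz : z ≠ 0) (a b : Fin (n + 1)) (h : a < b) :
    yBold j z a b = 0 := by
  rw [yBold_apply j hz]
  grind

lemma mul_apply_of_lower {X Y : Matrix (Fin (n + 1)) (Fin (n + 1)) K}
    (hX : ∀ a b, a < b → X a b = 0) (hY : ∀ a b, a < b → Y a b = 0) :
    (∀ a b, a < b → (X * Y) a b = 0) ∧ (∀ a, (X * Y) a a = X a a * Y a a) ∧
      ∀ i : Fin n, (X * Y) i.succ i.castSucc =
        X i.succ i.castSucc * Y i.castSucc i.castSucc + X i.succ i.succ * Y i.succ i.castSucc := by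
  have hX' : ∀ i j, j < i → X.transpose i j = 0 := fun i j h => hX j i h
  have hY' : ∀ i j, j < i → Y.transpose i j = 0 := fun i j h => hY j i h
  have ht : ∀ a b, (X * Y) a b = (Y.transpose * X.transpose) b a := fun a b => by
    rw [← Matrix.transpose_mul]; rfl
  refine ⟨fun a b h => ?_, fun a => ?_, fun i => ?_⟩
  · rw [ht]
    exact Matrix.BlockTriangular.mul (b := id) (fun i j h => hY' i j h) (fun i j h => hX' i j h) h
  · rw [ht, mul_apply_self_of_upper hY' hX']
    simp only [Matrix.transpose_apply]
    ring
  · rw [ht, mul_apply_succ_of_upper hY' hX']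
    simp only [Matrix.transpose_apply]
    ring

lemma yProd_lower (hc : ∀ q, c q ≠ 0) (l : List (Pos n)) (a b : Fin (n + 1)) (h : a < b) :
    yProd c l a b = 0 := by
  induction l generalizing a b with
  | nil => simp [yProd, h.ne]
  | cons q l ih =>
    have : yProd c (q :: l) = yBold q.letter (c q) * yProd c l := by simp [yProd]
    rw [this]
    exact (mul_apply_of_lower (yBold_lower _ (hc q)) ih).1 a b h

lemma yProd_diag_ne_zero (hc : ∀ q, c q ≠ 0) (l : List (Pos n)) (a : Fin (n + 1)) :
    yProd c l a a ≠ 0 := by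
  induction l with
  | nil => simp [yProd]
  | cons q l ih =>
    have : yProd c (q :: l) = yBold q.letter (c q) * yProd c l := by simp [yProd]
    rw [this, (mul_apply_of_lower (yBold_lower _ (hc q)) (yProd_lower hc l)).2.1]
    refine mul_ne_zero ?_ ih
    rw [yBold_apply _ (hc q), if_pos rfl]
    have := hc q
    split_ifs <;> simp [this]

lemma yBold_castSucc (j : Fin n) {z : K} (hz : z ≠ 0) :
    yBold j z i.castSucc i.castSucc =
      z ^ (-CartanMatrix.A n i j) * yBold j z i.succ i.succ := by
  rw [cartanMatrix_A_apply, yBold_apply j hz, yBold_apply j hz]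
  simp only [Fin.val_castSucc, Fin.val_succ]
  by_cases h1 : (i : ℕ) = j
  · simp only [h1, if_true]
    rw [if_neg (by omega), zpow_neg, zpow_ofNat]
    field_simp
  · by_cases h2 : (i : ℕ) + 1 = j ∨ (j : ℕ) + 1 = i
    · simp only [h1, h2, if_true, if_false, neg_neg, zpow_one]
      grind
    · simp only [h1, h2, if_false, neg_zero, zpow_zero, one_mul, if_true]
      grind

lemma yProd_castSucc (hc : ∀ q, c q ≠ 0) (l : List (Pos n)) :
    yProd c l i.castSucc i.castSucc = rootProd i c l * yProd c l i.succ i.succ := by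
  induction l with
  | nil => simp [yProd, rootProd]
  | cons q l ih =>
    have h1 : yProd c (q :: l) = yBold q.letter (c q) * yProd c l := by simp [yProd]
    have hroot : rootProd i c (q :: l) =
        c q ^ (-CartanMatrix.A n i q.letter) * rootProd i c l := by simp [rootProd]
    have h2 := (mul_apply_of_lower (yBold_lower q.letter (hc q)) (yProd_lower hc l)).2.1
    rw [h1, h2, h2, ih, yBold_castSucc _ (hc q), hroot]
    ring

/-- The quotient of the two entries in row `i + 1` is the sum of the terms of `1 / ε_i` in `l`. -/
lemma yProd_succ_castSucc (hc : ∀ q, c q ≠ 0) (l : List (Pos n)) :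
    ∀ pre : List (Pos n), longWord n = pre ++ l → yProd c l i.succ i.castSucc =
      (l.map fun q => if q.letter = i then epsTerm i c q else 0).sum *
        yProd c l i.succ i.succ := by
  induction l with
  | nil =>
    intro pre _
    simp [yProd, Fin.ext_iff]
  | cons q l ih =>
    intro pre hl
    have ih' := ih (pre ++ [q]) (by simp [hl])
    have h1 : yProd c (q :: l) = yBold q.letter (c q) * yProd c l := by simp [yProd]
    obtain ⟨-, h2, h3⟩ := mul_apply_of_lower (yBold_lower q.letter (hc q)) (yProd_lower hc l)
    rw [h1, h2, h3, ih', yProd_castSucc hc, List.map_cons, List.sum_cons, epsTerm_eq hl]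
    have h4 : yBold q.letter (c q) i.succ i.castSucc =
        if q.letter = i then (c q)⁻¹ * yBold q.letter (c q) i.succ i.succ else 0 := by
      have h5 := hc q
      rw [yBold_apply _ h5, yBold_apply _ h5]
      simp only [Fin.val_castSucc, Fin.val_succ, Fin.ext_iff]
      by_cases h : (q.letter : ℕ) = i
      · simp [h, h5]
      · rw [if_neg (by omega), if_neg (by omega), if_neg h]
    rw [h4]
    split_ifs with h <;> ring

lemma sum_longWord (f : Pos n → K) : ((longWord n).map f).sum = ∑ q, f q := by
  classical
  have hn : (longWord n).Nodup := nodup_suffix (pre := []) (l := longWord n) rfl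
  rw [← List.sum_toFinset f hn]
  refine Finset.sum_congr ?_ fun _ _ => rfl
  ext q
  simp [mem_longWord]

lemma prod_longWord (f : Pos n → K) : ((longWord n).map f).prod = ∏ q, f q := by
  classical
  have hn : (longWord n).Nodup := nodup_suffix (pre := []) (l := longWord n) rfl
  rw [← List.prod_toFinset f hn]
  refine Finset.prod_congr ?_ fun _ _ => rfl
  ext q
  simp [mem_longWord]

/-- The coordinates of a point of the torus as elements of the field. -/
def coordVal (p : TorusPt n K) (q : Pos n) : K := p.2 q

lemma coordVal_ne_zero (p : TorusPt n K) (q : Pos n) : coordVal p q ≠ 0 := Units.ne_zero _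

lemma chart_eq_yProd (p : TorusPt n K) :
    chart p = Matrix.diagonal (fun k => (p.1 k : K)) * yProd (coordVal p) (longWord n) := rfl

lemma chart_diag_ne_zero (p : TorusPt n K) (a : Fin (n + 1)) : chart p a a ≠ 0 := by
  rw [chart_eq_yProd, Matrix.diagonal_mul]
  exact mul_ne_zero (Units.ne_zero _) (yProd_diag_ne_zero (coordVal_ne_zero p) _ _)

lemma epsSum_one (a : K) : epsSum i c a 0 = ∑ q : Pos n with q.letter = i, epsTerm i c q := by
  simp [epsSum]

lemma chart_succ_castSucc (p : TorusPt n K) (a : K) :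
    chart p i.succ i.castSucc = epsSum i (coordVal p) a 0 * chart p i.succ i.succ := by
  rw [chart_eq_yProd, Matrix.diagonal_mul, Matrix.diagonal_mul,
    yProd_succ_castSucc (coordVal_ne_zero p) (longWord n) [] rfl, sum_longWord, epsSum_one,
    Finset.sum_filter]
  ring

lemma epsFun_chart (p : TorusPt n K) (a : K) :
    epsFun i (chart p) = (epsSum i (coordVal p) a 0)⁻¹ := by
  have h := chart_diag_ne_zero p i.succ
  rw [epsFun, chart_succ_castSucc p a, mul_comm, div_mul_cancel_left₀ h]

lemma gammaFun_chart (p : TorusPt n K) :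
    gammaFun i (chart p) =
      (p.1 i.castSucc : K) / p.1 i.succ * rootProd i (coordVal p) (longWord n) := by
  have h := yProd_diag_ne_zero (coordVal_ne_zero p) (longWord n) i.succ
  have h2 := Units.ne_zero (p.1 i.succ)
  rw [gammaFun, chart_eq_yProd, Matrix.diagonal_mul, Matrix.diagonal_mul,
    yProd_castSucc (coordVal_ne_zero p)]
  field_simp

/-- The action `e_i^a` in the chart. -/
lemma eAct_chart (p p' : TorusPt n K) {a : K} (ha : a ≠ 0)
    (hD : ∀ k, epsSum i (coordVal p) a k ≠ 0) (h1 : p'.1 = p.1)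
    (h2 : coordVal p' = actCoord i (coordVal p) a) : eAct i a (chart p) = chart p' := by
  have hc := coordVal_ne_zero p
  have hD0 := hD 0
  obtain ⟨N, hN⟩ : ∃ N, ∀ q : Pos n, q.place < N := by
    refine ⟨(Finset.univ : Finset (Pos n)).sup Pos.place + 1, fun q => ?_⟩
    exact Nat.lt_succ_of_le (Finset.le_sup (f := Pos.place) (Finset.mem_univ q))
  have hDN : epsSum i (coordVal p) a N = a * epsSum i (coordVal p) a 0 := by
    rw [epsSum, epsSum, Finset.mul_sum]
    refine Finset.sum_congr rfl fun q _ => ?_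
    rw [if_pos (hN q), if_neg (by omega), one_mul]
  have hmove := xOne_mul_yProd hc hD hN (longWord n) [] 0 rfl
    (fun q => by simp [mem_longWord])
  have ht1 := Units.ne_zero (p.1 i.castSucc)
  have ht2 := Units.ne_zero (p.1 i.succ)
  have hne : chart p i.succ i.castSucc ≠ 0 := by
    rw [chart_succ_castSucc p a]
    exact mul_ne_zero hD0 (chart_diag_ne_zero p _)
  have hz : (p.1 i.succ : K) / p.1 i.castSucc * ((a - 1) * phiFun i (chart p)) =
      (a - 1) * rootProd i (coordVal p) (longWord n) / epsSum i (coordVal p) a 0 := by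
    rw [phiFun, epsFun_chart p a, gammaFun_chart]
    field_simp
  have hz' : (a - 1) / epsSum i (coordVal p) a N + (a⁻¹ - 1) * epsFun i (chart p) = 0 := by
    rw [hDN, epsFun_chart p a]
    field_simp
    ring
  rw [eAct, if_neg hne]
  generalize (a - 1) * phiFun i (chart p) = z at hz
  generalize (a⁻¹ - 1) * epsFun i (chart p) = z' at hz'
  rw [chart_eq_yProd, ← mul_assoc, xOne_mul_diagonal, hz, mul_assoc (Matrix.diagonal _), hmove,
    mul_assoc, mul_assoc, xOne_mul_xOne, hz', xOne_zero, mul_one, chart_eq_yProd p', h1, h2]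

end Geometric

section UltraDiscretization

/-! ### The order of vanishing of sums of powers of `c` -/

lemma ordZero_eq_of_eq_div {f : RatFunc ℂ} {p q : Polynomial ℂ} (hp : p ≠ 0) (hq : q ≠ 0)
    (h : f = algebraMap (Polynomial ℂ) (RatFunc ℂ) p / algebraMap (Polynomial ℂ) (RatFunc ℂ) q) :
    ordZero f = (p.rootMultiplicity 0 : ℤ) - q.rootMultiplicity 0 := by
  have hden := f.denom_ne_zero
  have h1 := (RatFunc.num_mul_eq_mul_denom_iff hq).2 h
  have h2 : p * f.denom ≠ 0 := mul_ne_zero hp hden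
  have h3 := congrArg (Polynomial.rootMultiplicity 0) h1
  rw [Polynomial.rootMultiplicity_mul h2, Polynomial.rootMultiplicity_mul (h1 ▸ h2)] at h3
  rw [ordZero]
  omega

lemma ordZero_mul {f g : RatFunc ℂ} (hf : f ≠ 0) (hg : g ≠ 0) :
    ordZero (f * g) = ordZero f + ordZero g := by
  have hnf := RatFunc.num_ne_zero hf
  have hng := RatFunc.num_ne_zero hg
  have hdf := f.denom_ne_zero
  have hdg := g.denom_ne_zero
  rw [ordZero_eq_of_eq_div (p := f.num * g.num) (q := f.denom * g.denom)
      (mul_ne_zero hnf hng) (mul_ne_zero hdf hdg), ordZero, ordZero,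
    Polynomial.rootMultiplicity_mul (mul_ne_zero hnf hng),
    Polynomial.rootMultiplicity_mul (mul_ne_zero hdf hdg)]
  · push_cast
    ring
  · conv_lhs => rw [← RatFunc.num_div_denom f, ← RatFunc.num_div_denom g]
    rw [map_mul, map_mul, div_mul_div_comm]

lemma ordZero_algebraMap {p : Polynomial ℂ} (hp : p ≠ 0) :
    ordZero (algebraMap (Polynomial ℂ) (RatFunc ℂ) p) = p.rootMultiplicity 0 := by
  rw [ordZero_eq_of_eq_div hp one_ne_zero (by simp),
    Polynomial.rootMultiplicity_eq_zero (p := 1) (by simp)]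
  simp

lemma ordZero_one : ordZero 1 = 0 := by simp [ordZero]

lemma ordZero_inv {f : RatFunc ℂ} (hf : f ≠ 0) : ordZero f⁻¹ = -ordZero f := by
  have h := ordZero_mul hf (inv_ne_zero hf)
  rw [mul_inv_cancel₀ hf, ordZero_one] at h
  omega

lemma ordZero_div {f g : RatFunc ℂ} (hf : f ≠ 0) (hg : g ≠ 0) :
    ordZero (f / g) = ordZero f - ordZero g := by
  rw [div_eq_mul_inv, ordZero_mul hf (inv_ne_zero hg), ordZero_inv hg, sub_eq_add_neg]

lemma X_zpow_ne_zero (k : ℤ) : (RatFunc.X : RatFunc ℂ) ^ k ≠ 0 := zpow_ne_zero k RatFunc.X_ne_zero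

lemma ordZero_X_zpow (k : ℤ) : ordZero (RatFunc.X ^ k) = k := by
  have hX : ordZero RatFunc.X = 1 := by
    rw [← RatFunc.algebraMap_X, ordZero_algebraMap Polynomial.X_ne_zero]
    have := Polynomial.rootMultiplicity_X_sub_C_self (x := (0 : ℂ))
    rw [map_zero, sub_zero] at this
    simp [this]
  induction k with
  | zero => simp [ordZero_one]
  | succ k ih => rw [zpow_add_one₀ RatFunc.X_ne_zero,
      ordZero_mul (X_zpow_ne_zero _) RatFunc.X_ne_zero, ih, hX]
  | pred k ih => rw [sub_eq_add_neg, zpow_add₀ RatFunc.X_ne_zero,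
      ordZero_mul (X_zpow_ne_zero _) (X_zpow_ne_zero _), ih, zpow_neg_one,
      ordZero_inv RatFunc.X_ne_zero, hX]

lemma prod_X_zpow {ι : Type*} (s : Finset ι) (e : ι → ℤ) :
    ∏ i ∈ s, (RatFunc.X : RatFunc ℂ) ^ e i = RatFunc.X ^ ∑ i ∈ s, e i := by
  classical
  induction s using Finset.induction_on with
  | empty => simp
  | insert a s ha ih =>
    rw [Finset.prod_insert ha, Finset.sum_insert ha, ih, zpow_add₀ RatFunc.X_ne_zero]

/-- A sum of powers of `c` has no cancellation at `c = 0`, because the coefficient of its lowest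
power is a positive integer. -/
lemma ordZero_sum_X_zpow {ι : Type*} {s : Finset ι} {e : ι → ℤ} {k : ℤ}
    (hle : ∀ i ∈ s, k ≤ e i) (hk : ∃ i ∈ s, e i = k) :
    ∑ i ∈ s, (RatFunc.X : RatFunc ℂ) ^ e i ≠ 0 ∧
      ordZero (∑ i ∈ s, (RatFunc.X : RatFunc ℂ) ^ e i) = k := by
  set p : Polynomial ℂ := ∑ i ∈ s, Polynomial.X ^ (e i - k).toNat with hp
  have hsum : ∑ i ∈ s, (RatFunc.X : RatFunc ℂ) ^ e i =
      RatFunc.X ^ k * algebraMap (Polynomial ℂ) (RatFunc ℂ) p := by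
    rw [hp, map_sum, Finset.mul_sum]
    refine Finset.sum_congr rfl fun i hi => ?_
    rw [map_pow, RatFunc.algebraMap_X, ← zpow_natCast, ← zpow_add₀ RatFunc.X_ne_zero]
    congr 1
    have := hle i hi
    omega
  have heval : p.eval 0 ≠ 0 := by
    have h1 : p.eval 0 = ((s.filter fun i => e i = k).card : ℂ) := by
      rw [hp, Polynomial.eval_finsetSum, Finset.card_filter, Nat.cast_sum]
      refine Finset.sum_congr rfl fun i hi => ?_
      have := hle i hi
      by_cases h : e i = k
      · simp [h]
      · have h2 : (e i - k).toNat ≠ 0 := by omega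
        simp [h, h2]
    rw [h1, Nat.cast_ne_zero, Finset.card_ne_zero]
    obtain ⟨i, hi, hik⟩ := hk
    exact ⟨i, by simp [hi, hik]⟩
  have hp0 : p ≠ 0 := fun h => heval (by simp [h])
  have hp1 : algebraMap (Polynomial ℂ) (RatFunc ℂ) p ≠ 0 := RatFunc.algebraMap_ne_zero hp0
  rw [hsum]
  refine ⟨mul_ne_zero (X_zpow_ne_zero k) hp1, ?_⟩
  rw [ordZero_mul (X_zpow_ne_zero k) hp1, ordZero_X_zpow, ordZero_algebraMap hp0,
    Polynomial.rootMultiplicity_eq_zero heval]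
  simp

lemma zero_le_ordZero_sum_iff {ι : Type*} {s : Finset ι} (hs : s.Nonempty) (e : ι → ℤ) :
    0 ≤ ordZero (∑ i ∈ s, (RatFunc.X : RatFunc ℂ) ^ e i) ↔ ∀ i ∈ s, 0 ≤ e i := by
  obtain ⟨i, hi, hmin⟩ := Finset.exists_min_image s e hs
  rw [(ordZero_sum_X_zpow hmin ⟨i, hi, rfl⟩).2]
  exact ⟨fun h j hj => h.trans (hmin j hj), fun h => h i hi⟩

/-! ### Ultra-discretization of the functions on the chart -/

variable {n : ℕ}

lemma val_cUnit_zpow (k : ℤ) : ((cUnit ^ k : (RatFunc ℂ)ˣ) : RatFunc ℂ) = RatFunc.X ^ k := by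
  rw [Units.val_zpow_eq_zpow_val]
  rfl

lemma coordVal_toPt (ξ : Cochar n) (q : Pos n) : coordVal ξ.toPt q = RatFunc.X ^ ξ.2 q :=
  val_cUnit_zpow _

lemma udGamma_eq (i : Fin n) (ξ : Cochar n) :
    udGamma i ξ = ξ.1 i.castSucc - ξ.1 i.succ -
      ∑ q : Pos n, CartanMatrix.A n i q.letter * ξ.2 q := by
  have h1 : rootProd i (coordVal ξ.toPt) (longWord n) =
      RatFunc.X ^ (-∑ q : Pos n, CartanMatrix.A n i q.letter * ξ.2 q) := by
    rw [rootProd, prod_longWord, ← Finset.sum_neg_distrib, ← prod_X_zpow]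
    refine Finset.prod_congr rfl fun q _ => ?_
    rw [coordVal_toPt, ← zpow_mul]
    congr 1
    ring
  rw [udGamma, gammaFun_chart, h1]
  simp only [Cochar.toPt, val_cUnit_zpow]
  rw [ordZero_mul (div_ne_zero (X_zpow_ne_zero _) (X_zpow_ne_zero _)) (X_zpow_ne_zero _),
    ordZero_div (X_zpow_ne_zero _) (X_zpow_ne_zero _), ordZero_X_zpow, ordZero_X_zpow,
    ordZero_X_zpow]
  ring

lemma cEntry_toPt (ξ : Cochar n) (j b : ℕ) :
    cEntry ξ.toPt.2 j b = RatFunc.X ^ grid n (extendZero ξ.2) j b := by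
  rw [cEntry, grid_extendZero]
  split_ifs
  · exact val_cUnit_zpow _
  · simp

section

variable [NeZero n]

/-- Non-negativity of the ultra-discretized decoration is the system of inequalities which defines
the triangular families. -/
lemma zero_le_udDecoration_iff {lam : Fin n → ℤ} (ξ : Cochar n)
    (hl : ∀ i : Fin n, ξ.1 i.castSucc - ξ.1 i.succ = lam i) :
    0 ≤ udDecoration ξ ↔ ξ.2 ∈ triangleSet n lam := by
  set g := grid n (extendZero ξ.2) with hg
  have hdec : decoration (chart ξ.toPt) =
      ∑ z ∈ ((Finset.univ : Finset (Fin n)).sigma fun i => Finset.range ((i : ℕ) + 1)).disjSum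
          ((Finset.univ : Finset (Fin n)).sigma fun i => Finset.range ((i : ℕ) + 1)),
        (RatFunc.X : RatFunc ℂ) ^ (Sum.elim
          (fun a : Σ _ : Fin n, ℕ => g (n - 1 - (a.1 : ℕ)) (a.2 + 1) - g (n - a.1) a.2)
          (fun a : Σ _ : Fin n, ℕ => lam a.1 + (g a.2 (a.1 - a.2) - g a.2 (a.1 - a.2 + 1))) z) := by
    rw [Finset.sum_disjSum, Finset.sum_sigma, Finset.sum_sigma]
    have hX : (RatFunc.X : RatFunc ℂ) ≠ 0 := RatFunc.X_ne_zero
    refine (decoration_chart ξ.toPt.1 ξ.toPt.2).trans ?_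
    simp only [cEntry_toPt, Sum.elim_inl, Sum.elim_inr, ← hl, zpow_add₀ hX, zpow_sub₀ hX, hg]
    simp only [Cochar.toPt, val_cUnit_zpow]
  have hne : (((Finset.univ : Finset (Fin n)).sigma fun i => Finset.range ((i : ℕ) + 1)).disjSum
      ((Finset.univ : Finset (Fin n)).sigma fun i => Finset.range ((i : ℕ) + 1))).Nonempty :=
    ⟨Sum.inl ⟨0, 0⟩, by simp⟩
  rw [udDecoration, hdec, zero_le_ordZero_sum_iff hne, mem_triangleSet_iff]
  simp only [Sum.forall, Finset.inl_mem_disjSum, Finset.inr_mem_disjSum, Sum.elim_inl,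
    Sum.elim_inr, Sigma.forall, Finset.mem_sigma, Finset.mem_univ, true_and, Finset.mem_range]
  refine and_congr ⟨fun h j b hb hjb => ?_, fun h i k hk => ?_⟩
    ⟨fun h i j hj => ?_, fun h i j hj => ?_⟩
  · have := h ⟨n - 1 - j, by omega⟩ (b - 1) (by simp only; omega)
    simp only at this
    rw [show n - 1 - (n - 1 - j) = j by omega, show n - (n - 1 - j) = j + 1 by omega,
      show b - 1 + 1 = b by omega] at this
    linarith
  · have hi := i.isLt
    have := h (n - 1 - i) (k + 1) (by omega) (by omega)
    rw [show n - 1 - (i : ℕ) + 1 = n - i by omega, Nat.add_sub_cancel] at this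
    linarith
  · have := h i j (by omega)
    linarith
  · have := h i j (by omega)
    linarith

lemma epsTerm_toPt {i : Fin n} (ξ : Cochar n) {q : Pos n} (hq : q.letter = i) :
    epsTerm i (coordVal ξ.toPt) q = RatFunc.X ^ (-sigmaVal n (extendZero ξ.2) q.place) := by
  have h : ∏ r : Pos n with q.place < r.place,
      coordVal ξ.toPt r ^ (-CartanMatrix.A n i r.letter) =
      RatFunc.X ^ ∑ r : Pos n with q.place < r.place, -(CartanMatrix.A n i r.letter * ξ.2 r) := by
    rw [← prod_X_zpow]
    refine Finset.prod_congr rfl fun r _ => ?_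
    rw [coordVal_toPt, ← zpow_mul]
    congr 1
    ring
  rw [epsTerm, h, coordVal_toPt, ← zpow_neg, ← zpow_add₀ RatFunc.X_ne_zero, sigmaVal_extendZero, hq,
    Finset.sum_neg_distrib]
  congr 1
  ring

lemma epsSum_toPt (i : Fin n) (ξ : Cochar n) (m : ℤ) (k : ℕ) :
    epsSum i (coordVal ξ.toPt) (RatFunc.X ^ m) k = ∑ q : Pos n with q.letter = i,
      RatFunc.X ^ ((if q.place < k then m else 0) - sigmaVal n (extendZero ξ.2) q.place) := by
  refine Finset.sum_congr rfl fun q hq => ?_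
  rw [epsTerm_toPt ξ (by simpa using hq), sub_eq_add_neg, zpow_add₀ RatFunc.X_ne_zero]
  split_ifs <;> simp

/-- The hypothesis says that, for every threshold `k`, the minimum of the exponents in
`epsSum` is attained at `p`. -/
lemma ordZero_epsSum {i : Fin n} {ξ : Cochar n} {p : Pos n} {m : ℤ} (hp : p.letter = i)
    (hmin : ∀ (k : ℕ) (q : Pos n), q.letter = i →
      (if p.place < k then m else 0) - sigmaVal n (extendZero ξ.2) p.place ≤
        (if q.place < k then m else 0) - sigmaVal n (extendZero ξ.2) q.place) (k : ℕ) :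
    epsSum i (coordVal ξ.toPt) (RatFunc.X ^ m) k ≠ 0 ∧
      ordZero (epsSum i (coordVal ξ.toPt) (RatFunc.X ^ m) k) =
        (if p.place < k then m else 0) - sigmaVal n (extendZero ξ.2) p.place := by
  rw [epsSum_toPt]
  exact ordZero_sum_X_zpow (fun q hq => hmin k q (by simpa using hq)) ⟨p, by simpa using hp, rfl⟩

/-- If the minimum over all positions with letter `i` is attained at `p` for every threshold `k`, then
the orders of `epsSum` at consecutive thresholds differ only at `p`, by `m`. -/
lemma udE_eq {i : Fin n} {ξ : Cochar n} {p : Pos n} {m : ℤ} (hp : p.letter = i)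
    (hmin : ∀ (k : ℕ) (q : Pos n), q.letter = i →
      (if p.place < k then m else 0) - sigmaVal n (extendZero ξ.2) p.place ≤
        (if q.place < k then m else 0) - sigmaVal n (extendZero ξ.2) q.place) :
    udE i m ξ = (ξ.1, ξ.2 - Pi.single p m) := by
  have hD := ordZero_epsSum hp hmin
  have hne : ∀ q, actCoord i (coordVal ξ.toPt) (RatFunc.X ^ m) q ≠ 0 := by
    intro q
    rw [actCoord]
    split_ifs
    · exact div_ne_zero (mul_ne_zero (coordVal_ne_zero _ _) (hD _).1) (hD _).1
    · exact coordVal_ne_zero _ _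
  have hact : eChart i ((cUnit ^ m : (RatFunc ℂ)ˣ) : RatFunc ℂ) ξ.toPt =
      (ξ.toPt.1, fun q => Units.mk0 _ (hne q)) := by
    rw [eChart, val_cUnit_zpow, eAct_chart ξ.toPt (ξ.toPt.1, fun q => Units.mk0 _ (hne q))
      (X_zpow_ne_zero m) (fun k => (hD k).1) rfl rfl, chartInv_chart]
  rw [udE, hact]
  refine Prod.ext (funext fun k => ?_) (funext fun q => ?_)
  · simp only [Cochar.toPt, val_cUnit_zpow, ordZero_X_zpow]
  · simp only [Units.val_mk0, Pi.sub_apply, Pi.single_apply, actCoord]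
    have hq := coordVal_ne_zero ξ.toPt q
    split_ifs with h1 h2 h2
    · subst h2
      rw [ordZero_div (mul_ne_zero hq (hD _).1) (hD _).1, ordZero_mul hq (hD _).1, (hD _).2,
        (hD _).2, coordVal_toPt, ordZero_X_zpow, if_neg (lt_irrefl _), if_pos (Nat.lt_succ_self _)]
      ring
    · have h3 : q.place ≠ p.place := fun h => h2 (Pos.place_injective h)
      rw [ordZero_div (mul_ne_zero hq (hD _).1) (hD _).1, ordZero_mul hq (hD _).1, (hD _).2,
        (hD _).2, coordVal_toPt, ordZero_X_zpow]
      rw [if_congr (show p.place < q.place + 1 ↔ p.place < q.place by omega) rfl rfl]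
      ring
    · exact absurd (h2 ▸ hp) h1
    · rw [coordVal_toPt, ordZero_X_zpow, sub_zero]

lemma udE_one {i : Fin n} {ξ : Cochar n} {p : Pos n}
    (hp : IsLastArgmax (fun q => sigmaVal n (extendZero ξ.2) q.place) i p) :
    udE i 1 ξ = (ξ.1, ξ.2 - Pi.single p 1) := by
  refine udE_eq hp.letter fun k q hq => ?_
  have h1 := hp.le q hq
  have h2 := hp.lt q hq
  split_ifs <;> omega

lemma udE_neg_one {i : Fin n} {ξ : Cochar n} {p : Pos n}
    (hp : IsFirstArgmax (fun q => sigmaVal n (extendZero ξ.2) q.place) i p) :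
    udE i (-1) ξ = (ξ.1, ξ.2 + Pi.single p 1) := by
  have h : udE i (-1) ξ = (ξ.1, ξ.2 - Pi.single p (-1)) := by
    refine udE_eq hp.letter fun k q hq => ?_
    have h1 := hp.le q hq
    have h2 := hp.lt q hq
    split_ifs <;> omega
  rw [h, Pi.single_neg, sub_neg_eq_add]

lemma udEps_eq {i : Fin n} {ξ : Cochar n} {p : Pos n} (hp : p.letter = i)
    (hmax : ∀ q : Pos n, q.letter = i →
      sigmaVal n (extendZero ξ.2) q.place ≤ sigmaVal n (extendZero ξ.2) p.place) :
    udEps i ξ = sigmaVal n (extendZero ξ.2) p.place := by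
  obtain ⟨h1, h2⟩ := ordZero_epsSum (ξ := ξ) (m := 0) hp
    (fun k q hq => by simpa using hmax q hq) 0
  rw [udEps, epsFun_chart _ (RatFunc.X ^ (0 : ℤ)), ordZero_inv h1, h2]
  simp

end

end UltraDiscretization

section Comparison

/-! ### Comparison of the two crystals -/

variable {n : ℕ}

lemma exists_isLastArgmax (s : Pos n → ℤ) (i : Fin n) : ∃ p, IsLastArgmax s i p := by
  classical
  obtain ⟨p, hp, hmax⟩ := Finset.exists_max_image
    ((Finset.univ : Finset (Pos n)).filter fun q => q.letter = i)
    (fun q => toLex (s q, q.place)) ⟨lastPos i, by simp [lastPos_letter]⟩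
  simp only [Finset.mem_filter, Finset.mem_univ, true_and, Prod.Lex.toLex_le_toLex] at hp hmax
  refine ⟨p, hp, fun q hq => ?_, fun q hq hlt => ?_⟩
  · rcases hmax q hq with h | h
    · exact h.le
    · exact h.1.le
  · rcases hmax q hq with h | h
    · exact h
    · exact absurd h.2 (by omega)

lemma exists_isFirstArgmax (s : Pos n → ℤ) (i : Fin n) : ∃ p, IsFirstArgmax s i p := by
  classical
  obtain ⟨p, hp, hmax⟩ := Finset.exists_max_image
    ((Finset.univ : Finset (Pos n)).filter fun q => q.letter = i)
    (fun q => toLex (s q, OrderDual.toDual q.place)) ⟨lastPos i, by simp [lastPos_letter]⟩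
  simp only [Finset.mem_filter, Finset.mem_univ, true_and, Prod.Lex.toLex_le_toLex,
    OrderDual.toDual_le_toDual] at hp hmax
  refine ⟨p, hp, fun q hq => ?_, fun q hq hlt => ?_⟩
  · rcases hmax q hq with h | h
    · exact h.le
    · exact h.1.le
  · rcases hmax q hq with h | h
    · exact h
    · exact absurd h.2 (by omega)

lemma option_eq_map_of_forall {α β : Type*} (ψ : α ≃ β) {o : Option α} {o' : Option β}
    (h : ∀ a, o' = some (ψ a) ↔ o = some a) : o' = o.map ψ := by
  ext b
  obtain ⟨a, rfl⟩ := ψ.surjective b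
  rw [h, Option.map_eq_some_iff]
  exact ⟨fun h => ⟨a, h, rfl⟩, fun ⟨a', h, he⟩ => by rwa [← ψ.injective he]⟩

variable [NeZero n] {lam : Fin n → ℤ} {l : Fin (n + 1) → ℤ}

/-- Forgetting the fixed cocharacter `l` of `T` identifies the decorated set with the triangular
families. -/
def decoratedEquiv (hl : ∀ i : Fin n, l i.castSucc - l i.succ = lam i) :
    decoratedSet n l ≃ triangleSet n lam where
  toFun ξ := ⟨ξ.1.2,
    (zero_le_udDecoration_iff ξ.1 fun i => by rw [ξ.2.1]; exact hl i).1 ξ.2.2⟩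
  invFun x := ⟨(l, x.1), rfl, (zero_le_udDecoration_iff (l, x.1) hl).2 x.2⟩
  left_inv ξ := Subtype.ext (Prod.ext ξ.2.1.symm rfl)
  right_inv _ := rfl

lemma decoratedEquiv_isStrictMorphism (hl : ∀ i : Fin n, l i.castSucc - l i.succ = lam i) :
    IsStrictMorphism (decoratedCrystal n l) (sigmaCrystal n lam) (decoratedEquiv hl) := by
  have hwt : ∀ (ξ : decoratedSet n l) i, seqWt (CartanMatrix.A n) (periodicSeq n) lam
      (extendZero ξ.1.2) i = udGamma i ξ.1 := by
    intro ξ i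
    rw [seqWt_extendZero, udGamma_eq, ξ.2.1, hl]
  have heps : ∀ (ξ : decoratedSet n l) i, seqEps (CartanMatrix.A n) (periodicSeq n) lam i
      (extendZero ξ.1.2) = udEps i ξ.1 := by
    intro ξ i
    obtain ⟨p, hp⟩ := exists_isLastArgmax (fun q => sigmaVal n (extendZero ξ.1.2) q.place) i
    rw [udEps_eq hp.letter hp.le]
    exact ((mem_triangleSet_iff_inTriangle lam _).1 (decoratedEquiv hl ξ).2).seqEps_eq hp.letter
      hp.le
  -- the points of the decorated set are determined by their second components
  have hval : ∀ (ξ ξ' : decoratedSet n l) (y : Pos n → ℤ),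
      ((ξ.1.1, y) : Cochar n) = ξ'.1 ↔ ξ'.1.2 = y := fun ξ ξ' y =>
    ⟨fun h => by rw [← h], fun h => Prod.ext (ξ.2.1.trans ξ'.2.1.symm) h.symm⟩
  refine ⟨fun ξ => funext (hwt ξ), fun i ξ => ?_, fun i ξ => ?_, fun i ξ => ?_, fun i ξ => ?_⟩
  · exact congrArg (fun z : ℤ => (z : WithBot ℤ)) (heps ξ i)
  · exact congrArg (fun z : ℤ => (z : WithBot ℤ))
      ((congrArg₂ (· + ·) (hwt ξ i) (heps ξ i)).trans (add_comm _ _))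
  · refine option_eq_map_of_forall (decoratedEquiv hl) fun ξ' => ?_
    obtain ⟨p, hp⟩ := exists_isLastArgmax (fun q => sigmaVal n (extendZero ξ.1.2) q.place) i
    have h1 := CrystalData.induced_e_iff (C := udCrystal n) (S := decoratedSet n l)
      Subtype.val_injective i ξ ξ'
    have h2 := CrystalData.induced_e_iff (extendZero_subtype_injective lam) i
      (C := seqCrystal (CartanMatrix.A n) (periodicSeq n) lam)
      (decoratedEquiv hl ξ) (decoratedEquiv hl ξ')
    have h3 := triangle_e_iff lam (decoratedEquiv hl ξ).2 (decoratedEquiv hl ξ').2 hp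
    have h4 : (udCrystal n).e i ξ.1 = some ξ'.1 ↔ ξ'.1.2 = ξ.1.2 - Pi.single p 1 := by
      rw [← hval ξ ξ', ← udE_one hp]
      exact Option.some_inj
    exact h2.trans (h3.trans (h4.symm.trans h1.symm))
  · refine option_eq_map_of_forall (decoratedEquiv hl) fun ξ' => ?_
    obtain ⟨p, hp⟩ := exists_isFirstArgmax (fun q => sigmaVal n (extendZero ξ.1.2) q.place) i
    have h1 := CrystalData.induced_f_iff (C := udCrystal n) (S := decoratedSet n l)
      Subtype.val_injective i ξ ξ'
    have h2 := CrystalData.induced_f_iff (extendZero_subtype_injective lam) i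
      (C := seqCrystal (CartanMatrix.A n) (periodicSeq n) lam)
      (decoratedEquiv hl ξ) (decoratedEquiv hl ξ')
    have h3 := triangle_f_iff lam (decoratedEquiv hl ξ).2 (decoratedEquiv hl ξ').2 hp
    have h4 : (udCrystal n).f i ξ.1 = some ξ'.1 ↔ ξ'.1.2 = ξ.1.2 + Pi.single p 1 := by
      rw [← hval ξ ξ', ← udE_neg_one hp]
      exact Option.some_inj
    exact h2.trans (h3.trans (h4.symm.trans h1.symm))

end Comparison

end DecCrystal

theorem theorem5p2 (n : ℕ) [NeZero n] (lam : Fin n → ℤ) (hlam : ∀ i, 0 ≤ lam i)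
    (l : Fin (n + 1) → ℤ) (hl : ∀ i : Fin n, l i.castSucc - l i.succ = lam i) :
    (DecCrystal.decoratedCrystal n l).IsCrystal (CartanMatrix.A n) ∧
    (DecCrystal.sigmaCrystal n lam).IsCrystal (CartanMatrix.A n) ∧
    DecCrystal.Isomorphic (DecCrystal.decoratedCrystal n l) (DecCrystal.sigmaCrystal n lam) ∧
    -- `Σ_{ι_0}[λ]` is the polyhedral realization `Σ_ι[λ]`, strictly embedded in `ℤ^∞_ι[λ]`
    Set.InjOn DecCrystal.extendZero (DecCrystal.triangleSet n lam) ∧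
    DecCrystal.extendZero '' DecCrystal.triangleSet n lam =
      DecCrystal.polyhedral (CartanMatrix.A n) (DecCrystal.periodicSeq n) lam ∧
    DecCrystal.IsStrictMorphism (DecCrystal.sigmaCrystal n lam)
      (DecCrystal.seqCrystal (CartanMatrix.A n) (DecCrystal.periodicSeq n) lam)
      (fun x => DecCrystal.extendZero x.1) :=
  ⟨(DecCrystal.sigmaCrystal_isCrystal lam).of_isStrictMorphism
      (DecCrystal.decoratedEquiv_isStrictMorphism hl) (DecCrystal.decoratedEquiv hl).injective,
    DecCrystal.sigmaCrystal_isCrystal lam,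
    ⟨DecCrystal.decoratedEquiv hl, DecCrystal.decoratedEquiv_isStrictMorphism hl⟩,
    DecCrystal.extendZero_injective.injOn,
    DecCrystal.image_extendZero_triangleSet lam,
    DecCrystal.sigmaCrystal_isStrictMorphism lam⟩
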